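/- **Setting.** Let $X\subset\mathbb R^n$, $Y\subset\mathbb R^m$ be closed and convex, $F,f,g:\mathbb R^n\times\mathbb R^m\to\mathbb R$, $\varphi:=f+g$. For $\gamma>0$ put $$v_\gamma(x,y):=\inf_{\theta\in Y}\Big\{\varphi(x,\theta)+\tfrac1{2\gamma}\|\theta-y\|^2\Big\}.$$ For $\epsilon\ge 0$, $(\mathrm{VP})_\gamma^{\epsilon}$ is the problem $\min_{x\in X,\,y\in Y}F(x,y)$ s.t. $\varphi(x,y)-v_\gamma(x,y)\le\epsilon$. All norms are Euclidean, $\partial$ is the limiting (Mordukhovich) subdifferential, $\delta_S$ the indicator function of $S$ and $\mathcal N_S$ the normal cone. Since $g$ is prescribed only on $X\times Y$, $\partial_y g(x,y)$ means $\partial\big(g(x,\cdot)+\delta_Y\big)(y)$ and $\partial g$ means $\partial(g+\delta_{X\times Y})$; since $v_\gamma$ is considered on $X\times\mathbb R^m$, $\nabla v_\gamma$ is a gradient relative to $X\times\mathbb R^m$. A point $(\bar x,\bar y)\in X\times Y$ with $\varphi(\bar x,\bar y)-v_\gamma(\bar x,\bar y)\le\epsilon$ is a *KKT point* of $(\mathrm{VP})_\gamma^{\epsilon}$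 if for some $\lambda\ge0$ (with $v_\gamma$ differentiable at $(\bar x,\bar y)$ relative to $X\times\mathbb R^m$) $$0\in\nabla F(\bar x,\bar y)+\lambda\big(\nabla f(\bar x,\bar y)+\partial g(\bar x,\bar y)-\nabla v_\gamma(\bar x,\bar y)\big)+\mathcal N_{X\times Y}(\bar x,\bar y),\qquad \lambda\big(\varphi(\bar x,\bar y)-v_\gamma(\bar x,\bar y)-\epsilon\big)=0 .$$ **Assumptions.** 1. $F$ is continuously differentiable, $\underline F:=\inf_{X\times Y}F>-\infty$, and $\nabla_xF,\nabla_yF$ are $L_{F_x}$-, $L_{F_y}$-Lipschitz on $X\times Y$. 2. For each $x\in X$, $f(x,\cdot)$ and $g(x,\cdot)$ are convex on $Y$. 3. $f$ is continuously differentiable on $X\times Y$ with $\nabla_xf,\nabla_yf$ being $L_{f_x}$-, $L_{f_y}$-Lipschitz on $X\times Y$; $g$ is continuous on $X\times Y$, $\nabla_xg$ exists there, $\nabla_xg(\cdot,y)$ is $L_{g_1}$-Lipschitz on $X$ for each $y\in Y$, $\nabla_xg(x,\cdot)$ is $L_{g_2}$-Lipschitz on $Y$ for each $x\in X$; $f$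 and $g$ are $(\rho_{f_1},\rho_{f_2})$- and $(\rho_{g_1},\rho_{g_2})$-weakly convex on $X\times Y$ (i.e. $h+\frac{\rho_1}2\|x\|^2+\frac{\rho_2}2\|y\|^2$ is convex on $X\times Y$), all these constants being nonnegative. 4. There is $L_{g_y}$ with $\partial_yg(x',y)\subseteq\partial_yg(x,y)+L_{g_y}\|x-x'\|\mathbb B$ for all $x,x'\in X$, $y\in Y$, where $\mathbb B$ is the closed unit ball. **Algorithm (AGILS), run without a stopping test.** Parameters: $\gamma,\epsilon,\eta,p_0,\varrho_p,c_p,c_y,c_{\tilde y},\tau_0,p_\tau>0$ with $\gamma(\rho_{f_2}+\rho_{g_2})<1$, step sizes $\alpha_k,\beta_k$, tolerances $s_k\ge0$, $\tau_k:=\tau_0/(k+1)^{p_\tau}$. With $\tilde g(x,\cdot):=g(x,\cdot)+\delta_Y$ and $\operatorname{Prox}_h(w):=\arg\min_\theta\{h(\theta)+\frac12\|\theta-w\|^2\}$ let $$\mathcal G(\theta,x,y):=\big\|\theta-\operatorname{Prox}_{\eta\tilde g(x,\cdot)}\big(\theta-\eta(\nabla_yf(x,\theta)+(\theta-y)/\gamma)\big)\big\|.$$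 Start from $x^0\in X$, $y^0,\tilde y^0,\theta^0,\tilde\theta^0\in Y$, with $(x^{-1},y^{-1},\theta^{-1}):=(x^0,y^0,\tilde\theta^0)$. All inexact solutions $\theta^{k+1/2},\theta^{k+1},\tilde\theta^{k+1}$ below lie in $Y$. For $k=0,1,\dots$: - $d_y^k=\frac1{p_k}\nabla_yF(x^k,\tilde y^k)+\nabla_yf(x^k,\tilde y^k)-\frac1\gamma(\tilde y^k-\tilde\theta^k)$ and $y^{k+1}=\operatorname{Prox}_{\beta_k\tilde g(x^k,\cdot)}(\tilde y^k-\beta_kd_y^k)$. - Choose $\theta^{k+1/2}$ with $\mathcal G(\theta^{k+1/2},x^k,y^{k+1})\le\max\{s_k,\tau_k\mathcal G(\theta^{k-1},x^{k-1},y^{k-1})\}$. - $d_x^k=\frac1{p_k}\nabla_xF(x^k,y^{k+1})+\nabla_x\varphi(x^k,y^{k+1})-\nabla_xf(x^k,\theta^{k+1/2})-\nabla_xg(x^k,\theta^{k+1/2})$ and $x^{k+1}=\operatorname{Proj}_X(x^k-\alpha_kd_x^k)$. - Choose $\theta^{k+1}$ with $\mathcal G(\theta^{k+1},x^{k+1},y^{k+1})\le\max\{s_{k+1},\tau_{k+1}\mathcal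 G(\theta^k,x^k,y^k)\}$. - Put $\Delta_{k+1}=\|(x^{k+1},y^{k+1})-(x^k,\tilde y^k)\|$ and $t^{k+1}=\max\{\varphi(x^{k+1},y^{k+1})-\varphi(x^{k+1},\theta^{k+1})-\frac1{2\gamma}\|\theta^{k+1}-y^{k+1}\|^2-\epsilon,\,0\}$. - Case 1: if $\Delta_{k+1}\ge c_p\min\{1/p_k,t^{k+1}\}$, set $p_{k+1}=p_k$, $(\tilde y^{k+1},\tilde\theta^{k+1})=(y^{k+1},\theta^{k+1})$. - Case 2: if $\Delta_{k+1}<c_p\min\{1/p_k,t^{k+1}\}$ and $\|y^{k+1}-\theta^{k+1}\|\le c_y\gamma/p_k$, set $p_{k+1}=p_k+\varrho_p$, $(\tilde y^{k+1},\tilde\theta^{k+1})=(y^{k+1},\theta^{k+1})$. - Case 3 (feasibility correction): otherwise, choose a candidate $\tilde y^{k+1}\in Y$ with $\|\tilde y^{k+1}-\operatorname{Prox}_{\tilde g(x^{k+1},\cdot)}(\tilde y^{k+1}-\nabla_yf(x^{k+1},\tilde y^{k+1}))\|\le\frac{c_{\tilde y}}{p_k}\Delta_{k+1}$ and $\tilde\theta^{k+1}$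 with $\mathcal G(\tilde\theta^{k+1},x^{k+1},\tilde y^{k+1})\le\max\{s_{k+1},\tau_{k+1}\mathcal G(\theta^k,x^k,y^k)\}$. With $T(y,\theta):=\frac1{p_k}F(x^{k+1},y)+\varphi(x^{k+1},y)-\varphi(x^{k+1},\theta)-\frac1{2\gamma}\|\theta-y\|^2$: if $T(\tilde y^{k+1},\tilde\theta^{k+1})\le T(y^{k+1},\theta^{k+1})$ accept the candidate and set $p_{k+1}=p_k$; otherwise set $(\tilde y^{k+1},\tilde\theta^{k+1})=(y^{k+1},\theta^{k+1})$ and $p_{k+1}=p_k+\varrho_p$. The step sizes satisfy, for some constants $\underline\alpha,\underline\beta,c_\alpha,c_\beta>0$ and all $k$, $$\alpha_k\in\Big[\underline\alpha,\tfrac{2}{L_{F_x}/p_k+L_{f_x}+L_{g_1}+\rho_{f_1}+\rho_{g_1}+c_\alpha}\Big],\qquad \beta_k\in\Big[\underline\beta,\tfrac{2}{L_{F_y}/p_k+L_{f_y}+c_\beta}\Big].$$ **Merit function.** With $z=(x,y)$ and $\rho_{v_1}:=\rho_{f_1}+\rho_{g_1}+c_\alpha/4$, for $z\in X\times Y$ and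 $u\in\mathbb R^n$ let $$E_p(z,u):=\tfrac1p\big(F(z)-\underline F\big)+\varphi(z)+\tfrac{\rho_{v_1}}2\|x\|^2-\langle u,x\rangle+H(u,y),\qquad H(u,y):=\sup_{x'\in X}\Big\{\langle u,x'\rangle-v_\gamma(x',y)-\tfrac{\rho_{v_1}}2\|x'\|^2\Big\},$$ and $E_p(z,u):=+\infty$ for $z\notin X\times Y$. A proper lower semicontinuous $h:\mathbb R^d\to(-\infty,+\infty]$ is a *KL function* if at each $\bar w$ with $\partial h(\bar w)\ne\emptyset$ there are $\zeta\in(0,+\infty]$, a neighborhood $U$ of $\bar w$ and a concave continuous $\phi:[0,\zeta)\to[0,\infty)$ with $\phi(0)=0$, $\phi\in C^1(0,\zeta)$, $\phi'>0$ on $(0,\zeta)$, such that $\phi'(h(w)-h(\bar w))\operatorname{dist}(0,\partial h(w))\ge1$ for all $w\in U$ with $h(\bar w)<h(w)<h(\bar w)+\zeta$. **Theorem (sequential convergence under KL).** Let Assumptions 1–4 hold and let the sequences be generated by AGILS as above, with $\sum_{k}s_k<\infty$ and $\sum_{k}k\,s_k^{p_s}<\infty$ for some $p_s<2$. Suppose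 that $\{(x^k,y^k)\}$ is bounded and that there is $\bar p$ with $p_k=\bar p$ and $\tilde y^k=y^k$ for all sufficiently large $k$. If $E_{\bar p}$ is a KL function, then the whole sequence $(x^k,y^k)$ converges, and its limit is a KKT point of $(\mathrm{VP})_\gamma^{\tilde\epsilon}$ for some $\tilde\epsilon$ with $0\le\tilde\epsilon\le\epsilon$. -/

import Mathlib

open Filter Topology Set

noncomputable section

/-- Euclidean space of dimension `n`. -/
abbrev Eu (n : ℕ) : Type := EuclideanSpace ℝ (Fin n)

/-- The space of pairs `z = (x, y)`, with the Euclidean norm and inner product. -/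
abbrev Pair (n m : ℕ) : Type := WithLp 2 (Eu n × Eu m)

/-- The space of `(z, u) = ((x, y), u)`, with the Euclidean norm and inner product. -/
abbrev Triple (n m : ℕ) : Type := WithLp 2 (Pair n m × Eu n)

/-- The pair `(x, y)`. -/
def pair {n m : ℕ} (x : Eu n) (y : Eu m) : Pair n m := WithLp.toLp 2 (x, y)

/-- A function of two variables as a function of the pair. -/
def onPair {n m : ℕ} (h : Eu n → Eu m → ℝ) : Pair n m → ℝ := fun z => h z.fst z.snd

/-- The product set `X × Y`. -/
def prodSet {n m : ℕ} (X : Set (Eu n)) (Y : Set (Eu m)) : Set (Pair n m) :=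
  {z | z.fst ∈ X ∧ z.snd ∈ Y}

/-- Partial gradient in the first variable. -/
def gradX {n m : ℕ} (h : Eu n → Eu m → ℝ) (x : Eu n) (y : Eu m) : Eu n :=
  gradient (fun x' => h x' y) x

/-- Partial gradient in the second variable. -/
def gradY {n m : ℕ} (h : Eu n → Eu m → ℝ) (x : Eu n) (y : Eu m) : Eu m :=
  gradient (fun y' => h x y') y

/-! ### Variational analysis -/

section Variational

variable {V : Type} [NormedAddCommGroup V] [InnerProductSpace ℝ V]

open Classical in
/-- The function `h + δ_S`: equal to `h` on `S` and to `+∞` outside `S`. -/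
def extend (S : Set V) (h : V → ℝ) : V → EReal :=
  fun z => if z ∈ S then (h z : EReal) else ⊤

/-- The Fréchet (regular) subdifferential: `v` belongs to it when
`h z ≥ h z₀ + ⟨v, z - z₀⟩ + o(‖z - z₀‖)`. It is empty outside the domain of `h`. -/
def frechetSubdiff (h : V → EReal) (z₀ : V) : Set V :=
  {v | h z₀ ≠ ⊤ ∧ h z₀ ≠ ⊥ ∧ ∀ e : ℝ, 0 < e → ∀ᶠ z in 𝓝 z₀,
    h z₀ + ((inner ℝ v (z - z₀) - e * ‖z - z₀‖ : ℝ) : EReal) ≤ h z}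

/-- The limiting (Mordukhovich) subdifferential. It is empty outside the domain of `h`. -/
def limitingSubdiff (h : V → EReal) (z₀ : V) : Set V :=
  {v | h z₀ ≠ ⊤ ∧ h z₀ ≠ ⊥ ∧ ∃ (z w : ℕ → V),
    Tendsto z atTop (𝓝 z₀) ∧ Tendsto (fun k => h (z k)) atTop (𝓝 (h z₀)) ∧
    (∀ k, w k ∈ frechetSubdiff h (z k)) ∧ Tendsto w atTop (𝓝 v)}

/-- The normal cone of a convex set `S` at `z₀`. -/
def normalCone (S : Set V) (z₀ : V) : Set V :=
  {w | ∀ z ∈ S, inner ℝ w (z - z₀) ≤ 0}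

/-- The class `Φ_ζ` of desingularizing functions on `[0, ζ)`. -/
structure IsDesingularizing (ζ : EReal) (φ : ℝ → ℝ) : Prop where
  concave : ConcaveOn ℝ {s : ℝ | 0 ≤ s ∧ (s : EReal) < ζ} φ
  continuousOn : ContinuousOn φ {s : ℝ | 0 ≤ s ∧ (s : EReal) < ζ}
  nonneg : ∀ s : ℝ, 0 ≤ s → (s : EReal) < ζ → 0 ≤ φ s
  zero : φ 0 = 0
  contDiffOn : ContDiffOn ℝ 1 φ {s : ℝ | 0 < s ∧ (s : EReal) < ζ}
  deriv_pos : ∀ s : ℝ, 0 < s → (s : EReal) < ζ → 0 < deriv φ s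

/-- The Kurdyka-Łojasiewicz property of `h` at `z₀`; the distance from `0` to the empty set
is `+∞`. -/
def HasKLAt (h : V → EReal) (z₀ : V) : Prop :=
  ∃ (ζ : EReal) (φ : ℝ → ℝ), 0 < ζ ∧ IsDesingularizing ζ φ ∧
    ∃ U ∈ 𝓝 z₀, ∀ z ∈ U, h z₀ < h z → h z < h z₀ + ζ →
      1 ≤ ENNReal.ofReal (deriv φ ((h z).toReal - (h z₀).toReal)) *
        Metric.infEDist (0 : V) (limitingSubdiff h z)

/-- A KL function: proper, lower semicontinuous, with the KL property at every point at which
the limiting subdifferential is nonempty. -/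
structure IsKLFunction (h : V → EReal) : Prop where
  ne_bot : ∀ z, h z ≠ ⊥
  ne_top : ∃ z, h z ≠ ⊤
  lsc : LowerSemicontinuous h
  kl : ∀ z, (limitingSubdiff h z).Nonempty → HasKLAt h z

/-- The minimizer of `h` over `S` (meaningful where there is exactly one). -/
def argminOn (S : Set V) (h : V → ℝ) : V :=
  Classical.epsilon fun z => z ∈ S ∧ IsMinOn h S z

/-- The proximal mapping of `h + δ_S`. -/
def prox (S : Set V) (h : V → ℝ) (w : V) : V :=
  argminOn S fun θ => h θ + ‖θ - w‖ ^ 2 / 2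

/-- The Euclidean projection onto `S`. -/
def proj (S : Set V) (w : V) : V := argminOn S fun z => ‖z - w‖

end Variational

/-- `(ρ₁, ρ₂)`-weak convexity on `X × Y`. -/
def WeaklyConvexOn {n m : ℕ} (X : Set (Eu n)) (Y : Set (Eu m)) (ρ₁ ρ₂ : ℝ)
    (h : Eu n → Eu m → ℝ) : Prop :=
  ConvexOn ℝ (prodSet X Y)
    (fun z => onPair h z + ρ₁ / 2 * ‖z.fst‖ ^ 2 + ρ₂ / 2 * ‖z.snd‖ ^ 2)

/-! ### The bilevel problem -/

/-- The data of the bilevel problem: minimize `F x y` over `x ∈ X`, `y ∈ Y` such that `y`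
minimizes `f x + g x` over `Y`. -/
structure BilevelProblem (n m : ℕ) where
  X : Set (Eu n)
  Y : Set (Eu m)
  F : Eu n → Eu m → ℝ
  f : Eu n → Eu m → ℝ
  g : Eu n → Eu m → ℝ

/-- Lipschitz and weak convexity moduli. -/
structure Moduli where
  LFx : ℝ
  LFy : ℝ
  Lfx : ℝ
  Lfy : ℝ
  Lg1 : ℝ
  Lg2 : ℝ
  ρf1 : ℝ
  ρf2 : ℝ
  ρg1 : ℝ
  ρg2 : ℝ

namespace BilevelProblem

variable {n m : ℕ} (P : BilevelProblem n m)

/-- The lower-level objective `φ = f + g`. -/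
def phi (x : Eu n) (y : Eu m) : ℝ := P.f x y + P.g x y

/-- The feasible box `X × Y`. -/
def box : Set (Pair n m) := prodSet P.X P.Y

/-- The infimum of `F` over `X × Y`. -/
def Finf : ℝ := sInf (onPair P.F '' P.box)

/-- The Moreau envelope `v_γ`. -/
def vEnv (γ : ℝ) (x : Eu n) (y : Eu m) : ℝ :=
  sInf ((fun θ => P.phi x θ + 1 / (2 * γ) * ‖θ - y‖ ^ 2) '' P.Y)

/-- The partial subdifferential `∂_y g(x, y)`, where `g x` is a function on `Y`
(value `+∞` outside). -/
def subdiffGy (x : Eu n) (y : Eu m) : Set (Eu m) :=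
  limitingSubdiff (extend P.Y (P.g x)) y

/-- The subdifferential `∂ g(x, y)`, where `g` is a function on `X × Y`
(value `+∞` outside). -/
def subdiffG (z : Pair n m) : Set (Pair n m) :=
  limitingSubdiff (extend P.box (onPair P.g)) z

/-- `X` and `Y` are closed and convex. -/
structure ConvexSets : Prop where
  closed_X : IsClosed P.X
  convex_X : Convex ℝ P.X
  closed_Y : IsClosed P.Y
  convex_Y : Convex ℝ P.Y

/-- The upper-level objective is bounded below on `X × Y` and continuously differentiable, with
partial gradients that are Lipschitz continuous on `X × Y`. -/
structure UpperAssumption (M : Moduli) : Prop where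
  bddBelow : BddBelow (onPair P.F '' P.box)
  contDiff : ContDiff ℝ 1 (onPair P.F)
  LFx_nonneg : 0 ≤ M.LFx
  LFy_nonneg : 0 ≤ M.LFy
  lip_x : ∀ z ∈ P.box, ∀ z' ∈ P.box,
    ‖gradX P.F z.fst z.snd - gradX P.F z'.fst z'.snd‖ ≤ M.LFx * ‖z - z'‖
  lip_y : ∀ z ∈ P.box, ∀ z' ∈ P.box,
    ‖gradY P.F z.fst z.snd - gradY P.F z'.fst z'.snd‖ ≤ M.LFy * ‖z - z'‖

/-- The lower-level problem is convex. -/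
structure LowerConvexAssumption : Prop where
  convex_f : ∀ x ∈ P.X, ConvexOn ℝ P.Y (P.f x)
  convex_g : ∀ x ∈ P.X, ConvexOn ℝ P.Y (P.g x)

/-- Smoothness of `f`, partial smoothness of `g`, and weak convexity of both. -/
structure LowerSmoothAssumption (M : Moduli) : Prop where
  diff_f : ∀ z ∈ P.box, DifferentiableAt ℝ (onPair P.f) z
  cont_grad_f : ContinuousOn (gradient (onPair P.f)) P.box
  Lfx_nonneg : 0 ≤ M.Lfx
  Lfy_nonneg : 0 ≤ M.Lfy
  lip_fx : ∀ z ∈ P.box, ∀ z' ∈ P.box,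
    ‖gradX P.f z.fst z.snd - gradX P.f z'.fst z'.snd‖ ≤ M.Lfx * ‖z - z'‖
  lip_fy : ∀ z ∈ P.box, ∀ z' ∈ P.box,
    ‖gradY P.f z.fst z.snd - gradY P.f z'.fst z'.snd‖ ≤ M.Lfy * ‖z - z'‖
  cont_g : ContinuousOn (onPair P.g) P.box
  diff_gx : ∀ x ∈ P.X, ∀ y ∈ P.Y, DifferentiableAt ℝ (fun x' => P.g x' y) x
  Lg1_nonneg : 0 ≤ M.Lg1
  Lg2_nonneg : 0 ≤ M.Lg2
  lip_g1 : ∀ y ∈ P.Y, ∀ x ∈ P.X, ∀ x' ∈ P.X,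
    ‖gradX P.g x y - gradX P.g x' y‖ ≤ M.Lg1 * ‖x - x'‖
  lip_g2 : ∀ x ∈ P.X, ∀ y ∈ P.Y, ∀ y' ∈ P.Y,
    ‖gradX P.g x y - gradX P.g x y'‖ ≤ M.Lg2 * ‖y - y'‖
  ρf1_nonneg : 0 ≤ M.ρf1
  ρf2_nonneg : 0 ≤ M.ρf2
  ρg1_nonneg : 0 ≤ M.ρg1
  ρg2_nonneg : 0 ≤ M.ρg2
  weak_f : WeaklyConvexOn P.X P.Y M.ρf1 M.ρf2 P.f
  weak_g : WeaklyConvexOn P.X P.Y M.ρg1 M.ρg2 P.g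

/-- `∂_y g` is `L`-Lipschitz in `x` on `X`, for each fixed `y ∈ Y`:
`∂_y g(x', y) ⊆ ∂_y g(x, y) + L ‖x - x'‖ 𝔹`. -/
def SubdiffLipschitz (L : ℝ) : Prop :=
  ∀ y ∈ P.Y, ∀ x ∈ P.X, ∀ x' ∈ P.X, ∀ ξ' ∈ P.subdiffGy x' y,
    ∃ ξ ∈ P.subdiffGy x y, ‖ξ' - ξ‖ ≤ L * ‖x - x'‖

/-- `z` is a KKT point of: minimize `F` over `X × Y` subject to `φ - v_γ ≤ ε`.
The gradient of `v_γ`, a function on `X × ℝᵐ`, is taken relative to `X × ℝᵐ`. -/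
def IsKKT (γ ε : ℝ) (z : Pair n m) : Prop :=
  z ∈ P.box ∧ P.phi z.fst z.snd - P.vEnv γ z.fst z.snd ≤ ε ∧
  ∃ lam : ℝ, 0 ≤ lam ∧
    lam * (P.phi z.fst z.snd - P.vEnv γ z.fst z.snd - ε) = 0 ∧
    ∃ ξ ∈ P.subdiffG z, ∃ ν : Pair n m,
      HasGradientWithinAt (onPair (P.vEnv γ)) ν (prodSet P.X univ) z ∧
      ∃ w ∈ normalCone P.box z,
        gradient (onPair P.F) z + lam • (gradient (onPair P.f) z + ξ - ν) + w = 0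

/-! ### The merit function -/

/-- The function `ṽ_γ(x, y) = v_γ(x, y) + (ρ / 2) ‖x‖²`. -/
def vTilde (γ ρ : ℝ) (x : Eu n) (y : Eu m) : ℝ := P.vEnv γ x y + ρ / 2 * ‖x‖ ^ 2

/-- The Fenchel conjugate `H(u, y)` of `ṽ_γ(·, y)`, a function on `X`. -/
def conj (γ ρ : ℝ) (u : Eu n) (y : Eu m) : ℝ :=
  sSup ((fun x => inner ℝ u x - P.vTilde γ ρ x y) '' P.X)

/-- The function `G_p`. -/
def meritG (ρ p : ℝ) (z : Pair n m) : ℝ :=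
  1 / p * (onPair P.F z - P.Finf) + onPair P.phi z + ρ / 2 * ‖z.fst‖ ^ 2

/-- The merit function `E_p(z, u) = G_p(z) - ⟨u, x⟩ + H(u, y)` on `(X × Y) × ℝⁿ`
(value `+∞` outside). -/
def merit (γ ρ p : ℝ) : Triple n m → EReal :=
  extend {q | q.fst ∈ P.box} fun q =>
    P.meritG ρ p q.fst - inner ℝ q.snd q.fst.fst + P.conj γ ρ q.snd q.fst.snd

end BilevelProblem

/-! ### The algorithm -/

/-- Parameters of the algorithm. -/
structure Params where
  γ : ℝ
  ε : ℝ
  η : ℝ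
  p0 : ℝ
  ϱp : ℝ
  cp : ℝ
  cy : ℝ
  cyt : ℝ
  τ0 : ℝ
  pτ : ℝ
  s : ℕ → ℝ
  α : ℕ → ℝ
  β : ℕ → ℝ

/-- The relative tolerance `τ_k = τ₀ / (k + 1) ^ p_τ`. -/
def Params.τ (A : Params) (k : ℕ) : ℝ := A.τ0 / ((k : ℝ) + 1) ^ A.pτ

/-- Admissible parameters. -/
structure Params.Admissible (A : Params) (M : Moduli) : Prop where
  γ_pos : 0 < A.γ
  γ_lt : A.γ * (M.ρf2 + M.ρg2) < 1
  ε_pos : 0 < A.ε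
  η_pos : 0 < A.η
  p0_pos : 0 < A.p0
  ϱp_pos : 0 < A.ϱp
  cp_pos : 0 < A.cp
  cy_pos : 0 < A.cy
  cyt_pos : 0 < A.cyt
  τ0_pos : 0 < A.τ0
  pτ_pos : 0 < A.pτ
  s_nonneg : ∀ k, 0 ≤ A.s k

/-- The sequences produced by the algorithm: `x k`, `y k`, the corrected `yt k`, the inexact
proximal solutions `θ k` and `θt k`, the intermediate `θh k` (the iterate with index `k + 1/2`),
and the penalty parameters `p k`. -/
structure Iterates (n m : ℕ) where
  x : ℕ → Eu n
  y : ℕ → Eu m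
  yt : ℕ → Eu m
  θ : ℕ → Eu m
  θt : ℕ → Eu m
  θh : ℕ → Eu m
  p : ℕ → ℝ

namespace Iterates

variable {n m : ℕ}

/-- The prox-gradient residual `𝒢(θ, x, y)`. -/
def resid (P : BilevelProblem n m) (A : Params) (θ : Eu m) (x : Eu n) (y : Eu m) : ℝ :=
  ‖θ - prox P.Y (fun t => A.η * P.g x t)
    (θ - A.η • (gradY P.f x θ + (1 / A.γ) • (θ - y)))‖

variable (P : BilevelProblem n m) (A : Params) (I : Iterates n m)

/-- The residual `𝒢(θ^{k-1}, x^{k-1}, y^{k-1})`, where `(θ^{-1}, x^{-1}, y^{-1})` is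
`(θt 0, x 0, y 0)`. -/
def prevResid : ℕ → ℝ
  | 0 => resid P A (I.θt 0) (I.x 0) (I.y 0)
  | k + 1 => resid P A (I.θ k) (I.x k) (I.y k)

/-- The direction `d_y^k`. -/
def dY (k : ℕ) : Eu m :=
  (1 / I.p k) • gradY P.F (I.x k) (I.yt k) + gradY P.f (I.x k) (I.yt k)
    - (1 / A.γ) • (I.yt k - I.θt k)

/-- The direction `d_x^k`. -/
def dX (k : ℕ) : Eu n :=
  (1 / I.p k) • gradX P.F (I.x k) (I.y (k + 1))
    + (gradX P.f (I.x k) (I.y (k + 1)) + gradX P.g (I.x k) (I.y (k + 1)))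
    - gradX P.f (I.x k) (I.θh k) - gradX P.g (I.x k) (I.θh k)

/-- The step length `Δ_{k+1}`. -/
def stepLen (k : ℕ) : ℝ :=
  ‖pair (I.x (k + 1)) (I.y (k + 1)) - pair (I.x k) (I.yt k)‖

/-- The estimated constraint violation `t^{k+1}`. -/
def viol (k : ℕ) : ℝ :=
  max (P.phi (I.x (k + 1)) (I.y (k + 1)) - P.phi (I.x (k + 1)) (I.θ (k + 1))
    - 1 / (2 * A.γ) * ‖I.θ (k + 1) - I.y (k + 1)‖ ^ 2 - A.ε) 0

/-- The quantity compared in the descent test of the feasibility correction. -/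
def testValue (k : ℕ) (y θ : Eu m) : ℝ :=
  1 / I.p k * P.F (I.x (k + 1)) y + P.phi (I.x (k + 1)) y
    - (P.phi (I.x (k + 1)) θ + 1 / (2 * A.γ) * ‖θ - y‖ ^ 2)

/-- No correction at step `k`: the pair `(y, θ)` with index `k + 1` is kept. -/
def Keep (k : ℕ) : Prop :=
  I.yt (k + 1) = I.y (k + 1) ∧ I.θt (k + 1) = I.θ (k + 1)

/-- The condition of the penalty update test. -/
def PenaltyTest (k : ℕ) : Prop :=
  I.stepLen k < A.cp * min (1 / I.p k) (I.viol P A k)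

/-- The feasibility correction procedure at step `k`: a candidate `yc`, an inexact solution of
the lower-level problem, and an inexact proximal solution `θc` are found, and they are accepted
exactly when the descent test holds. -/
def FeasibilityCorrection (k : ℕ) : Prop :=
  ∃ yc ∈ P.Y, ∃ θc ∈ P.Y,
    ‖yc - prox P.Y (P.g (I.x (k + 1))) (yc - gradY P.f (I.x (k + 1)) yc)‖
        ≤ A.cyt / I.p k * I.stepLen k ∧
    (resid P A θc (I.x (k + 1)) yc ≤ A.s (k + 1) ∨
      resid P A θc (I.x (k + 1)) yc ≤ A.τ (k + 1) * resid P A (I.θ k) (I.x k) (I.y k)) ∧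
    ((I.testValue P A k yc θc ≤ I.testValue P A k (I.y (k + 1)) (I.θ (k + 1)) ∧
        I.p (k + 1) = I.p k ∧ I.yt (k + 1) = yc ∧ I.θt (k + 1) = θc) ∨
      (¬ I.testValue P A k yc θc ≤ I.testValue P A k (I.y (k + 1)) (I.θ (k + 1)) ∧
        I.p (k + 1) = I.p k + A.ϱp ∧ I.Keep k))

/-- The sequences are generated by the algorithm (run without a stopping test). -/
structure IsAGILS : Prop where
  x_init : I.x 0 ∈ P.X
  y_init : I.y 0 ∈ P.Y
  yt_init : I.yt 0 ∈ P.Y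
  θ_init : I.θ 0 ∈ P.Y
  θt_init : I.θt 0 ∈ P.Y
  p_init : I.p 0 = A.p0
  y_update : ∀ k, I.y (k + 1) =
    prox P.Y (fun t => A.β k * P.g (I.x k) t) (I.yt k - A.β k • I.dY P A k)
  θh_mem : ∀ k, I.θh k ∈ P.Y
  θh_inexact : ∀ k, resid P A (I.θh k) (I.x k) (I.y (k + 1)) ≤ A.s k ∨
    resid P A (I.θh k) (I.x k) (I.y (k + 1)) ≤ A.τ k * I.prevResid P A k
  x_update : ∀ k, I.x (k + 1) = proj P.X (I.x k - A.α k • I.dX P k)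
  θ_mem : ∀ k, I.θ (k + 1) ∈ P.Y
  θ_inexact : ∀ k, resid P A (I.θ (k + 1)) (I.x (k + 1)) (I.y (k + 1)) ≤ A.s (k + 1) ∨
    resid P A (I.θ (k + 1)) (I.x (k + 1)) (I.y (k + 1))
      ≤ A.τ (k + 1) * resid P A (I.θ k) (I.x k) (I.y k)
  case_one : ∀ k, ¬ I.PenaltyTest P A k → I.p (k + 1) = I.p k ∧ I.Keep k
  case_two : ∀ k, I.PenaltyTest P A k →
    ‖I.y (k + 1) - I.θ (k + 1)‖ ≤ A.cy * A.γ / I.p k →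
      I.p (k + 1) = I.p k + A.ϱp ∧ I.Keep k
  case_three : ∀ k, I.PenaltyTest P A k →
    A.cy * A.γ / I.p k < ‖I.y (k + 1) - I.θ (k + 1)‖ → I.FeasibilityCorrection P A k

/-- The step size rule, with lower bounds `αlow`, `βlow` and margins `cα`, `cβ`. -/
structure StepSizes (M : Moduli) (αlow βlow cα cβ : ℝ) : Prop where
  αlow_pos : 0 < αlow
  βlow_pos : 0 < βlow
  cα_pos : 0 < cα
  cβ_pos : 0 < cβ
  α_mem : ∀ k, A.α k ∈ Icc αlow
    (2 / ((M.LFx / I.p k + M.Lfx + M.Lg1 + M.ρf1 + M.ρg1) + cα))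
  β_mem : ∀ k, A.β k ∈ Icc βlow (2 / ((M.LFy / I.p k + M.Lfy) + cβ))

end Iterates

end

/-! The proof runs the scheme "sufficient decrease, relative error, Kurdyka-Łojasiewicz" for inexact
steps.

Convexity of `φ(x, ·)` makes the problem defining `v_γ` strongly convex, so its minimizer `envSol`
is Lipschitz and `v_γ` has a first order expansion with quadratic remainder
(`exists_envelope_bounds`). Joint weak convexity and `γ(ρf2 + ρg2) < 1` make `v_γ(·, y)` weakly
convex with modulus `ρf1 + ρg1` (`vEnv_lower_left`). The surplus `cα/4` in the merit function then
gives strong convexity in `x`: the conjugate `H` is finite, and by Fenchel-Young the merit function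
dominates the penalized value function, with equality when `u` is the gradient of `ṽ_γ(·, y)` at
`x`.

The Lyapunov value is the merit function at the new point, with `u` the gradient at the old `x` and
the new `y`. It decreases by a multiple of the squared step up to a multiple of the squared error of
the inexact solutions (`merit_descent`), and it has a subgradient bounded by step plus error
(`exists_merit_subgradient`). The prox-gradient residual controls the error (`exists_error_bound`).

Because of the errors the values need not be monotone. Adding the tail of the error series restores
monotonicity. Where the gap to the limit value exceeds this tail, the KL inequality gives the usual
telescoping bound; elsewhere the squared step is bounded by the decrease of a quantity of the size
of the tail, summable against weights `(k+1)^q` with `q > 1`. Such weights come from the summability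
hypotheses on the tolerances (`exists_weight_of_summable`). Both cases yield steps that halve up to
a summable term (`exists_summable_contraction`). This holds only near a cluster point, but the total
length is small enough to stay there (`tendsto_of_local_contraction`).

Passing to the limit in the optimality conditions of the two steps gives the KKT system with
multiplier `p̄` and tolerance equal to the gap at the limit. If that gap exceeded `ε`, the penalty
test would eventually always pass; with constant penalty only accepted corrections remain, and these
make the limit an exact lower-level solution, with no gap (`gap_le`). -/

section Generic

/-! ### Convexity, minimizers and subdifferentials. -/

variable {V : Type} [NormedAddCommGroup V] [InnerProductSpace ℝ V]

/-- A quadratic lower bound for a convex function improves to a linear one. -/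
theorem ConvexOn.subgradient_of_quadratic {S : Set V} {h : V → ℝ} (hh : ConvexOn ℝ S h)
    {z₀ a : V} (hz₀ : z₀ ∈ S) {C : ℝ}
    (hq : ∀ z ∈ S, h z₀ + inner ℝ a (z - z₀) - C * ‖z - z₀‖ ^ 2 ≤ h z) :
    ∀ z ∈ S, h z₀ + inner ℝ a (z - z₀) ≤ h z := by
  intro z hz
  -- On the segment to `z` the quadratic term is of order `t²` and the others are linear in `t`;
  -- dividing by `t` and letting `t → 0` removes it.
  have key : ∀ t : ℝ, 0 < t → t ≤ 1 →
      h z₀ + inner ℝ a (z - z₀) - h z ≤ t * (C * ‖z - z₀‖ ^ 2) := by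
    intro t ht ht1
    have h1 := hh.2 hz₀ hz (sub_nonneg.2 ht1) ht.le (by ring)
    have h2 := hq _ (hh.1 hz₀ hz (sub_nonneg.2 ht1) ht.le (by ring))
    have h3 : (1 - t) • z₀ + t • z - z₀ = t • (z - z₀) := by module
    rw [h3, inner_smul_right, norm_smul, Real.norm_of_nonneg ht.le, mul_pow] at h2
    simp only [smul_eq_mul] at h1
    have h4 : t * (h z₀ + inner ℝ a (z - z₀) - h z) ≤ t * (t * (C * ‖z - z₀‖ ^ 2)) := by
      linarith
    exact le_of_mul_le_mul_left h4 ht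
  have lim : Tendsto (fun t : ℝ => t * (C * ‖z - z₀‖ ^ 2)) (𝓝[>] 0) (𝓝 0) := by
    have : Tendsto (fun t : ℝ => t * (C * ‖z - z₀‖ ^ 2)) (𝓝 0) (𝓝 (0 * (C * ‖z - z₀‖ ^ 2))) :=
      (continuous_id.mul continuous_const).tendsto 0
    rw [zero_mul] at this
    exact this.mono_left nhdsWithin_le_nhds
  have : h z₀ + inner ℝ a (z - z₀) - h z ≤ 0 := by
    refine ge_of_tendsto lim ?_
    filter_upwards [Ioc_mem_nhdsGT (zero_lt_one' ℝ)] with t ht using key t ht.1 ht.2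
  linarith

theorem norm_sub_sq_eq_add (z z₀ w : V) :
    ‖z - w‖ ^ 2 = ‖z₀ - w‖ ^ 2 + 2 * inner ℝ (z₀ - w) (z - z₀) + ‖z - z₀‖ ^ 2 := by
  have : z - w = (z₀ - w) + (z - z₀) := by abel
  rw [this, norm_add_sq_real]

/-- First order optimality of a minimizer of `h + c ‖· - w‖²`, for `h` convex. -/
theorem ConvexOn.subgradient_of_isMinOn_add_sq {S : Set V} {h : V → ℝ} (hh : ConvexOn ℝ S h)
    {z₀ w : V} (hz₀ : z₀ ∈ S) {c : ℝ} (hmin : IsMinOn (fun z => h z + c * ‖z - w‖ ^ 2) S z₀) :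
    ∀ z ∈ S, h z₀ + inner ℝ ((2 * c) • (w - z₀)) (z - z₀) ≤ h z := by
  refine hh.subgradient_of_quadratic hz₀ (C := c) fun z hz => ?_
  have h1 : h z₀ + c * ‖z₀ - w‖ ^ 2 ≤ h z + c * ‖z - w‖ ^ 2 := hmin hz
  rw [norm_sub_sq_eq_add z z₀ w] at h1
  have h2 : w - z₀ = -(z₀ - w) := by abel
  rw [inner_smul_left, h2, inner_neg_left]
  simp only [conj_trivial]
  linarith

/-- A continuous convex function plus a positive multiple of a squared distance attains its
minimum on a closed convex set. -/
theorem ConvexOn.exists_isMinOn_add_sq [FiniteDimensional ℝ V] {S : Set V} {h : V → ℝ}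
    (hS : IsClosed S) (hne : S.Nonempty) (hh : ConvexOn ℝ S h) (hc : ContinuousOn h S)
    {c : ℝ} (hc0 : 0 < c) (w : V) :
    ∃ z ∈ S, IsMinOn (fun z => h z + c * ‖z - w‖ ^ 2) S z := by
  obtain ⟨z₀, hz₀⟩ := hne
  have hcont : ContinuousOn (fun z => h z + c * ‖z - w‖ ^ 2) S := by fun_prop
  obtain ⟨q, hq, hqmin⟩ : ∃ q ∈ S ∩ Metric.closedBall z₀ 1, IsMinOn h (S ∩ Metric.closedBall z₀ 1) q := by
    have hcpt : IsCompact (S ∩ Metric.closedBall z₀ 1) :=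
      (isCompact_closedBall z₀ 1).inter_left hS
    exact hcpt.exists_isMinOn ⟨z₀, hz₀, by simp⟩ (hc.mono inter_subset_left)
  have hA : 0 ≤ h z₀ - h q := sub_nonneg.2 (hqmin ⟨hz₀, by simp⟩)
  refine hcont.exists_isMinOn' hS hz₀ ?_
  -- By convexity and the minimum `h q` over the unit ball, `h` falls at most linearly along rays
  -- from `z₀`, with slope `h z₀ - h q`. Beyond this radius the quadratic term outweighs that fall.
  have hev : ∀ᶠ z in cocompact V ⊓ 𝓟 S,
      max 1 (2 * ‖z₀ - w‖ + (h z₀ - h q) / c) ≤ ‖z - z₀‖ := by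
    have h1 : Tendsto (fun z : V => ‖z - z₀‖) (cocompact V) atTop := by
      have := tendsto_norm_cocompact_atTop.comp
        ((Homeomorph.addRight (-z₀)).isClosedEmbedding.tendsto_cocompact)
      refine this.congr fun z => ?_
      simp [sub_eq_add_neg]
    exact (h1.eventually_ge_atTop _).filter_mono inf_le_left
  filter_upwards [hev, mem_inf_of_right (mem_principal_self S)] with z hz hzS
  have hR1 : 1 ≤ ‖z - z₀‖ := (le_max_left _ _).trans hz
  have hR2 : 2 * ‖z₀ - w‖ + (h z₀ - h q) / c ≤ ‖z - z₀‖ := (le_max_right _ _).trans hz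
  set R := ‖z - z₀‖ with hR
  have hR0 : 0 < R := by linarith
  have hinv : R⁻¹ ≤ 1 := inv_le_one_of_one_le₀ hR1
  have h1 := hh.2 hz₀ hzS (sub_nonneg.2 hinv) (inv_nonneg.2 hR0.le) (by ring)
  have hmem := hh.1 hz₀ hzS (sub_nonneg.2 hinv) (inv_nonneg.2 hR0.le) (by ring)
  have h2 : h q ≤ h ((1 - R⁻¹) • z₀ + R⁻¹ • z) := by
    refine hqmin ⟨hmem, ?_⟩
    have h3 : (1 - R⁻¹) • z₀ + R⁻¹ • z - z₀ = R⁻¹ • (z - z₀) := by module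
    rw [Metric.mem_closedBall, dist_eq_norm, h3, norm_smul, Real.norm_of_nonneg (by positivity),
      ← hR, inv_mul_cancel₀ hR0.ne']
  simp only [smul_eq_mul] at h1
  have h4 : h z₀ - (h z₀ - h q) * R ≤ h z := by
    have h5 := mul_le_mul_of_nonneg_left (h2.trans h1) hR0.le
    have h6 : R * ((1 - R⁻¹) * h z₀ + R⁻¹ * h z) = (R - 1) * h z₀ + h z := by
      field_simp
    rw [h6] at h5
    linarith
  have h7 : R - ‖z₀ - w‖ ≤ ‖z - w‖ := by
    have h8 : z - z₀ = (z - w) - (z₀ - w) := by abel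
    have := norm_sub_le (z - w) (z₀ - w)
    rw [← h8] at this
    linarith
  have hD := norm_nonneg (z₀ - w)
  have h8 : (R - ‖z₀ - w‖) ^ 2 ≤ ‖z - w‖ ^ 2 := by
    refine pow_le_pow_left₀ ?_ h7 2
    have : 0 ≤ (h z₀ - h q) / c := by positivity
    linarith
  have h9 : c * (2 * ‖z₀ - w‖) + (h z₀ - h q) ≤ c * R := by
    have := mul_le_mul_of_nonneg_left hR2 hc0.le
    rwa [mul_add, mul_div_cancel₀ _ hc0.ne'] at this
  have h10 := mul_le_mul_of_nonneg_left h8 hc0.le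
  have h11 := mul_le_mul_of_nonneg_right h9 hR0.le
  nlinarith

/-- The descent lemma on a convex set. -/
theorem le_add_sq_of_lipschitz_gradient [CompleteSpace V] {S : Set V} (hS : Convex ℝ S) {h : V → ℝ}
    {h' : V → V} {L : ℝ} (hd : ∀ z ∈ S, HasGradientAt h (h' z) z)
    (hL : ∀ z ∈ S, ∀ z' ∈ S, ‖h' z - h' z'‖ ≤ L * ‖z - z'‖) {z z' : V} (hz : z ∈ S)
    (hz' : z' ∈ S) : h z' ≤ h z + inner ℝ (h' z) (z' - z) + L / 2 * ‖z' - z‖ ^ 2 := by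
  set D := z' - z with hD
  have hmem : ∀ t ∈ Icc (0 : ℝ) 1, z + t • D ∈ S := fun t ht => by
    have := hS hz hz' (sub_nonneg.2 ht.2) ht.1 (by ring)
    convert this using 1
    rw [hD]; module
  -- The excess of `h` over its quadratic model along the segment. The Lipschitz bound makes its
  -- derivative nonpositive, so `ψ 1 ≤ ψ 0`.
  set ψ : ℝ → ℝ := fun t => h (z + t • D) - t * inner ℝ (h' z) D - L / 2 * t ^ 2 * ‖D‖ ^ 2
  have hder : ∀ t ∈ Icc (0 : ℝ) 1, HasDerivAt ψ
      (inner ℝ (h' (z + t • D)) D - inner ℝ (h' z) D - L * t * ‖D‖ ^ 2) t := by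
    intro t ht
    have h1 : HasDerivAt (fun t : ℝ => z + t • D) D t := by
      simpa using ((hasDerivAt_id t).smul_const D).const_add z
    have h2 : HasDerivAt (fun t : ℝ => h (z + t • D)) (inner ℝ (h' (z + t • D)) D) t := by
      have := (hd _ (hmem t ht)).hasFDerivAt.comp_hasDerivAt t h1
      simpa [Function.comp_def] using this
    have h3 := (h2.sub ((hasDerivAt_id t).mul_const (inner ℝ (h' z) D))).sub
      (((hasDerivAt_pow 2 t).const_mul (L / 2)).mul_const (‖D‖ ^ 2))
    refine h3.congr_deriv ?_
    push_cast
    ring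
  have hanti : AntitoneOn ψ (Icc 0 1) := by
    refine antitoneOn_of_deriv_nonpos (convex_Icc 0 1)
      (fun t ht => (hder t ht).continuousAt.continuousWithinAt) ?_ ?_
    · rw [interior_Icc]
      exact fun t ht => (hder t (Ioo_subset_Icc_self ht)).differentiableAt.differentiableWithinAt
    · rw [interior_Icc]
      intro t ht
      have ht' := Ioo_subset_Icc_self ht
      rw [(hder t ht').deriv, ← inner_sub_left]
      have h1 := real_inner_le_norm (h' (z + t • D) - h' z) D
      have h2 := hL _ (hmem t ht') _ hz
      rw [add_sub_cancel_left, norm_smul, Real.norm_of_nonneg ht'.1] at h2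
      have h3 := mul_le_mul_of_nonneg_right h2 (norm_nonneg D)
      nlinarith
  have h01 := hanti (left_mem_Icc.2 zero_le_one) (right_mem_Icc.2 zero_le_one) zero_le_one
  simp only [ψ, one_smul, zero_smul, add_zero, zero_mul, one_mul, one_pow, sub_zero] at h01
  have : z + D = z' := by rw [hD]; abel
  rw [this] at h01
  simp at h01
  linarith

theorem add_sub_sq_le_of_lipschitz_gradient [CompleteSpace V] {S : Set V} (hS : Convex ℝ S)
    {h : V → ℝ} {h' : V → V} {L : ℝ} (hd : ∀ z ∈ S, HasGradientAt h (h' z) z)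
    (hL : ∀ z ∈ S, ∀ z' ∈ S, ‖h' z - h' z'‖ ≤ L * ‖z - z'‖) {z z' : V} (hz : z ∈ S)
    (hz' : z' ∈ S) : h z + inner ℝ (h' z) (z' - z) - L / 2 * ‖z' - z‖ ^ 2 ≤ h z' := by
  have h1 : ∀ z ∈ S, HasGradientAt (fun z => -h z) (-h' z) z := fun z hz => by
    have := (hd z hz).hasFDerivAt.neg
    rw [hasGradientAt_iff_hasFDerivAt, map_neg]
    exact this
  have := le_add_sq_of_lipschitz_gradient hS h1
    (fun z hz z' hz' => by rw [← neg_sub', norm_neg]; exact hL z hz z' hz') hz hz'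
  rw [inner_neg_left] at this
  linarith

/-- Elements of the limiting subdifferential of a convex function are subgradients in the sense
of convex analysis. -/
theorem ConvexOn.subgradient_of_mem_limitingSubdiff {S : Set V} {h : V → ℝ}
    (hh : ConvexOn ℝ S h) {z₀ ξ : V} (hξ : ξ ∈ limitingSubdiff (extend S h) z₀) :
    ∀ z ∈ S, h z₀ + inner ℝ ξ (z - z₀) ≤ h z := by
  have mem_of : ∀ z, extend S h z ≠ ⊤ → z ∈ S := fun z hz => by
    by_contra hn
    simp [extend, hn] at hz
  obtain ⟨h1, -, zs, ws, hzs, hhs, hws, hwlim⟩ := hξ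
  have hz₀ := mem_of _ h1
  intro z hz
  have hstep : ∀ k, h (zs k) + inner ℝ (ws k) (z - zs k) ≤ h z := by
    intro k
    obtain ⟨hk1, -, hk⟩ := hws k
    have hkS := mem_of _ hk1
    -- A single small `t` suffices: the Fréchet inequality at that point of the segment is carried
    -- to `z` by convexity. The slope `e / (‖z - zs k‖ + 1)` keeps the error below `e`.
    refine le_of_forall_pos_le_add fun e he => ?_
    have hev := hk (e / (‖z - zs k‖ + 1)) (by positivity)
    have hpath : Tendsto (fun t : ℝ => zs k + t • (z - zs k)) (𝓝[>] 0) (𝓝 (zs k)) := by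
      have : Tendsto (fun t : ℝ => zs k + t • (z - zs k)) (𝓝 0)
          (𝓝 (zs k + (0 : ℝ) • (z - zs k))) := by
        apply Continuous.tendsto; fun_prop
      rw [zero_smul, add_zero] at this
      exact this.mono_left nhdsWithin_le_nhds
    obtain ⟨t, ht, ht0, ht1⟩ := ((hpath.eventually hev).and
      (Ioc_mem_nhdsGT (zero_lt_one' ℝ))).exists
    have hmem := hh.1 hkS hz (sub_nonneg.2 ht1) ht0.le (by ring)
    have hcv := hh.2 hkS hz (sub_nonneg.2 ht1) ht0.le (by ring)
    have heq : (1 - t) • zs k + t • z = zs k + t • (z - zs k) := by module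
    rw [heq] at hmem hcv
    simp only [extend, hmem, hkS, if_true, add_sub_cancel_left] at ht
    rw [← EReal.coe_add, EReal.coe_le_coe_iff, inner_smul_right, norm_smul,
      Real.norm_of_nonneg ht0.le] at ht
    simp only [smul_eq_mul] at hcv
    have h5 : e / (‖z - zs k‖ + 1) * ‖z - zs k‖ ≤ e := by
      rw [div_mul_eq_mul_div, div_le_iff₀ (by positivity)]
      nlinarith
    have h6 : t * (h (zs k) + inner ℝ (ws k) (z - zs k)) ≤ t * (h z + e) := by
      have h7 := mul_le_mul_of_nonneg_left h5 ht0.le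
      nlinarith
    exact le_of_mul_le_mul_left h6 ht0
  have hlim1 : Tendsto (fun k => h (zs k)) atTop (𝓝 (h z₀)) := by
    have e1 : ∀ k, extend S h (zs k) = (h (zs k) : EReal) := fun k => by
      simp [extend, mem_of _ (hws k).1]
    have e2 : extend S h z₀ = (h z₀ : EReal) := by simp [extend, hz₀]
    simp only [e1, e2] at hhs
    exact EReal.tendsto_coe.1 hhs
  have hlim2 : Tendsto (fun k => inner ℝ (ws k) (z - zs k)) atTop (𝓝 (inner ℝ ξ (z - z₀))) :=
    hwlim.inner (tendsto_const_nhds.sub hzs)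
  exact le_of_tendsto (hlim1.add hlim2) (Eventually.of_forall hstep)

/-- A quadratic error is `o(‖z - z₀‖)`, and outside `S` the inequality is void. The Fréchet
subgradients of `g` and of the merit function are all produced in this way. -/
theorem mem_frechetSubdiff_of_quadratic {S : Set V} {h : V → ℝ} {z₀ a : V} (hz₀ : z₀ ∈ S)
    {C : ℝ} (hq : ∀ z ∈ S, h z₀ + inner ℝ a (z - z₀) - C * ‖z - z₀‖ ^ 2 ≤ h z) :
    a ∈ frechetSubdiff (extend S h) z₀ := by
  have e2 : extend S h z₀ = (h z₀ : EReal) := by simp [extend, hz₀]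
  refine ⟨by simp [e2], by simp [e2], fun e he => ?_⟩
  have hlim : Tendsto (fun z => C * ‖z - z₀‖) (𝓝 z₀) (𝓝 0) := by
    have : Tendsto (fun z => C * ‖z - z₀‖) (𝓝 z₀) (𝓝 (C * ‖z₀ - z₀‖)) := by
      apply Continuous.tendsto; fun_prop
    simpa using this
  filter_upwards [hlim.eventually (gt_mem_nhds he)] with z hz
  by_cases hzS : z ∈ S
  · simp only [extend, hzS, hz₀, if_true]
    rw [← EReal.coe_add, EReal.coe_le_coe_iff]
    have := hq z hzS
    have h2 := mul_le_mul_of_nonneg_right hz.le (norm_nonneg (z - z₀))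
    nlinarith
  · simp [extend, hzS]

theorem frechetSubdiff_subset_limitingSubdiff (h : V → EReal) (z₀ : V) :
    frechetSubdiff h z₀ ⊆ limitingSubdiff h z₀ := fun v hv =>
  ⟨hv.1, hv.2.1, fun _ => z₀, fun _ => v, tendsto_const_nhds, tendsto_const_nhds,
    fun _ => hv, tendsto_const_nhds⟩

theorem argminOn_spec {V : Type} [NormedAddCommGroup V] {S : Set V} {h : V → ℝ} (hex : ∃ z ∈ S, IsMinOn h S z) :
    argminOn S h ∈ S ∧ IsMinOn h S (argminOn S h) := by
  obtain ⟨z, hz⟩ := hex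
  exact Classical.epsilon_spec (p := fun z => z ∈ S ∧ IsMinOn h S z) ⟨z, hz⟩

/-- Membership and first order optimality of the proximal mapping. -/
theorem prox_spec [FiniteDimensional ℝ V] {S : Set V} {h : V → ℝ}
    (hS : IsClosed S) (hne : S.Nonempty) (hh : ConvexOn ℝ S h) (hc : ContinuousOn h S) (w : V) :
    prox S h w ∈ S ∧ ∀ z ∈ S, h (prox S h w) + inner ℝ (w - prox S h w) (z - prox S h w) ≤ h z := by
  have hex := hh.exists_isMinOn_add_sq hS hne hc (c := 1 / 2) (by norm_num) w
  have heq : (fun θ => h θ + ‖θ - w‖ ^ 2 / 2) = fun z => h z + 1 / 2 * ‖z - w‖ ^ 2 := by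
    ext z; ring
  have := argminOn_spec hex
  rw [← heq] at this
  change prox S h w ∈ S ∧ IsMinOn _ S (prox S h w) at this
  refine ⟨this.1, fun z hz => ?_⟩
  have h2 := this.2
  rw [heq] at h2
  have h3 := hh.subgradient_of_isMinOn_add_sq this.1 h2 z hz
  simpa using h3

/-- Membership and first order optimality of the projection. -/
theorem proj_spec [FiniteDimensional ℝ V] {S : Set V} (hS : IsClosed S) (hcv : Convex ℝ S)
    (hne : S.Nonempty) (w : V) :
    proj S w ∈ S ∧ ∀ z ∈ S, inner ℝ (w - proj S w) (z - proj S w) ≤ 0 := by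
  have hconv : ConvexOn ℝ S (fun _ : V => (0 : ℝ)) := convexOn_const 0 hcv
  obtain ⟨q, hq, hqm⟩ := hconv.exists_isMinOn_add_sq hS hne continuousOn_const
    (c := 1) one_pos w
  have hex : ∃ z ∈ S, IsMinOn (fun z => ‖z - w‖) S z := by
    refine ⟨q, hq, fun z hz => ?_⟩
    have : 0 + 1 * ‖q - w‖ ^ 2 ≤ 0 + 1 * ‖z - w‖ ^ 2 := hqm hz
    simp only [one_mul, zero_add] at this
    exact le_of_sq_le_sq this (norm_nonneg _)
  have h1 : proj S w ∈ S ∧ IsMinOn _ S (proj S w) := argminOn_spec hex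
  refine ⟨h1.1, fun z hz => ?_⟩
  have h2 : IsMinOn (fun z => (0 : ℝ) + 1 / 2 * ‖z - w‖ ^ 2) S (proj S w) := fun z hz => by
    have h3 : ‖proj S w - w‖ ≤ ‖z - w‖ := h1.2 hz
    have h4 := pow_le_pow_left₀ (norm_nonneg _) h3 2
    change (0 : ℝ) + 1 / 2 * ‖proj S w - w‖ ^ 2 ≤ 0 + 1 / 2 * ‖z - w‖ ^ 2
    linarith
  have h3 := hconv.subgradient_of_isMinOn_add_sq h1.1 h2 z hz
  simpa using h3

end Generic

/-! ### Real sequences -/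

/-- The partial sums of `a` plus twice the next term grow by at most `2 * b k` at each step, since
the halved term absorbs the new summand. The sign of `b` is free, hence the absolute values. -/
theorem summable_of_le_half_add {a b : ℕ → ℝ} (ha : ∀ k, 0 ≤ a k) (hb : Summable b)
    (h : ∀ᶠ k in atTop, a (k + 1) ≤ a k / 2 + b k) : Summable a := by
  obtain ⟨K, hK⟩ := eventually_atTop.1 h
  rw [← summable_nat_add_iff K]
  have hbK : Summable fun k => |b (k + K)| := ((summable_nat_add_iff K).2 hb).abs
  have hle : ∀ n, ∑ k ∈ Finset.range n, a (k + K) + 2 * a (n + K)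
      ≤ 2 * a K + 2 * ∑ k ∈ Finset.range n, |b (k + K)| := by
    intro n
    induction n with
    | zero => simp
    | succ n ih =>
      rw [Finset.sum_range_succ, Finset.sum_range_succ]
      have h1 := hK (n + K) (by omega)
      have h2 := le_abs_self (b (n + K))
      have h3 : n + 1 + K = n + K + 1 := by omega
      rw [h3]
      linarith
  refine summable_of_sum_range_le (c := 2 * a K + 2 * ∑' k, |b (k + K)|) (fun k => ha _) fun n => ?_
  have h1 := hbK.sum_le_tsum (Finset.range n) (fun _ _ => abs_nonneg _)
  have h2 := hle n
  have h3 := ha (n + K)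
  linarith

/-- Local convergence: a sequence with small, almost contracting steps near one of its cluster
points converges to that point. -/
theorem tendsto_of_local_contraction {V : Type} [NormedAddCommGroup V]
    {z : ℕ → V} {zb : V} {r : ℝ} (hr : 0 < r) {h : ℕ → ℝ} (hh0 : ∀ k, 0 ≤ h k) (hh : Summable h)
    (hcl : MapClusterPt zb atTop z)
    (hd : Tendsto (fun k => ‖z (k + 1) - z k‖) atTop (𝓝 0))
    (hstep : ∀ᶠ k in atTop, ‖z k - zb‖ < r → ‖z (k + 1) - zb‖ < r →
      ‖z (k + 2) - z (k + 1)‖ ≤ ‖z (k + 1) - z k‖ / 2 + h k) :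
    Tendsto z atTop (𝓝 zb) := by
  rw [Metric.tendsto_atTop]
  intro e he
  set ρ := min e r with hρ
  have hρ0 : 0 < ρ := lt_min he hr
  have htail : Tendsto (fun i => ∑' k, h (k + i)) atTop (𝓝 0) := tendsto_sum_nat_add h
  -- The budget: distance `ρ/4` at the start, twice the first step below `ρ/4`, and twice the tail
  -- of `h` below `ρ/4` add up to less than `ρ`.
  obtain ⟨N, hN1, hN2, hN3, hN4⟩ : ∃ N, ‖z N - zb‖ < ρ / 4 ∧
      (∀ k ≥ N, ‖z k - zb‖ < r → ‖z (k + 1) - zb‖ < r →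
      ‖z (k + 2) - z (k + 1)‖ ≤ ‖z (k + 1) - z k‖ / 2 + h k) ∧
      ‖z (N + 1) - z N‖ < ρ / 8 ∧ ∑' k, h (k + N) < ρ / 8 := by
    have hfr : ∃ᶠ k in atTop, z k ∈ Metric.ball zb (ρ / 4) :=
      hcl.frequently (Metric.ball_mem_nhds zb (by positivity))
    have hev := (eventually_forall_ge_atTop.2 hstep).and
      ((hd.eventually (gt_mem_nhds (show (0 : ℝ) < ρ / 8 by positivity))).and
        (htail.eventually (gt_mem_nhds (show (0 : ℝ) < ρ / 8 by positivity))))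
    obtain ⟨N, h1, h2, h3, h4⟩ := (hfr.and_eventually hev).exists
    exact ⟨N, by simpa [dist_eq_norm] using h1, h2, h3, h4⟩
  have hsumle : ∀ n, ∑ k ∈ Finset.range n, h (k + N) < ρ / 8 := fun n =>
    (((summable_nat_add_iff N).2 hh).sum_le_tsum _ (fun _ _ => hh0 _)).trans_lt hN4
  -- Both facts are carried together: staying in the ball licenses the contraction, and the length
  -- bound from the contraction keeps the next point in the ball.
  have key : ∀ n, (∀ j ≤ n, ‖z (j + N) - zb‖ < ρ) ∧
      ∑ j ∈ Finset.range n, ‖z (j + N + 1) - z (j + N)‖ + 2 * ‖z (n + N + 1) - z (n + N)‖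
        ≤ 2 * ‖z (N + 1) - z N‖ + 2 * ∑ k ∈ Finset.range n, h (k + N) := by
    intro n
    induction n with
    | zero =>
      refine ⟨fun j hj => ?_, by simp⟩
      obtain rfl : j = 0 := by omega
      simp only [zero_add]
      linarith
    | succ n ih =>
      have hlast : ‖z (n + 1 + N) - zb‖ < ρ := by
        have h1 : ‖z (n + 1 + N) - z N‖ ≤
            ∑ j ∈ Finset.range (n + 1), ‖z (j + N + 1) - z (j + N)‖ := by
          have := norm_sum_le (Finset.range (n + 1)) (fun j => z (j + N + 1) - z (j + N))
          have h2 := Finset.sum_range_sub (fun j => z (j + N)) (n + 1)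
          simp only [zero_add] at h2
          rw [← h2]
          refine le_trans (le_of_eq ?_) this
          congr 1
          refine Finset.sum_congr rfl fun j _ => ?_
          rw [show j + 1 + N = j + N + 1 by omega]
        rw [Finset.sum_range_succ] at h1
        have h3 : ‖z (n + 1 + N) - zb‖ ≤ ‖z (n + 1 + N) - z N‖ + ‖z N - zb‖ := by
          have := norm_add_le (z (n + 1 + N) - z N) (z N - zb)
          simpa using this
        have h4 := hsumle n
        have h5 := norm_nonneg (z (n + N + 1) - z (n + N))
        linarith [ih.2]
      have hr' : ρ ≤ r := min_le_right _ _
      refine ⟨fun j hj => ?_, ?_⟩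
      · rcases Nat.lt_or_ge j (n + 1) with hj' | hj'
        · exact ih.1 j (by omega)
        · obtain rfl : j = n + 1 := by omega
          exact hlast
      · rw [Finset.sum_range_succ, Finset.sum_range_succ]
        have h1 := hN2 (n + N) (by omega) ((ih.1 n le_rfl).trans_le hr')
          (by rw [show n + N + 1 = n + 1 + N by omega]; exact hlast.trans_le hr')
        rw [show n + 1 + N = n + N + 1 by omega]
        linarith [ih.2]
  refine ⟨N, fun k hk => ?_⟩
  have := (key (k - N)).1 (k - N) le_rfl
  rw [Nat.sub_add_cancel hk] at this
  rw [dist_eq_norm]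
  exact this.trans_le (min_le_left _ _)

/-- A power weight with exponent larger than one under which the squared tolerances are summable. -/
theorem exists_weight_of_summable {s : ℕ → ℝ} (hs0 : ∀ k, 0 ≤ s k) (hs : Summable s) {ps : ℝ}
    (hps : ps < 2) (hs' : Summable fun k : ℕ => (k : ℝ) * s k ^ ps) :
    ∃ q : ℝ, 1 < q ∧ q ≤ 2 ∧ Summable fun k : ℕ => ((k : ℝ) + 1) ^ q * s k ^ 2 := by
  -- Raising the exponent is harmless because eventually `s k < 1`; it ensures `p > 0` and `δ ≤ 1`.
  -- The choice of `δ` gives `p + pδ = 2`, so `k^(1+δ) s² = (k s^p)(k s^p)^δ`, whose last factor is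
  -- eventually at most `1`.
  set p := max ps 1 with hp
  have hp1 : 1 ≤ p := le_max_right _ _
  have hp2 : p < 2 := max_lt hps (by norm_num)
  have hp0 : 0 < p := by linarith
  set δ := (2 - p) / p with hδ
  have hδ0 : 0 < δ := div_pos (by linarith) hp0
  have hδ1 : δ ≤ 1 := by rw [hδ, div_le_one hp0]; linarith
  refine ⟨1 + δ, by linarith, by linarith, ?_⟩
  have hlim1 := hs.tendsto_atTop_zero
  have hlim2 := hs'.tendsto_atTop_zero
  refine (hs'.mul_left 4).of_norm_bounded_eventually_nat ?_
  filter_upwards [hlim1.eventually (gt_mem_nhds (zero_lt_one' ℝ)),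
    hlim2.eventually (gt_mem_nhds (zero_lt_one' ℝ)), eventually_ge_atTop 1] with k h1 h2 hk
  have hk1 : (1 : ℝ) ≤ k := by exact_mod_cast hk
  have hk0 : (0 : ℝ) < k := by linarith
  rw [Real.norm_of_nonneg (by positivity)]
  rcases (hs0 k).eq_or_lt with h0 | h0
  · rw [← h0]
    have : (0 : ℝ) ≤ 4 * (k * 0 ^ ps) := by positivity
    simpa using this
  have hsp : s k ^ p ≤ s k ^ ps := Real.rpow_le_rpow_of_exponent_ge h0 h1.le (le_max_left _ _)
  have hksp : (k : ℝ) * s k ^ p ≤ 1 := (mul_le_mul_of_nonneg_left hsp hk0.le).trans h2.le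
  have hone : ((k : ℝ) * s k ^ p) ^ δ ≤ 1 :=
    Real.rpow_le_one (by positivity) hksp hδ0.le
  have hsq : s k ^ 2 = s k ^ p * (s k ^ p) ^ δ := by
    rw [← Real.rpow_mul h0.le, ← Real.rpow_add h0, hδ, mul_div_cancel₀ _ hp0.ne',
      ← Real.rpow_natCast]
    congr 1; push_cast; ring
  have hw : ((k : ℝ) + 1) ^ (1 + δ) ≤ 4 * k ^ (1 + δ) := by
    have h3 : ((k : ℝ) + 1) ^ (1 + δ) ≤ (2 * k) ^ (1 + δ) :=
      Real.rpow_le_rpow (by positivity) (by linarith) (by linarith)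
    have h4 : (2 : ℝ) ^ (1 + δ) ≤ 2 ^ (2 : ℝ) :=
      Real.rpow_le_rpow_of_exponent_le (by norm_num) (by linarith)
    rw [Real.mul_rpow (by norm_num) hk0.le] at h3
    refine h3.trans (mul_le_mul_of_nonneg_right (h4.trans (by norm_num)) (by positivity))
  calc ((k : ℝ) + 1) ^ (1 + δ) * s k ^ 2 ≤ 4 * k ^ (1 + δ) * s k ^ 2 :=
        mul_le_mul_of_nonneg_right hw (by positivity)
    _ = 4 * (k * s k ^ p) * ((k : ℝ) * s k ^ p) ^ δ := by
        rw [hsq, Real.rpow_add hk0, Real.rpow_one,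
          Real.mul_rpow hk0.le (Real.rpow_nonneg h0.le p)]
        ring
    _ ≤ 4 * (k * s k ^ p) * 1 := mul_le_mul_of_nonneg_left hone (by positivity)
    _ ≤ 4 * (k * s k ^ ps) := by
        rw [mul_one]
        exact mul_le_mul_of_nonneg_left (mul_le_mul_of_nonneg_left hsp hk0.le) (by norm_num)

/-- Summability of residuals that satisfy a relative error criterion. -/
theorem summable_relative_errors {c s τ r : ℕ → ℝ} (hc : ∀ k, 0 ≤ c k)
    (hc4 : ∀ k, c (k + 1) ≤ 4 * c k) (hs0 : ∀ k, 0 ≤ s k) (hs : Summable s)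
    (hcs : Summable fun k => c k * s k ^ 2) (hτ0 : ∀ k, 0 ≤ τ k) (hτ : Tendsto τ atTop (𝓝 0))
    (hr0 : ∀ k, 0 ≤ r k) (hr : ∀ k, r (k + 1) ≤ s (k + 1) + τ (k + 1) * r k) :
    (Summable fun k => s (k + 1) + τ (k + 1) * r k) ∧
      Summable fun k => c (k + 1) * (s (k + 1) + τ (k + 1) * r k) ^ 2 := by
  -- Squaring then leaves the factor `1/8` on `r²`; the growth factor `4` of `c` turns it into
  -- `1/2`, so the weighted squares still contract.
  have hev : ∀ᶠ k in atTop, τ (k + 1) < 1 / 4 :=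
    (tendsto_add_atTop_iff_nat 1).2 hτ |>.eventually (gt_mem_nhds (by norm_num))
  have hs1 : Summable fun k => s (k + 1) := (summable_nat_add_iff 1).2 hs
  have hcs1 : Summable fun k => c (k + 1) * s (k + 1) ^ 2 := (summable_nat_add_iff 1).2 hcs
  have hsq : ∀ k, τ (k + 1) < 1 / 4 → c (k + 1) * (s (k + 1) + τ (k + 1) * r k) ^ 2
      ≤ c k * r k ^ 2 / 2 + 2 * (c (k + 1) * s (k + 1) ^ 2) := by
    intro k hk
    have h1 : (s (k + 1) + τ (k + 1) * r k) ^ 2 ≤ 2 * s (k + 1) ^ 2 + r k ^ 2 / 8 := by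
      have h3 : τ (k + 1) * r k ≤ r k / 4 := by nlinarith [hr0 k]
      have h4 : (s (k + 1) + τ (k + 1) * r k) ^ 2 ≤ (s (k + 1) + r k / 4) ^ 2 :=
        pow_le_pow_left₀ (add_nonneg (hs0 _) (mul_nonneg (hτ0 _) (hr0 _))) (by linarith) 2
      nlinarith [sq_nonneg (s (k + 1) - r k / 4)]
    have h5 := mul_le_mul_of_nonneg_left h1 (hc (k + 1))
    have h6 := mul_le_mul_of_nonneg_right (hc4 k) (sq_nonneg (r k))
    nlinarith
  have hrs : Summable r := by
    refine summable_of_le_half_add hr0 hs1 ?_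
    filter_upwards [hev] with k hk
    nlinarith [hr k, hr0 k]
  have hcr : Summable fun k => c k * r k ^ 2 := by
    refine summable_of_le_half_add (fun k => mul_nonneg (hc k) (sq_nonneg _)) (hcs1.mul_left 2) ?_
    filter_upwards [hev] with k hk
    exact (mul_le_mul_of_nonneg_left (pow_le_pow_left₀ (hr0 _) (hr k) 2) (hc _)).trans (hsq k hk)
  constructor
  · refine (hs1.add hrs).of_norm_bounded_eventually_nat ?_
    filter_upwards [hev] with k hk
    rw [Real.norm_of_nonneg (add_nonneg (hs0 _) (mul_nonneg (hτ0 _) (hr0 _)))]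
    nlinarith [hr0 k]
  · refine ((hcr.div_const 2).add (hcs1.mul_left 2)).of_norm_bounded_eventually_nat ?_
    filter_upwards [hev] with k hk
    rw [Real.norm_of_nonneg (mul_nonneg (hc _) (sq_nonneg _))]
    exact hsq k hk

/-- The decrease of the minimum of a nonincreasing sequence and the tail sums of a series is
summable with the weights of that series. -/
theorem summable_weighted_decrease {c E T W : ℕ → ℝ} (hc : ∀ k, 0 ≤ c k) (hmono : Monotone c)
    (hE0 : ∀ k, 0 ≤ E k) (hcE : Summable fun k => c k * E k) (hE : Summable E)
    (hT : ∀ k, T k = ∑' j, E (j + k)) (hW0 : ∀ k, 0 ≤ W k) (hWanti : Antitone W)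
    (hWT : ∀ k, W k ≤ T k) : Summable fun k => c k * (W k - W (k + 1)) := by
  have hTsucc : ∀ k, T k = E k + T (k + 1) := fun k => by
    have h1 := ((summable_nat_add_iff k).2 hE).tsum_eq_zero_add
    rw [hT, hT, h1, zero_add]
    congr 1
    refine tsum_congr fun j => ?_
    rw [show j + 1 + k = j + (k + 1) by omega]
  -- Summation by parts, with boundary term `c n * (T n - W n)`. The slack `T - W` is nonnegative,
  -- so the growing weights only enlarge this term.
  have hle : ∀ n, ∑ k ∈ Finset.range n, c k * (W k - W (k + 1))
      ≤ ∑ k ∈ Finset.range n, c k * E k + c n * (T n - W n) := by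
    intro n
    induction n with
    | zero => simpa using mul_nonneg (hc 0) (sub_nonneg.2 (hWT 0))
    | succ n ih =>
      rw [Finset.sum_range_succ, Finset.sum_range_succ]
      have h1 := mul_le_mul_of_nonneg_right (hmono (Nat.le_succ n))
        (sub_nonneg.2 (hWT (n + 1)))
      have h2 := hTsucc n
      simp only [Nat.succ_eq_add_one] at h1
      have h3 : c n * T n = c n * E n + c n * T (n + 1) := by rw [h2]; ring
      nlinarith
  refine summable_of_sum_range_le (c := ∑' k, c k * E k)
    (fun k => mul_nonneg (hc k) (sub_nonneg.2 (hWanti (Nat.le_succ k)))) fun n => ?_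
  have h1 : c n * (T n - W n) ≤ ∑' j, c (j + n) * E (j + n) := by
    calc c n * (T n - W n) ≤ c n * T n :=
          mul_le_mul_of_nonneg_left (by linarith [hW0 n]) (hc n)
      _ = ∑' j, c n * E (j + n) := by rw [hT, tsum_mul_left]
      _ ≤ _ := by
          refine Summable.tsum_le_tsum (fun j => ?_) (((summable_nat_add_iff n).2 hE).mul_left _)
            ((summable_nat_add_iff n).2 hcE)
          exact mul_le_mul_of_nonneg_right (hmono (Nat.le_add_left n j)) (hE0 _)
  have h2 := hcE.sum_add_tsum_nat_add n
  linarith [hle n]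

/-- A sequence with sufficient decrease up to square summable errors converges. -/
theorem exists_tendsto_of_descent {E d e : ℕ → ℝ} {a b : ℝ} (ha : 0 < a) (hb : 0 ≤ b)
    (hE0 : ∀ k, 0 ≤ E k) (he : Summable fun k => e k ^ 2)
    (hdesc : ∀ k, E (k + 1) + a * d k ^ 2 ≤ E k + b * e k ^ 2) :
    ∃ Es, Tendsto E atTop (𝓝 Es) ∧ Tendsto (fun k => d k ^ 2) atTop (𝓝 0) := by
  set T : ℕ → ℝ := fun k => ∑' j, b * e (j + k) ^ 2 with hT
  have hbe : Summable fun k => b * e k ^ 2 := he.mul_left b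
  have hTlim : Tendsto T atTop (𝓝 0) := tendsto_sum_nat_add fun k => b * e k ^ 2
  have hT0 : ∀ k, 0 ≤ T k := fun k => tsum_nonneg fun j => by positivity
  have hTsucc : ∀ k, T k = b * e k ^ 2 + T (k + 1) := fun k => by
    have h1 := ((summable_nat_add_iff k).2 hbe).tsum_eq_zero_add
    simp only [hT, h1, zero_add]
    congr 1
    refine tsum_congr fun j => ?_
    rw [show j + 1 + k = j + (k + 1) by omega]
  have hstep : ∀ k, E (k + 1) + T (k + 1) + a * d k ^ 2 ≤ E k + T k := fun k => by
    linarith [hdesc k, hTsucc k]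
  have hanti : Antitone fun k => E k + T k := antitone_nat_of_succ_le fun k => by
    have : 0 ≤ a * d k ^ 2 := by positivity
    linarith [hstep k]
  have hlim := tendsto_atTop_ciInf hanti ⟨0, by
    rintro _ ⟨k, rfl⟩
    exact add_nonneg (hE0 k) (hT0 k)⟩
  refine ⟨_, by simpa using hlim.sub hTlim, ?_⟩
  have h1 : Tendsto (fun k => ((E k + T k) - (E (k + 1) + T (k + 1))) / a) atTop (𝓝 0) := by
    have := (hlim.sub ((tendsto_add_atTop_iff_nat 1).2 hlim)).div_const a
    simpa using this
  refine squeeze_zero (fun k => sq_nonneg _) (fun k => ?_) h1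
  rw [le_div_iff₀ ha]
  linarith [hstep k]

/-! ### Desingularizing functions and the KL estimate with errors. -/

namespace IsDesingularizing

variable {ζ : EReal} {φ : ℝ → ℝ}

theorem differentiableAt (hφ : IsDesingularizing ζ φ) {s : ℝ} (hs : 0 < s)
    (hsζ : (s : EReal) < ζ) : DifferentiableAt ℝ φ s := by
  have hopen : IsOpen {s : ℝ | 0 < s ∧ (s : EReal) < ζ} :=
    (isOpen_lt continuous_const continuous_id).inter
      (isOpen_lt continuous_coe_real_ereal continuous_const)
  exact (hφ.contDiffOn.differentiableOn one_ne_zero).differentiableAt (hopen.mem_nhds ⟨hs, hsζ⟩)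

/-- The chord to the left of `s` is at least as steep as the tangent of a concave function at `s`.
The value `t = 0` is included, which covers the case that the energy gap closes. -/
theorem deriv_mul_le (hφ : IsDesingularizing ζ φ) {s t : ℝ} (ht : 0 ≤ t) (hts : t ≤ s)
    (hs : 0 < s) (hsζ : (s : EReal) < ζ) : deriv φ s * (s - t) ≤ φ s - φ t := by
  rcases hts.eq_or_lt with rfl | hlt
  · simp
  · have htζ : (t : EReal) < ζ := lt_of_le_of_lt (EReal.coe_le_coe_iff.2 hts) hsζ
    have := hφ.concave.deriv_le_slope ⟨ht, htζ⟩ ⟨hs.le, hsζ⟩ hlt (hφ.differentiableAt hs hsζ)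
    rw [slope_def_field, le_div_iff₀ (sub_pos.2 hlt)] at this
    exact this

theorem deriv_anti (hφ : IsDesingularizing ζ φ) {s t : ℝ} (ht : 0 < t) (hts : t ≤ s)
    (hsζ : (s : EReal) < ζ) : deriv φ s ≤ deriv φ t := by
  rcases hts.eq_or_lt with rfl | hlt
  · exact le_rfl
  · have htζ : (t : EReal) < ζ := lt_of_le_of_lt (EReal.coe_le_coe_iff.2 hts) hsζ
    exact (hφ.concave.deriv_le_slope ⟨ht.le, htζ⟩ ⟨(ht.trans hlt).le, hsζ⟩ hlt
      (hφ.differentiableAt (ht.trans hlt) hsζ)).trans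
      (hφ.concave.slope_le_deriv ⟨ht.le, htζ⟩ ⟨(ht.trans hlt).le, hsζ⟩ hlt
      (hφ.differentiableAt ht htζ))

theorem mono (hφ : IsDesingularizing ζ φ) {s t : ℝ} (ht : 0 ≤ t) (hts : t ≤ s)
    (hsζ : (s : EReal) < ζ) : φ t ≤ φ s := by
  rcases hts.eq_or_lt with rfl | hlt
  · exact le_rfl
  · have hs := ht.trans_lt hlt
    have h1 := hφ.deriv_mul_le ht hts hs hsζ
    have h2 := mul_nonneg (hφ.deriv_pos s hs hsζ).le (sub_nonneg.2 hts)
    linarith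

end IsDesingularizing

/-- The contraction estimate which the Kurdyka-Łojasiewicz inequality gives for the steps of a
descent method with errors. The steps at which the error terms dominate are controlled by the
weights `c`. -/
theorem exists_summable_contraction {E d e c : ℕ → ℝ} {a b B Es : ℝ} (ha : 0 < a) (hb : 0 ≤ b)
    (hd0 : ∀ k, 0 ≤ d k) (he0 : ∀ k, 0 ≤ e k)
    (hc : ∀ k, 0 < c k) (hmono : Monotone c) (hcinv : Summable fun k => (c k)⁻¹)
    (he : Summable e) (hce : Summable fun k => c k * e k ^ 2)
    (hdesc : ∀ k, E (k + 1) + a * d k ^ 2 ≤ E k + b * e k ^ 2)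
    (hEs : Tendsto E atTop (𝓝 Es)) {ζ : EReal} {φ : ℝ → ℝ} (hζ : 0 < ζ)
    (hφ : IsDesingularizing ζ φ) :
    ∃ h : ℕ → ℝ, (∀ k, 0 ≤ h k) ∧ Summable h ∧ ∀ᶠ k in atTop,
      (Es < E (k + 1) → (E (k + 1) : EReal) < Es + ζ →
        1 ≤ deriv φ (E (k + 1) - Es) * (B * (d k + e k))) →
      d (k + 1) ≤ d k / 2 + h k := by
  have he2 : Summable fun k => e k ^ 2 := by
    refine (hce.mul_left (c 0)⁻¹).of_nonneg_of_le (fun k => sq_nonneg _) fun k => ?_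
    have h1 := mul_le_mul_of_nonneg_right (hmono (Nat.zero_le k)) (sq_nonneg (e k))
    rw [← div_eq_inv_mul, le_div_iff₀ (hc 0)]
    linarith
  set T : ℕ → ℝ := fun k => ∑' j, b * e (j + k) ^ 2 with hT
  have hbe : Summable fun k => b * e k ^ 2 := he2.mul_left b
  have hTlim : Tendsto T atTop (𝓝 0) := tendsto_sum_nat_add fun k => b * e k ^ 2
  have hT0 : ∀ k, 0 ≤ T k := fun k => tsum_nonneg fun j => by positivity
  have hTsucc : ∀ k, T k = b * e k ^ 2 + T (k + 1) := fun k => by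
    have h1 := ((summable_nat_add_iff k).2 hbe).tsum_eq_zero_add
    simp only [hT, h1, zero_add]
    congr 1
    refine tsum_congr fun j => ?_
    rw [show j + 1 + k = j + (k + 1) by omega]
  -- The gap with the remaining error budget added: it decreases by at least `a * d k ^ 2`, with no
  -- error term left.
  set V : ℕ → ℝ := fun k => E k - Es + T k with hV
  have hstep : ∀ k, V (k + 1) + a * d k ^ 2 ≤ V k := fun k => by
    simp only [hV]
    linarith [hdesc k, hTsucc k]
  have hVanti : Antitone V := antitone_nat_of_succ_le fun k => by
    have : 0 ≤ a * d k ^ 2 := by positivity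
    linarith [hstep k]
  have hTanti : Antitone T := antitone_nat_of_succ_le fun k => by
    have : 0 ≤ b * e k ^ 2 := by positivity
    linarith [hTsucc k]
  have hVlim : Tendsto V atTop (𝓝 0) := by
    simpa [hV] using (hEs.sub_const Es).add hTlim
  have hV0 : ∀ k, 0 ≤ V k := fun k => hVanti.le_of_tendsto hVlim k
  obtain ⟨K, hK⟩ : ∃ K, ∀ k ≥ K, (V k : EReal) < ζ := by
    refine eventually_atTop.1 ?_
    have h1 : Tendsto (fun k => (V k : EReal)) atTop (𝓝 ((0 : ℝ) : EReal)) :=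
      (continuous_coe_real_ereal.tendsto 0).comp hVlim
    exact h1.eventually (gt_mem_nhds (by exact_mod_cast hζ))
  have hhalf : ∀ k ≥ K, ((V k / 2 : ℝ) : EReal) < ζ := fun k hk =>
    lt_of_le_of_lt (EReal.coe_le_coe_iff.2 (by linarith [hV0 k])) (hK k hk)
  -- The half is used when the gap exceeds the tail, for then `V/2 ≤ E - Es ≤ V`. Freezing the index
  -- below `K` keeps the argument in `[0, ζ)`.
  set ψ : ℕ → ℝ := fun k => φ (V (max k K) / 2) with hψ
  have hψanti : Antitone ψ := antitone_nat_of_succ_le fun k => by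
    refine hφ.mono (by linarith [hV0 (max (k + 1) K)]) ?_ (hhalf _ (le_max_right _ _))
    have := hVanti (max_le_max_right K (Nat.le_succ k))
    simp only [Nat.succ_eq_add_one] at this
    linarith
  have hψ0 : ∀ k, 0 ≤ ψ k := fun k =>
    hφ.nonneg _ (by linarith [hV0 (max k K)]) (hhalf _ (le_max_right _ _))
  have hψsum : Summable fun k => ψ k - ψ (k + 1) := by
    refine summable_of_sum_range_le (c := ψ 0)
      (fun k => sub_nonneg.2 (hψanti (Nat.le_succ k))) fun n => ?_
    rw [Finset.sum_range_sub']
    linarith [hψ0 n]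
  -- Equal to `V` where the gap is at most the tail, and always bounded by `2 * T`, which makes its
  -- weighted decrease summable.
  set W : ℕ → ℝ := fun k => min (V k) (2 * T k) with hW
  have hWanti : Antitone W := fun i j hij =>
    min_le_min (hVanti hij) (mul_le_mul_of_nonneg_left (hTanti hij) (by norm_num))
  have hWsum : Summable fun k => c k * (W k - W (k + 1)) := by
    refine summable_weighted_decrease (E := fun k => 2 * (b * e k ^ 2)) (T := fun k => 2 * T k)
      (fun k => (hc k).le) hmono (fun k => by positivity) ?_ (hbe.mul_left 2) (fun k => ?_)
      (fun k => le_min (hV0 k) (by linarith [hT0 k])) hWanti (fun k => min_le_right _ _)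
    · refine (hce.mul_left (2 * b)).congr fun k => by ring
    · rw [hT, tsum_mul_left]
  have hWd : ∀ k, 0 ≤ W k - W (k + 1) := fun k => sub_nonneg.2 (hWanti (Nat.le_succ k))
  have hψd : ∀ k, 0 ≤ ψ k - ψ (k + 1) := fun k => sub_nonneg.2 (hψanti (Nat.le_succ k))
  -- The first two terms serve the indices where the KL inequality is used, the last two those where
  -- the tail dominates. Their sum is independent of which case occurs.
  refine ⟨fun k => e k / 2 + |B| / a * (ψ (k + 1) - ψ (k + 1 + 1)) +
    (c (k + 1) * (W (k + 1) - W (k + 1 + 1)) / a + (c (k + 1))⁻¹), fun k => ?_, ?_, ?_⟩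
  · have h1 := hWd (k + 1)
    have h2 := hψd (k + 1)
    have h3 := he0 k
    have h4 := hc (k + 1)
    positivity
  · exact ((he.div_const 2).add (((summable_nat_add_iff 1).2 hψsum).mul_left _)).add
      ((((summable_nat_add_iff 1).2 hWsum).div_const a).add ((summable_nat_add_iff 1).2 hcinv))
  filter_upwards [eventually_ge_atTop K] with k hk hKL
  have hA : 0 ≤ |B| / a * (ψ (k + 1) - ψ (k + 1 + 1)) := mul_nonneg (by positivity) (hψd _)
  have hAA : 0 ≤ c (k + 1) * (W (k + 1) - W (k + 1 + 1)) / a + (c (k + 1))⁻¹ := by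
    have h1 := hWd (k + 1)
    have h4 := hc (k + 1)
    positivity
  have hst := hstep (k + 1)
  rcases le_or_gt (E (k + 1) - Es) (T (k + 1)) with hbad | hgood
  · have h1 : W (k + 1) = V (k + 1) := min_eq_left (by simp only [hV]; linarith)
    have h2 : W (k + 1 + 1) ≤ V (k + 1 + 1) := min_le_left _ _
    have h3 : a * d (k + 1) ^ 2 ≤ W (k + 1) - W (k + 1 + 1) := by linarith
    have hck := hc (k + 1)
    have h4 : c (k + 1) * d (k + 1) ^ 2 ≤ c (k + 1) * (W (k + 1) - W (k + 1 + 1)) / a := by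
      rw [le_div_iff₀ ha]
      have := mul_le_mul_of_nonneg_left h3 hck.le
      linarith
    -- Young's inequality trades the step for its weighted square and `1/c`, both under summable
    -- control.
    have h5 : d (k + 1) ≤ c (k + 1) * d (k + 1) ^ 2 + (c (k + 1))⁻¹ := by
      have h6 : 0 ≤ c (k + 1) * (d (k + 1) - (c (k + 1))⁻¹) ^ 2 := by positivity
      have h7 : c (k + 1) * (d (k + 1) - (c (k + 1))⁻¹) ^ 2
          = c (k + 1) * d (k + 1) ^ 2 - 2 * d (k + 1) + (c (k + 1))⁻¹ := by
        field_simp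
        ring
      linarith [hd0 (k + 1)]
    linarith [hd0 k, he0 k]
  · have hEpos : 0 < E (k + 1) - Es := (hT0 _).trans_lt hgood
    have hVk := hK (k + 1) (by omega)
    have hEV : E (k + 1) - Es ≤ V (k + 1) := by simp only [hV]; linarith [hT0 (k + 1)]
    have hElt : ((E (k + 1) - Es : ℝ) : EReal) < ζ :=
      lt_of_le_of_lt (EReal.coe_le_coe_iff.2 hEV) hVk
    have hkl := hKL (by linarith) (by
      have := EReal.add_lt_add_left_coe hElt Es
      rwa [← EReal.coe_add, add_sub_cancel] at this)
    have hVhalf : V (k + 1) / 2 ≤ E (k + 1) - Es := by simp only [hV]; linarith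
    have hVpos : 0 < V (k + 1) := hEpos.trans_le hEV
    -- The KL inequality concerns the derivative at `E - Es`, the telescoping concerns the one at
    -- `V/2`; since `V/2 ≤ E - Es`, concavity compares them in the needed direction.
    have hder := hφ.deriv_anti (half_pos hVpos) hVhalf hElt
    have htan := hφ.deriv_mul_le (t := V (k + 1 + 1) / 2) (by linarith [hV0 (k + 1 + 1)])
      (by linarith [hVanti (Nat.le_succ (k + 1))]) (half_pos hVpos) (hhalf (k + 1) (by omega))
    have hψ1 : ψ (k + 1) = φ (V (k + 1) / 2) := by
      simp only [hψ]; rw [max_eq_left (by omega)]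
    have hψ2 : ψ (k + 1 + 1) = φ (V (k + 1 + 1) / 2) := by
      simp only [hψ]; rw [max_eq_left (by omega)]
    rw [← hψ1, ← hψ2] at htan
    set D := ψ (k + 1) - ψ (k + 1 + 1) with hD
    set x := d k + e k with hx
    have hx0 : 0 ≤ x := add_nonneg (hd0 k) (he0 k)
    set q := deriv φ (E (k + 1) - Es) with hq
    have hq0 : 0 < q := hφ.deriv_pos _ hEpos hElt
    have h1 : q * (a * d (k + 1) ^ 2 / 2) ≤ D := by
      refine le_trans ?_ htan
      have h2 : 0 ≤ a * d (k + 1) ^ 2 / 2 := by positivity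
      refine mul_le_mul hder (by linarith) h2 (hq0.le.trans hder)
    have h3 : 1 ≤ q * (|B| * x) :=
      hkl.trans (mul_le_mul_of_nonneg_left
        (mul_le_mul_of_nonneg_right (le_abs_self B) hx0) hq0.le)
    have hBx : 0 ≤ |B| * x := by positivity
    have h4 : a * d (k + 1) ^ 2 / 2 ≤ |B| * x * D := by
      have h5 := mul_le_mul_of_nonneg_left h1 hBx
      have h6 := mul_le_mul_of_nonneg_right h3 (show 0 ≤ a * d (k + 1) ^ 2 / 2 by positivity)
      linarith
    have h7 : d (k + 1) ^ 2 ≤ (x / 2 + |B| / a * D) ^ 2 := by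
      have h8 : d (k + 1) ^ 2 ≤ 2 * x * (|B| / a * D) := by
        rw [show 2 * x * (|B| / a * D) = 2 * (|B| * x * D) / a by ring, le_div_iff₀ ha]
        linarith
      nlinarith [sq_nonneg (x / 2 - |B| / a * D)]
    have h9 := le_of_sq_le_sq h7 (by positivity)
    have h10 : x / 2 = d k / 2 + e k / 2 := by rw [hx]; ring
    linarith

/-! ### Calculus on the product space, and scalar estimates. -/

section PairSpace

variable {n m : ℕ}

@[simp] theorem pair_fst (x : Eu n) (y : Eu m) : (pair x y).fst = x := rfl

@[simp] theorem pair_snd (x : Eu n) (y : Eu m) : (pair x y).snd = y := rfl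

theorem pair_eta (z : Pair n m) : pair z.fst z.snd = z := rfl

theorem pair_sub (x x' : Eu n) (y y' : Eu m) : pair x y - pair x' y' = pair (x - x') (y - y') := rfl

theorem norm_pair_sq (x : Eu n) (y : Eu m) : ‖pair x y‖ ^ 2 = ‖x‖ ^ 2 + ‖y‖ ^ 2 :=
  WithLp.prod_norm_sq_eq_of_L2 _

theorem norm_pair_le (x : Eu n) (y : Eu m) : ‖pair x y‖ ≤ ‖x‖ + ‖y‖ := by
  refine le_of_sq_le_sq ?_ (by positivity)
  rw [norm_pair_sq]
  nlinarith [norm_nonneg x, norm_nonneg y]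

theorem inner_pair (x x' : Eu n) (y y' : Eu m) :
    inner ℝ (pair x y) (pair x' y') = inner ℝ x x' + inner ℝ y y' := rfl

theorem continuous_pair : Continuous fun q : Eu n × Eu m => pair q.1 q.2 :=
  WithLp.prod_continuous_toLp 2 _ _

theorem continuous_pair_fst : Continuous fun z : Pair n m => z.fst :=
  (WithLp.prod_continuous_ofLp 2 _ _).fst

theorem continuous_pair_snd : Continuous fun z : Pair n m => z.snd :=
  (WithLp.prod_continuous_ofLp 2 _ _).snd

/-- Partial gradients of a function of the pair with a gradient. -/
theorem HasGradientAt.fst {h : Eu n → Eu m → ℝ} {G z : Pair n m}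
    (hG : HasGradientAt (onPair h) G z) :
    HasGradientAt (fun x => h x z.snd) G.fst z.fst := by
  have h1 : HasFDerivAt (fun x : Eu n => pair x z.snd)
      (((WithLp.prodContinuousLinearEquiv 2 ℝ (Eu n) (Eu m)).symm :
        (Eu n × Eu m) →L[ℝ] Pair n m).comp (ContinuousLinearMap.inl ℝ (Eu n) (Eu m))) z.fst := by
    have h2 : HasFDerivAt (fun x : Eu n => (x, z.snd))
        (ContinuousLinearMap.inl ℝ (Eu n) (Eu m)) z.fst := hasFDerivAt_prodMk_left _ _
    exact ((WithLp.prodContinuousLinearEquiv 2 ℝ (Eu n) (Eu m)).symm :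
        (Eu n × Eu m) →L[ℝ] Pair n m).hasFDerivAt.comp z.fst h2
  have h3 := HasFDerivAt.comp z.fst (g := onPair h) (f := fun x : Eu n => pair x z.snd)
    hG.hasFDerivAt h1
  rw [hasGradientAt_iff_hasFDerivAt]
  refine h3.congr_fderiv ?_
  ext v
  change inner ℝ G (pair v 0) = inner ℝ G.fst v
  rw [← pair_eta G, inner_pair]
  simp

theorem HasGradientAt.snd {h : Eu n → Eu m → ℝ} {G z : Pair n m}
    (hG : HasGradientAt (onPair h) G z) :
    HasGradientAt (fun y => h z.fst y) G.snd z.snd := by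
  have h1 : HasFDerivAt (fun y : Eu m => pair z.fst y)
      (((WithLp.prodContinuousLinearEquiv 2 ℝ (Eu n) (Eu m)).symm :
        (Eu n × Eu m) →L[ℝ] Pair n m).comp (ContinuousLinearMap.inr ℝ (Eu n) (Eu m))) z.snd := by
    have h2 : HasFDerivAt (fun y : Eu m => (z.fst, y))
        (ContinuousLinearMap.inr ℝ (Eu n) (Eu m)) z.snd := hasFDerivAt_prodMk_right _ _
    exact ((WithLp.prodContinuousLinearEquiv 2 ℝ (Eu n) (Eu m)).symm :
        (Eu n × Eu m) →L[ℝ] Pair n m).hasFDerivAt.comp z.snd h2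
  have h3 := HasFDerivAt.comp z.snd (g := onPair h) (f := fun y : Eu m => pair z.fst y)
    hG.hasFDerivAt h1
  rw [hasGradientAt_iff_hasFDerivAt]
  refine h3.congr_fderiv ?_
  ext v
  change inner ℝ G (pair 0 v) = inner ℝ G.snd v
  rw [← pair_eta G, inner_pair]
  simp

theorem hasGradientAt_gradX {h : Eu n → Eu m → ℝ} {x : Eu n} {y : Eu m}
    (hd : DifferentiableAt ℝ (onPair h) (pair x y)) :
    HasGradientAt (fun x' => h x' y) (gradX h x y) x := by
  have h1 : HasGradientAt (fun x' => h x' y) _ x := hd.hasGradientAt.fst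
  rwa [gradX, h1.gradient]

theorem hasGradientAt_gradY {h : Eu n → Eu m → ℝ} {x : Eu n} {y : Eu m}
    (hd : DifferentiableAt ℝ (onPair h) (pair x y)) :
    HasGradientAt (fun y' => h x y') (gradY h x y) y := by
  have h1 : HasGradientAt (fun y' => h x y') _ y := hd.hasGradientAt.snd
  rwa [gradY, h1.gradient]

theorem gradient_onPair {h : Eu n → Eu m → ℝ} {x : Eu n} {y : Eu m}
    (hd : DifferentiableAt ℝ (onPair h) (pair x y)) :
    gradient (onPair h) (pair x y) = pair (gradX h x y) (gradY h x y) := by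
  have h1 : HasGradientAt (fun x' => h x' y) _ x := hd.hasGradientAt.fst
  have h2 : HasGradientAt (fun y' => h x y') _ y := hd.hasGradientAt.snd
  rw [gradX, gradY, h1.gradient, h2.gradient, pair_eta]

/-- A quadratic lower bound in both variables from lower bounds in each of them. -/
theorem quadratic_lower_of_partial {h : Eu n → Eu m → ℝ} {x x' : Eu n} {y y' : Eu m}
    {a a' : Eu n} {b : Eu m} {C₁ C₂ C₃ : ℝ} (hC₁ : 0 ≤ C₁) (hC₂ : 0 ≤ C₂) (hC₃ : 0 ≤ C₃)
    (h1 : h x y' + inner ℝ a' (x' - x) - C₁ * ‖x' - x‖ ^ 2 ≤ h x' y')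
    (h2 : ‖a' - a‖ ≤ C₂ * ‖y' - y‖)
    (h3 : h x y + inner ℝ b (y' - y) - C₃ * ‖y' - y‖ ^ 2 ≤ h x y') :
    h x y + (inner ℝ a (x' - x) + inner ℝ b (y' - y))
      - (C₁ + C₂ + C₃) * (‖x' - x‖ ^ 2 + ‖y' - y‖ ^ 2) ≤ h x' y' := by
  have h4 := neg_le_of_abs_le (abs_real_inner_le_norm (a' - a) (x' - x))
  rw [inner_sub_left] at h4
  have h5 := mul_le_mul_of_nonneg_right h2 (norm_nonneg (x' - x))
  have h6 : C₂ * ‖y' - y‖ * ‖x' - x‖ ≤ C₂ * (‖x' - x‖ ^ 2 + ‖y' - y‖ ^ 2) := by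
    rw [mul_assoc]
    exact mul_le_mul_of_nonneg_left
      (by nlinarith [sq_nonneg (‖x' - x‖ - ‖y' - y‖), sq_nonneg (‖x' - x‖ + ‖y' - y‖)]) hC₂
  have h7 : 0 ≤ C₁ * ‖y' - y‖ ^ 2 := by positivity
  have h8 : 0 ≤ C₃ * ‖x' - x‖ ^ 2 := by positivity
  linarith

end PairSpace

/-- If `t` exceeded the bound, then `r ≤ t`, and the right-hand side of `h` would be at most `(p +
q) * r * t`, contradicting `t ^ 2 > (p + q + 1) * r * t`. -/
theorem le_mul_of_sq_le {p q r t : ℝ} (hp : 0 ≤ p) (hq : 0 ≤ q) (hr : 0 ≤ r)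
    (h : t ^ 2 ≤ p * r * t + q * r ^ 2) : t ≤ (p + q + 1) * r := by
  by_contra! hcon
  have h1 : 0 ≤ p * r := mul_nonneg hp hr
  have h2 : 0 ≤ q * r := mul_nonneg hq hr
  have h3 : r ≤ t := by linarith
  have h4 : 0 < t := by linarith
  have h5 := mul_le_mul_of_nonneg_left h3 h2
  have h6 := mul_lt_mul_of_pos_right hcon h4
  have h7 : 0 ≤ r * t := mul_nonneg hr h4.le
  linarith

/-- Bounds for the displacement `t` of a minimizer and the second order deviation `D` of the
minimum, in terms of the perturbations `u` and `w`. -/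
theorem exists_perturbation_bound {κ A B : ℝ} (hκ : 0 < κ) (hA : 0 ≤ A) (hB : 0 ≤ B) :
    ∃ C : ℝ, 0 ≤ C ∧ ∀ u w t D : ℝ, 0 ≤ u → 0 ≤ w → 0 ≤ t →
      κ / 2 * t ^ 2 - (A * u + κ * w) * t - B / 2 * u ^ 2 ≤ D →
      D ≤ B / 2 * u ^ 2 + κ / 2 * w ^ 2 →
      t ≤ C * (u + w) ∧ |D| ≤ C * (u ^ 2 + w ^ 2) := by
  set G := A + κ with hG
  have hG0 : 0 < G := by linarith
  set p := 2 / κ * G with hp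
  set q := 2 / κ * (B + κ) with hq
  have hp0 : 0 ≤ p := by positivity
  have hq0 : 0 ≤ q := by positivity
  -- Completing the square in `t` bounds the quadratic part below by `-(1/κ) G² (u² + w²)`; `B` and
  -- `κ` account for the remaining terms.
  set N := 2 / κ * G ^ 2 + B + κ with hN
  have hN0 : 0 ≤ N := by positivity
  refine ⟨p + q + 1 + N, by positivity, fun u w t D hu hw ht hlow hup => ?_⟩
  have h1 : (A * u + κ * w) * t ≤ G * (u + w) * t := by
    refine mul_le_mul_of_nonneg_right ?_ ht
    have e1 : 0 ≤ A * w := mul_nonneg hA hw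
    have e2 : 0 ≤ κ * u := mul_nonneg hκ.le hu
    rw [hG]; linarith
  have hBu : 0 ≤ B * u ^ 2 := by positivity
  have hBw : 0 ≤ B * w ^ 2 := by positivity
  have hku : 0 ≤ κ * u ^ 2 := by positivity
  have hkw : 0 ≤ κ * w ^ 2 := by positivity
  constructor
  · have h2 : κ / 2 * t ^ 2 ≤ G * (u + w) * t + (B + κ) * (u + w) ^ 2 := by
      have e1 : 0 ≤ (B + κ) * (u * w) := by positivity
      linarith
    have h3 : t ^ 2 ≤ p * (u + w) * t + q * (u + w) ^ 2 := by
      have e1 := mul_le_mul_of_nonneg_left h2 (show 0 ≤ 2 / κ by positivity)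
      have e2 : 2 / κ * (κ / 2 * t ^ 2) = t ^ 2 := by field_simp
      rw [e2] at e1
      rw [hp, hq]
      linarith
    have h4 := le_mul_of_sq_le hp0 hq0 (add_nonneg hu hw) h3
    have h5 : 0 ≤ N * (u + w) := by positivity
    linarith
  · have h2 : -(1 / κ * G ^ 2 * (u ^ 2 + w ^ 2)) ≤ κ / 2 * t ^ 2 - G * (u + w) * t := by
      have e1 : 0 ≤ κ / 2 * (t - 1 / κ * G * (u + w)) ^ 2 := by positivity
      have e2 : κ / 2 * (t - 1 / κ * G * (u + w)) ^ 2
          = κ / 2 * t ^ 2 - G * (u + w) * t + 1 / κ * G ^ 2 / 2 * (u + w) ^ 2 := by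
        field_simp
        ring
      have e3 : 0 ≤ 1 / κ * G ^ 2 / 2 * (u - w) ^ 2 := by positivity
      linarith
    have h3 : 0 ≤ (p + q + 1) * (u ^ 2 + w ^ 2) := by positivity
    have h4 : N * (u ^ 2 + w ^ 2) = 2 * (1 / κ * G ^ 2 * (u ^ 2 + w ^ 2))
        + B * u ^ 2 + B * w ^ 2 + κ * u ^ 2 + κ * w ^ 2 := by rw [hN]; ring
    have h5 : 0 ≤ 1 / κ * G ^ 2 * (u ^ 2 + w ^ 2) := by positivity
    rw [abs_le]
    constructor <;> linarith

/-! ### The Moreau envelope and its minimizer. -/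

namespace BilevelProblem

variable {n m : ℕ}

/-- The standing assumptions on the lower-level problem. -/
structure IsRegular (P : BilevelProblem n m) (M : Moduli) (γ : ℝ) : Prop where
  sets : P.ConvexSets
  lower : P.LowerConvexAssumption
  smooth : P.LowerSmoothAssumption M
  nonempty_Y : P.Y.Nonempty
  γ_pos : 0 < γ
  γ_lt : γ * (M.ρf2 + M.ρg2) < 1

/-- The partial gradient of the lower-level objective in the first variable. -/
noncomputable def phiX (P : BilevelProblem n m) (x : Eu n) (y : Eu m) : Eu n :=
  gradX P.f x y + gradX P.g x y

/-- The minimizer which defines the Moreau envelope. -/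
noncomputable def envSol (P : BilevelProblem n m) (γ : ℝ) (x : Eu n) (y : Eu m) : Eu m :=
  argminOn P.Y fun θ => P.phi x θ + 1 / (2 * γ) * ‖θ - y‖ ^ 2

namespace IsRegular

variable {P : BilevelProblem n m} {M : Moduli} {γ : ℝ}

theorem hasGradientAt_fX (h : P.IsRegular M γ) {x : Eu n} {y : Eu m} (hx : x ∈ P.X) (hy : y ∈ P.Y) :
    HasGradientAt (fun x' => P.f x' y) (gradX P.f x y) x :=
  hasGradientAt_gradX (h.smooth.diff_f (pair x y) ⟨hx, hy⟩)

theorem hasGradientAt_fY (h : P.IsRegular M γ) {x : Eu n} {y : Eu m} (hx : x ∈ P.X) (hy : y ∈ P.Y) :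
    HasGradientAt (fun y' => P.f x y') (gradY P.f x y) y :=
  hasGradientAt_gradY (h.smooth.diff_f (pair x y) ⟨hx, hy⟩)

theorem lip_fX (h : P.IsRegular M γ) {x x' : Eu n} {y y' : Eu m} (hx : x ∈ P.X) (hx' : x' ∈ P.X)
    (hy : y ∈ P.Y) (hy' : y' ∈ P.Y) :
    ‖gradX P.f x y - gradX P.f x' y'‖ ≤ M.Lfx * (‖x - x'‖ + ‖y - y'‖) :=
  (h.smooth.lip_fx (pair x y) ⟨hx, hy⟩ (pair x' y') ⟨hx', hy'⟩).trans
    (mul_le_mul_of_nonneg_left (norm_pair_le _ _) h.smooth.Lfx_nonneg)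

theorem lip_fY (h : P.IsRegular M γ) {x x' : Eu n} {y y' : Eu m} (hx : x ∈ P.X) (hx' : x' ∈ P.X)
    (hy : y ∈ P.Y) (hy' : y' ∈ P.Y) :
    ‖gradY P.f x y - gradY P.f x' y'‖ ≤ M.Lfy * (‖x - x'‖ + ‖y - y'‖) :=
  (h.smooth.lip_fy (pair x y) ⟨hx, hy⟩ (pair x' y') ⟨hx', hy'⟩).trans
    (mul_le_mul_of_nonneg_left (norm_pair_le _ _) h.smooth.Lfy_nonneg)

theorem hasGradientAt_phiX (h : P.IsRegular M γ) {x : Eu n} {y : Eu m} (hx : x ∈ P.X)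
    (hy : y ∈ P.Y) : HasGradientAt (fun x' => P.phi x' y) (P.phiX x y) x := by
  have h1 : HasGradientAt (fun x' => P.g x' y) (gradX P.g x y) x :=
    (h.smooth.diff_gx x hx y hy).hasGradientAt
  have h2 := (h.hasGradientAt_fX hx hy).hasFDerivAt.add h1.hasFDerivAt
  rw [hasGradientAt_iff_hasFDerivAt, phiX, map_add]
  exact h2

theorem phiX_lip (h : P.IsRegular M γ) {x x' : Eu n} {y y' : Eu m} (hx : x ∈ P.X) (hx' : x' ∈ P.X)
    (hy : y ∈ P.Y) (hy' : y' ∈ P.Y) :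
    ‖P.phiX x y - P.phiX x' y'‖ ≤ (M.Lfx + M.Lg1) * ‖x - x'‖ + (M.Lfx + M.Lg2) * ‖y - y'‖ := by
  have h1 := h.lip_fX hx hx' hy hy'
  have h2 := h.smooth.lip_g1 y hy x hx x' hx'
  have h3 := h.smooth.lip_g2 x' hx' y hy y' hy'
  have h4 : P.phiX x y - P.phiX x' y' = (gradX P.f x y - gradX P.f x' y') +
      ((gradX P.g x y - gradX P.g x' y) + (gradX P.g x' y - gradX P.g x' y')) := by
    simp only [phiX]; abel
  rw [h4]
  have h5 := norm_add_le (gradX P.f x y - gradX P.f x' y')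
    ((gradX P.g x y - gradX P.g x' y) + (gradX P.g x' y - gradX P.g x' y'))
  have h6 := norm_add_le (gradX P.g x y - gradX P.g x' y) (gradX P.g x' y - gradX P.g x' y')
  linarith

theorem phiX_lip_left (h : P.IsRegular M γ) {y : Eu m} (hy : y ∈ P.Y) :
    ∀ x ∈ P.X, ∀ x' ∈ P.X, ‖P.phiX x y - P.phiX x' y‖ ≤ (M.Lfx + M.Lg1) * ‖x - x'‖ := by
  intro x hx x' hx'
  simpa using h.phiX_lip hx hx' hy hy

theorem phiX_lip_right (h : P.IsRegular M γ) {x : Eu n} {y y' : Eu m} (hx : x ∈ P.X)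
    (hy : y ∈ P.Y) (hy' : y' ∈ P.Y) :
    ‖P.phiX x y - P.phiX x y'‖ ≤ (M.Lfx + M.Lg2) * ‖y - y'‖ := by
  simpa using h.phiX_lip hx hx hy hy'

theorem phi_upper_left (h : P.IsRegular M γ) {x x' : Eu n} {y : Eu m} (hx : x ∈ P.X)
    (hx' : x' ∈ P.X) (hy : y ∈ P.Y) :
    P.phi x' y ≤ P.phi x y + inner ℝ (P.phiX x y) (x' - x)
      + (M.Lfx + M.Lg1) / 2 * ‖x' - x‖ ^ 2 :=
  le_add_sq_of_lipschitz_gradient (h := fun x => P.phi x y) h.sets.convex_X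
    (fun _ hx => h.hasGradientAt_phiX hx hy) (h.phiX_lip_left hy) hx hx'

theorem phi_lower_left (h : P.IsRegular M γ) {x x' : Eu n} {y : Eu m} (hx : x ∈ P.X)
    (hx' : x' ∈ P.X) (hy : y ∈ P.Y) :
    P.phi x y + inner ℝ (P.phiX x y) (x' - x) - (M.Lfx + M.Lg1) / 2 * ‖x' - x‖ ^ 2
      ≤ P.phi x' y :=
  add_sub_sq_le_of_lipschitz_gradient (h := fun x => P.phi x y) h.sets.convex_X
    (fun _ hx => h.hasGradientAt_phiX hx hy) (h.phiX_lip_left hy) hx hx'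

theorem f_upper_right (h : P.IsRegular M γ) {x : Eu n} {y y' : Eu m} (hx : x ∈ P.X)
    (hy : y ∈ P.Y) (hy' : y' ∈ P.Y) :
    P.f x y' ≤ P.f x y + inner ℝ (gradY P.f x y) (y' - y) + M.Lfy / 2 * ‖y' - y‖ ^ 2 :=
  le_add_sq_of_lipschitz_gradient (h := fun y => P.f x y) h.sets.convex_Y
    (fun _ hy => h.hasGradientAt_fY hx hy)
    (fun y hy y' hy' => by simpa using h.lip_fY hx hx hy hy') hy hy'

theorem f_lower_right (h : P.IsRegular M γ) {x : Eu n} {y y' : Eu m} (hx : x ∈ P.X)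
    (hy : y ∈ P.Y) (hy' : y' ∈ P.Y) :
    P.f x y + inner ℝ (gradY P.f x y) (y' - y) ≤ P.f x y' :=
  (h.lower.convex_f x hx).subgradient_of_quadratic hy (fun _ hy' =>
    add_sub_sq_le_of_lipschitz_gradient (h := fun y => P.f x y) h.sets.convex_Y
      (fun _ hy => h.hasGradientAt_fY hx hy)
      (fun y hy y' hy' => by simpa using h.lip_fY hx hx hy hy') hy hy') y' hy'

theorem continuousOn_phi (h : P.IsRegular M γ) : ContinuousOn (onPair P.phi) P.box := by
  have h1 : ContinuousOn (onPair P.f) P.box := fun z hz =>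
    (h.smooth.diff_f z hz).hasGradientAt.continuousAt.continuousWithinAt
  exact h1.add h.smooth.cont_g

theorem continuousOn_slice {k : Eu n → Eu m → ℝ} (hk : ContinuousOn (onPair k) P.box)
    {x : Eu n} (hx : x ∈ P.X) : ContinuousOn (k x) P.Y := by
  have h1 : Continuous fun y : Eu m => pair x y :=
    continuous_pair.comp (continuous_const.prodMk continuous_id)
  exact hk.comp h1.continuousOn fun y hy => ⟨hx, hy⟩

theorem convexOn_phi (h : P.IsRegular M γ) {x : Eu n} (hx : x ∈ P.X) :
    ConvexOn ℝ P.Y (P.phi x) :=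
  (h.lower.convex_f x hx).add (h.lower.convex_g x hx)

theorem envSol_spec (h : P.IsRegular M γ) {x : Eu n} (hx : x ∈ P.X) (y : Eu m) :
    P.envSol γ x y ∈ P.Y ∧
      IsMinOn (fun θ => P.phi x θ + 1 / (2 * γ) * ‖θ - y‖ ^ 2) P.Y (P.envSol γ x y) := by
  have hγ := h.γ_pos
  exact argminOn_spec ((h.convexOn_phi hx).exists_isMinOn_add_sq h.sets.closed_Y h.nonempty_Y
    (continuousOn_slice h.continuousOn_phi hx) (by positivity) y)

theorem vEnv_eq (h : P.IsRegular M γ) {x : Eu n} (hx : x ∈ P.X) (y : Eu m) :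
    P.vEnv γ x y = P.phi x (P.envSol γ x y) + 1 / (2 * γ) * ‖P.envSol γ x y - y‖ ^ 2 := by
  have h1 := h.envSol_spec hx y
  refine IsLeast.csInf_eq ⟨⟨_, h1.1, rfl⟩, ?_⟩
  rintro _ ⟨θ, hθ, rfl⟩
  exact h1.2 hθ

theorem vEnv_le (h : P.IsRegular M γ) {x : Eu n} (hx : x ∈ P.X) (y : Eu m) {θ : Eu m}
    (hθ : θ ∈ P.Y) : P.vEnv γ x y ≤ P.phi x θ + 1 / (2 * γ) * ‖θ - y‖ ^ 2 := by
  rw [h.vEnv_eq hx]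
  exact (h.envSol_spec hx y).2 hθ

theorem vEnv_le_phi (h : P.IsRegular M γ) {x : Eu n} (hx : x ∈ P.X) {y : Eu m}
    (hy : y ∈ P.Y) : P.vEnv γ x y ≤ P.phi x y := by
  simpa using h.vEnv_le hx y hy

/-- Optimality of the minimizer `s` makes `(y - s)/γ` a subgradient of `φ(x, ·)` at `s`; here only
convexity in the second variable matters. -/
theorem phi_subgradient_envSol (h : P.IsRegular M γ) {x : Eu n} (hx : x ∈ P.X) (y : Eu m)
    {θ : Eu m} (hθ : θ ∈ P.Y) :
    P.phi x (P.envSol γ x y) +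
      inner ℝ ((1 / γ) • (y - P.envSol γ x y)) (θ - P.envSol γ x y) ≤ P.phi x θ := by
  have h1 := h.envSol_spec hx y
  have h2 := (h.convexOn_phi hx).subgradient_of_isMinOn_add_sq h1.1 h1.2 θ hθ
  rwa [show 2 * (1 / (2 * γ)) = 1 / γ by ring] at h2

/-- Strong convexity of the problem that defines the envelope. -/
theorem vEnv_add_sq_le (h : P.IsRegular M γ) {x : Eu n} (hx : x ∈ P.X) (y : Eu m) {θ : Eu m}
    (hθ : θ ∈ P.Y) : P.vEnv γ x y + 1 / (2 * γ) * ‖θ - P.envSol γ x y‖ ^ 2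
      ≤ P.phi x θ + 1 / (2 * γ) * ‖θ - y‖ ^ 2 := by
  have h1 := h.phi_subgradient_envSol hx y hθ
  rw [h.vEnv_eq hx, norm_sub_sq_eq_add θ (P.envSol γ x y) y]
  rw [real_inner_smul_left, ← neg_sub, inner_neg_left] at h1
  have h2 : 1 / (2 * γ) * (2 * inner ℝ (P.envSol γ x y - y) (θ - P.envSol γ x y))
      = 1 / γ * inner ℝ (P.envSol γ x y - y) (θ - P.envSol γ x y) := by ring
  linarith

/-- The basic joint lower estimate for the problem that defines the envelope. -/
theorem envelope_lower (h : P.IsRegular M γ) {x x' : Eu n} (hx : x ∈ P.X) (hx' : x' ∈ P.X)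
    (y y' : Eu m) {θ : Eu m} (hθ : θ ∈ P.Y) :
    P.vEnv γ x y + inner ℝ (P.phiX x (P.envSol γ x y)) (x' - x)
      + inner ℝ ((1 / γ) • (y - P.envSol γ x y)) (y' - y)
      + 1 / (2 * γ) * ‖θ - P.envSol γ x y‖ ^ 2
      - ((M.Lfx + M.Lg2) * ‖x' - x‖ + 1 / γ * ‖y' - y‖) * ‖θ - P.envSol γ x y‖
      - (M.Lfx + M.Lg1) / 2 * ‖x' - x‖ ^ 2
      ≤ P.phi x' θ + 1 / (2 * γ) * ‖θ - y'‖ ^ 2 := by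
  have hγ := h.γ_pos
  set s := P.envSol γ x y with hs
  have hsY : s ∈ P.Y := (h.envSol_spec hx y).1
  have h1 := h.phi_lower_left hx hx' hθ
  -- The expansion in `x` has its gradient at `θ`. Moving it to the minimizer `s` costs a cross term
  -- with `‖θ - s‖`, which the strong convexity term can later absorb.
  have h2 := h.phiX_lip_right hx hθ hsY
  have h3 := neg_le_of_abs_le (abs_real_inner_le_norm (P.phiX x θ - P.phiX x s) (x' - x))
  rw [inner_sub_left] at h3
  have h4 := mul_le_mul_of_nonneg_right h2 (norm_nonneg (x' - x))
  have h5 := h.vEnv_add_sq_le hx y hθ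
  rw [← hs] at h5
  have h6 : ‖θ - y'‖ ^ 2 = ‖θ - y‖ ^ 2 - 2 * inner ℝ (θ - y) (y' - y) + ‖y' - y‖ ^ 2 := by
    rw [← norm_sub_sq_real]; congr 2; abel
  have h7 : inner ℝ (θ - y) (y' - y) = inner ℝ (θ - s) (y' - y) - inner ℝ (y - s) (y' - y) := by
    rw [← inner_sub_left]; congr 1; abel
  have h8 := real_inner_le_norm (θ - s) (y' - y)
  have h9 := mul_le_mul_of_nonneg_left h8 (show 0 ≤ 1 / γ by positivity)
  have h10 : 1 / (2 * γ) * ‖θ - y'‖ ^ 2 = 1 / (2 * γ) * ‖θ - y‖ ^ 2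
      - 1 / γ * inner ℝ (θ - s) (y' - y) + 1 / γ * inner ℝ (y - s) (y' - y)
      + 1 / (2 * γ) * ‖y' - y‖ ^ 2 := by
    rw [h6, h7]; ring
  have h11 : 0 ≤ 1 / (2 * γ) * ‖y' - y‖ ^ 2 := by positivity
  rw [real_inner_smul_left, h10]
  linarith

/-- The old minimizer is a competitor in the new problem, so nothing about the new minimizer is
needed. -/
theorem vEnv_upper (h : P.IsRegular M γ) {x x' : Eu n} (hx : x ∈ P.X) (hx' : x' ∈ P.X)
    (y y' : Eu m) :
    P.vEnv γ x' y' ≤ P.vEnv γ x y + inner ℝ (P.phiX x (P.envSol γ x y)) (x' - x)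
      + inner ℝ ((1 / γ) • (y - P.envSol γ x y)) (y' - y)
      + (M.Lfx + M.Lg1) / 2 * ‖x' - x‖ ^ 2 + 1 / (2 * γ) * ‖y' - y‖ ^ 2 := by
  set s := P.envSol γ x y with hs
  have hsY : s ∈ P.Y := (h.envSol_spec hx y).1
  have h1 := h.vEnv_le hx' y' hsY
  have h2 := h.phi_upper_left hx hx' hsY
  have h3 := h.vEnv_eq hx y
  rw [← hs] at h3
  have h4 : ‖s - y'‖ ^ 2 = ‖s - y‖ ^ 2 + 2 * inner ℝ (y - s) (y' - y) + ‖y' - y‖ ^ 2 := by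
    rw [norm_sub_rev s y', norm_sub_rev s y, norm_sub_sq_eq_add y' y s]
  rw [h4] at h1
  rw [real_inner_smul_left]
  have h5 : 1 / (2 * γ) * (2 * inner ℝ (y - s) (y' - y)) = 1 / γ * inner ℝ (y - s) (y' - y) := by
    ring
  linarith

/-- The envelope and its minimizer vary quadratically, respectively Lipschitz continuously. -/
theorem exists_envelope_bounds (h : P.IsRegular M γ) : ∃ C : ℝ, 0 ≤ C ∧
    ∀ x ∈ P.X, ∀ x' ∈ P.X, ∀ y y' : Eu m,
      ‖P.envSol γ x' y' - P.envSol γ x y‖ ≤ C * (‖x' - x‖ + ‖y' - y‖) ∧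
      |P.vEnv γ x' y' - P.vEnv γ x y - (inner ℝ (P.phiX x (P.envSol γ x y)) (x' - x)
        + inner ℝ ((1 / γ) • (y - P.envSol γ x y)) (y' - y))|
        ≤ C * (‖x' - x‖ ^ 2 + ‖y' - y‖ ^ 2) := by
  have hγ := h.γ_pos
  have hL1 := h.smooth.Lfx_nonneg
  have hL2 := h.smooth.Lg1_nonneg
  have hL3 := h.smooth.Lg2_nonneg
  have hγi : 0 < 1 / γ := by positivity
  obtain ⟨C, hC0, hC⟩ := exists_perturbation_bound hγi (add_nonneg hL1 hL3) (add_nonneg hL1 hL2)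
  refine ⟨C, hC0, fun x hx x' hx' y y' => ?_⟩
  set s := P.envSol γ x y with hs
  set s' := P.envSol γ x' y' with hs'
  -- At the new minimizer the lower estimate meets the upper one. The resulting enclosure is
  -- quadratic in `‖s' - s‖` and bounds this displacement and the remainder at once.
  have h1 := h.envelope_lower hx hx' y y' (h.envSol_spec hx' y').1
  rw [← h.vEnv_eq hx', ← hs', ← hs] at h1
  have h2 := h.vEnv_upper hx hx' y y'
  rw [← hs] at h2
  have hg : 1 / (2 * γ) = 1 / γ / 2 := by ring
  rw [hg] at h1 h2
  exact hC _ _ _ _ (norm_nonneg _) (norm_nonneg _) (norm_nonneg _) (by linarith) (by linarith)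

/-- The two-sided quadratic remainder is little-o. The expansion holds for every `y`, so only `x` is
confined to its set. -/
theorem hasGradientWithinAt_vEnv (h : P.IsRegular M γ) {x : Eu n} (hx : x ∈ P.X) (y : Eu m) :
    HasGradientWithinAt (onPair (P.vEnv γ))
      (pair (P.phiX x (P.envSol γ x y)) ((1 / γ) • (y - P.envSol γ x y)))
      (prodSet P.X univ) (pair x y) := by
  obtain ⟨C, hC, hb⟩ := h.exists_envelope_bounds
  rw [hasGradientWithinAt_iff_isLittleO]
  have h1 : (fun z' : Pair n m => onPair (P.vEnv γ) z' - onPair (P.vEnv γ) (pair x y) -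
      inner ℝ (pair (P.phiX x (P.envSol γ x y)) ((1 / γ) • (y - P.envSol γ x y)))
        (z' - pair x y)) =O[𝓝[prodSet P.X univ] (pair x y)]
      fun z' => ‖z' - pair x y‖ ^ 2 := by
    refine Asymptotics.IsBigO.of_bound C ?_
    filter_upwards [self_mem_nhdsWithin] with z' hz'
    have h2 := (hb x hx z'.fst hz'.1 y z'.snd).2
    rw [← pair_eta z', pair_sub, inner_pair, norm_pow, norm_norm, norm_pair_sq, Real.norm_eq_abs]
    exact h2
  refine h1.trans_isLittleO ?_
  have hlim : Tendsto (fun z' => z' - pair x y) (𝓝 (pair x y)) (𝓝 0) :=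
    tendsto_sub_nhds_zero_iff.2 tendsto_id
  have h3 : (fun z' : Pair n m => ‖z' - pair x y‖ ^ 2) =o[𝓝 (pair x y)]
      fun z' => z' - pair x y :=
    (Asymptotics.isLittleO_norm_pow_id (E' := Pair n m) one_lt_two).comp_tendsto hlim
  exact h3.mono nhdsWithin_le_nhds

/-- The envelope is convex in the second variable. -/
theorem vEnv_lower_right (h : P.IsRegular M γ) {x : Eu n} (hx : x ∈ P.X) (y y' : Eu m) :
    P.vEnv γ x y + inner ℝ ((1 / γ) • (y - P.envSol γ x y)) (y' - y) ≤ P.vEnv γ x y' := by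
  have hγ := h.γ_pos
  set s := P.envSol γ x y with hs
  set s' := P.envSol γ x y' with hs'
  have h1 := h.phi_subgradient_envSol hx y (h.envSol_spec hx y').1
  rw [← hs, ← hs'] at h1
  rw [h.vEnv_eq hx, h.vEnv_eq hx, ← hs, ← hs']
  rw [real_inner_smul_left] at h1 ⊢
  -- The square of this difference is the excess in the joint convexity of `(θ, y) ↦ ‖θ - y‖²`.
  have h2 : ‖(s' - y') - (s - y)‖ ^ 2 = ‖s' - y'‖ ^ 2 - 2 * inner ℝ (s' - y') (s - y) + ‖s - y‖ ^ 2 :=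
    norm_sub_sq_real _ _
  have h3 : inner ℝ (s' - y') (s - y) = - inner ℝ (y - s) (s' - s) + inner ℝ (y - s) (y' - y)
      + ‖s - y‖ ^ 2 := by
    have e1 : s' - y' = (s' - s) - (y' - y) + (s - y) := by abel
    have e2 : y - s = -(s - y) := by abel
    rw [e1, inner_add_left, inner_sub_left, real_inner_self_eq_norm_sq, e2, inner_neg_left,
      inner_neg_left, real_inner_comm (s' - s), real_inner_comm (y' - y)]
    ring
  have h4 : 0 ≤ 1 / (2 * γ) * ‖(s' - y') - (s - y)‖ ^ 2 := by positivity
  rw [h2, h3] at h4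
  have h5 : 1 / (2 * γ) * (‖s' - y'‖ ^ 2 - 2 * (- inner ℝ (y - s) (s' - s)
      + inner ℝ (y - s) (y' - y) + ‖s - y‖ ^ 2) + ‖s - y‖ ^ 2)
      = 1 / (2 * γ) * ‖s' - y'‖ ^ 2 + 1 / γ * inner ℝ (y - s) (s' - s)
        - 1 / γ * inner ℝ (y - s) (y' - y) - 1 / (2 * γ) * ‖s - y‖ ^ 2 := by
    field_simp; ring
  linarith

theorem weak_phi (h : P.IsRegular M γ) :
    WeaklyConvexOn P.X P.Y (M.ρf1 + M.ρg1) (M.ρf2 + M.ρg2) P.phi := by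
  have h1 := h.smooth.weak_f.add h.smooth.weak_g
  refine h1.congr fun z _ => ?_
  simp only [Pi.add_apply, onPair, phi]
  ring

/-- The envelope is weakly convex in the first variable. -/
theorem vEnv_lower_left (h : P.IsRegular M γ) {x x' : Eu n} (hx : x ∈ P.X) (hx' : x' ∈ P.X)
    (y : Eu m) :
    P.vEnv γ x y + inner ℝ (P.phiX x (P.envSol γ x y)) (x' - x)
      - (M.ρf1 + M.ρg1) / 2 * ‖x' - x‖ ^ 2 ≤ P.vEnv γ x' y := by
  have hγ := h.γ_pos
  have hL1 := h.smooth.Lfx_nonneg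
  have hL2 := h.smooth.Lg1_nonneg
  have hL3 := h.smooth.Lg2_nonneg
  have hρ1 := add_nonneg h.smooth.ρf1_nonneg h.smooth.ρg1_nonneg
  have hρ2 := add_nonneg h.smooth.ρf2_nonneg h.smooth.ρg2_nonneg
  set ρ₁ := M.ρf1 + M.ρg1 with hρ₁
  set ρ₂ := M.ρf2 + M.ρg2 with hρ₂
  set s := P.envSol γ x y with hs
  set s' := P.envSol γ x' y with hs'
  have hsY : s ∈ P.Y := (h.envSol_spec hx y).1
  have hs'Y : s' ∈ P.Y := (h.envSol_spec hx' y).1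
  set a := P.phiX x s with ha
  set b := (1 / γ) • (y - s) with hb
  -- The Lipschitz constants give a subgradient inequality for `φ` up to some quadratic term.
  -- Convexity of the shifted function removes that term, so that the moduli `ρ₁`, `ρ₂` replace the
  -- Lipschitz constants.
  have hK := ConvexOn.subgradient_of_quadratic h.weak_phi (z₀ := pair x s)
    (a := pair (a + ρ₁ • x) (b + ρ₂ • s)) ⟨hx, hsY⟩
    (C := (M.Lfx + M.Lg1) / 2 + (M.Lfx + M.Lg2) + 0) ?_ (pair x' s') ⟨hx', hs'Y⟩
  · have hq : P.phi x s + inner ℝ a (x' - x) + inner ℝ b (s' - s) - ρ₁ / 2 * ‖x' - x‖ ^ 2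
        - ρ₂ / 2 * ‖s' - s‖ ^ 2 ≤ P.phi x' s' := by
      simp only [onPair, pair_fst, pair_snd, pair_sub, inner_pair, inner_add_left,
        real_inner_smul_left] at hK
      have e1 := norm_sub_sq_eq_add x' x 0
      have e2 := norm_sub_sq_eq_add s' s 0
      simp only [sub_zero] at e1 e2
      rw [e1, e2] at hK
      linarith
    rw [h.vEnv_eq hx, h.vEnv_eq hx', ← hs, ← hs', norm_sub_sq_eq_add s' s y]
    have e3 : inner ℝ b (s' - s) = - (1 / γ * inner ℝ (s - y) (s' - s)) := by
      rw [hb, real_inner_smul_left, ← neg_sub s y, inner_neg_left]; ring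
    -- Here `γ ρ₂ < 1` enters: the proximal term absorbs the defect of convexity in the second
    -- variable.
    have e4 : ρ₂ / 2 * ‖s' - s‖ ^ 2 ≤ 1 / (2 * γ) * ‖s' - s‖ ^ 2 := by
      refine mul_le_mul_of_nonneg_right ?_ (sq_nonneg _)
      rw [div_le_div_iff₀ (by norm_num) (by positivity)]
      linarith [h.γ_lt]
    have e5 : 1 / (2 * γ) * (2 * inner ℝ (s - y) (s' - s)) = 1 / γ * inner ℝ (s - y) (s' - s) := by
      ring
    linarith
  · intro z hz
    have h1 := quadratic_lower_of_partial (h := P.phi) (x := x) (x' := z.fst) (y := s)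
      (y' := z.snd) (a := a) (a' := P.phiX x z.snd) (b := b) (C₁ := (M.Lfx + M.Lg1) / 2)
      (C₂ := M.Lfx + M.Lg2) (C₃ := 0) (by positivity) (by positivity) le_rfl
      (h.phi_lower_left hx hz.1 hz.2) (h.phiX_lip_right hx hz.2 hsY)
      (by
        rw [zero_mul, sub_zero]
        exact h.phi_subgradient_envSol hx y hz.2)
    have e1 := norm_sub_sq_eq_add z.fst x 0
    have e2 := norm_sub_sq_eq_add z.snd s 0
    simp only [sub_zero] at e1 e2
    rw [← pair_eta z]
    simp only [onPair, pair_fst, pair_snd, pair_sub, inner_pair, inner_add_left,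
        real_inner_smul_left, norm_pair_sq]
    have e3 : 0 ≤ ρ₁ / 2 * ‖z.fst - x‖ ^ 2 := by positivity
    have e4 : 0 ≤ ρ₂ / 2 * ‖z.snd - s‖ ^ 2 := by positivity
    rw [e1, e2]
    linarith

end IsRegular

end BilevelProblem

/-! ### The merit function: duality, subgradients, descent and the error bound. -/

namespace BilevelProblem

variable {n m : ℕ}

namespace UpperAssumption

variable {P : BilevelProblem n m} {M : Moduli}

theorem differentiableAt (hF : P.UpperAssumption M) (z : Pair n m) :
    DifferentiableAt ℝ (onPair P.F) z :=
  (hF.contDiff.differentiable one_ne_zero) z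

theorem lip_left (hF : P.UpperAssumption M) {x x' : Eu n} {y y' : Eu m} (hx : x ∈ P.X)
    (hx' : x' ∈ P.X) (hy : y ∈ P.Y) (hy' : y' ∈ P.Y) :
    ‖gradX P.F x y - gradX P.F x' y'‖ ≤ M.LFx * (‖x - x'‖ + ‖y - y'‖) :=
  (hF.lip_x (pair x y) ⟨hx, hy⟩ (pair x' y') ⟨hx', hy'⟩).trans
    (mul_le_mul_of_nonneg_left (norm_pair_le _ _) hF.LFx_nonneg)

theorem lip_right (hF : P.UpperAssumption M) {x x' : Eu n} {y y' : Eu m} (hx : x ∈ P.X)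
    (hx' : x' ∈ P.X) (hy : y ∈ P.Y) (hy' : y' ∈ P.Y) :
    ‖gradY P.F x y - gradY P.F x' y'‖ ≤ M.LFy * (‖x - x'‖ + ‖y - y'‖) :=
  (hF.lip_y (pair x y) ⟨hx, hy⟩ (pair x' y') ⟨hx', hy'⟩).trans
    (mul_le_mul_of_nonneg_left (norm_pair_le _ _) hF.LFy_nonneg)

theorem upper_left (hF : P.UpperAssumption M) (hs : P.ConvexSets) {x x' : Eu n} {y : Eu m}
    (hx : x ∈ P.X) (hx' : x' ∈ P.X) (hy : y ∈ P.Y) :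
    P.F x' y ≤ P.F x y + inner ℝ (gradX P.F x y) (x' - x) + M.LFx / 2 * ‖x' - x‖ ^ 2 :=
  le_add_sq_of_lipschitz_gradient (h := fun x => P.F x y) hs.convex_X
    (fun x _ => hasGradientAt_gradX (hF.differentiableAt (pair x y)))
    (fun x hx x' hx' => by simpa using hF.lip_left hx hx' hy hy) hx hx'

theorem lower_left (hF : P.UpperAssumption M) (hs : P.ConvexSets) {x x' : Eu n} {y : Eu m}
    (hx : x ∈ P.X) (hx' : x' ∈ P.X) (hy : y ∈ P.Y) :
    P.F x y + inner ℝ (gradX P.F x y) (x' - x) - M.LFx / 2 * ‖x' - x‖ ^ 2 ≤ P.F x' y :=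
  add_sub_sq_le_of_lipschitz_gradient (h := fun x => P.F x y) hs.convex_X
    (fun x _ => hasGradientAt_gradX (hF.differentiableAt (pair x y)))
    (fun x hx x' hx' => by simpa using hF.lip_left hx hx' hy hy) hx hx'

theorem upper_right (hF : P.UpperAssumption M) (hs : P.ConvexSets) {x : Eu n} {y y' : Eu m}
    (hx : x ∈ P.X) (hy : y ∈ P.Y) (hy' : y' ∈ P.Y) :
    P.F x y' ≤ P.F x y + inner ℝ (gradY P.F x y) (y' - y) + M.LFy / 2 * ‖y' - y‖ ^ 2 :=
  le_add_sq_of_lipschitz_gradient (h := fun y => P.F x y) hs.convex_Y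
    (fun y _ => hasGradientAt_gradY (hF.differentiableAt (pair x y)))
    (fun y hy y' hy' => by simpa using hF.lip_right hx hx hy hy') hy hy'

theorem lower_right (hF : P.UpperAssumption M) (hs : P.ConvexSets) {x : Eu n} {y y' : Eu m}
    (hx : x ∈ P.X) (hy : y ∈ P.Y) (hy' : y' ∈ P.Y) :
    P.F x y + inner ℝ (gradY P.F x y) (y' - y) - M.LFy / 2 * ‖y' - y‖ ^ 2 ≤ P.F x y' :=
  add_sub_sq_le_of_lipschitz_gradient (h := fun y => P.F x y) hs.convex_Y
    (fun y _ => hasGradientAt_gradY (hF.differentiableAt (pair x y)))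
    (fun y hy y' hy' => by simpa using hF.lip_right hx hx hy hy') hy hy'

theorem Finf_le (hF : P.UpperAssumption M) {x : Eu n} {y : Eu m} (hx : x ∈ P.X) (hy : y ∈ P.Y) :
    P.Finf ≤ P.F x y :=
  csInf_le hF.bddBelow ⟨pair x y, ⟨hx, hy⟩, rfl⟩

end UpperAssumption

/-- The gradient at `x` of `ṽ_γ(·, y)`, the dual variable of the merit function. -/
noncomputable def envDual (P : BilevelProblem n m) (γ ρ : ℝ) (x : Eu n) (y : Eu m) : Eu n :=
  P.phiX x (P.envSol γ x y) + ρ • x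

/-- The penalized value function `(F - F_inf) / p + φ - v_γ`. -/
noncomputable def penalized (P : BilevelProblem n m) (γ p : ℝ) (x : Eu n) (y : Eu m) : ℝ :=
  1 / p * (P.F x y - P.Finf) + P.phi x y - P.vEnv γ x y

/-- The finite part of the merit function. -/
noncomputable def meritReal (P : BilevelProblem n m) (γ ρ p : ℝ) (q : Triple n m) : ℝ :=
  P.meritG ρ p q.fst - inner ℝ q.snd q.fst.fst + P.conj γ ρ q.snd q.fst.snd

theorem meritReal_toLp (P : BilevelProblem n m) (γ ρ p : ℝ) (x u : Eu n) (y : Eu m) :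
    P.meritReal γ ρ p (WithLp.toLp 2 (pair x y, u))
      = 1 / p * (P.F x y - P.Finf) + P.phi x y + ρ / 2 * ‖x‖ ^ 2 - inner ℝ u x
        + P.conj γ ρ u y := rfl

theorem merit_eq_extend (P : BilevelProblem n m) (γ ρ p : ℝ) :
    P.merit γ ρ p = extend {q | q.fst ∈ P.box} (P.meritReal γ ρ p) := rfl

namespace IsRegular

variable {P : BilevelProblem n m} {M : Moduli} {γ : ℝ}

/-- The part `c/4` of the modulus beyond weak convexity survives as strong convexity in `x`. -/
theorem vTilde_lower (h : P.IsRegular M γ) {x x' : Eu n} (hx : x ∈ P.X) (hx' : x' ∈ P.X)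
    (y : Eu m) (c : ℝ) :
    P.vTilde γ (M.ρf1 + M.ρg1 + c / 4) x y
      + inner ℝ (P.envDual γ (M.ρf1 + M.ρg1 + c / 4) x y) (x' - x) + c / 8 * ‖x' - x‖ ^ 2
      ≤ P.vTilde γ (M.ρf1 + M.ρg1 + c / 4) x' y := by
  have h1 := h.vEnv_lower_left hx hx' y
  have e1 := norm_sub_sq_eq_add x' x 0
  simp only [sub_zero] at e1
  rw [vTilde, vTilde, envDual, inner_add_left, real_inner_smul_left, e1]
  linarith

/-- Strong convexity of `ṽ_γ(·, y)` outweighs every linear function. Boundedness is what makes the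
real `sSup` a true supremum. -/
theorem bddAbove_conj (h : P.IsRegular M γ) {c : ℝ} (hc : 0 < c) (u : Eu n) (y : Eu m) :
    BddAbove ((fun x => inner ℝ u x - P.vTilde γ (M.ρf1 + M.ρg1 + c / 4) x y) '' P.X) := by
  rcases P.X.eq_empty_or_nonempty with hX | ⟨x₀, hx₀⟩
  · simp [hX]
  set ρ := M.ρf1 + M.ρg1 + c / 4 with hρ
  set U := P.envDual γ ρ x₀ y with hU
  refine ⟨inner ℝ u x₀ - P.vTilde γ ρ x₀ y + 2 / c * ‖u - U‖ ^ 2, ?_⟩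
  rintro _ ⟨x, hx, rfl⟩
  have h1 := h.vTilde_lower hx₀ hx y c
  rw [← hρ, ← hU] at h1
  have h2 : inner ℝ u x = inner ℝ u x₀ + inner ℝ (u - U) (x - x₀) + inner ℝ U (x - x₀) := by
    rw [inner_sub_left, inner_sub_right]; ring
  have h3 := real_inner_le_norm (u - U) (x - x₀)
  have h4 : ‖u - U‖ * ‖x - x₀‖ ≤ 2 / c * ‖u - U‖ ^ 2 + c / 8 * ‖x - x₀‖ ^ 2 := by
    have h5 : 0 ≤ 2 / c * (‖u - U‖ - c / 4 * ‖x - x₀‖) ^ 2 := by positivity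
    have h6 : 2 / c * (‖u - U‖ - c / 4 * ‖x - x₀‖) ^ 2
        = 2 / c * ‖u - U‖ ^ 2 - ‖u - U‖ * ‖x - x₀‖ + c / 8 * ‖x - x₀‖ ^ 2 := by
      field_simp
      ring
    linarith
  change inner ℝ u x - P.vTilde γ ρ x y ≤ _
  linarith

theorem le_conj (h : P.IsRegular M γ) {c : ℝ} (hc : 0 < c) (u : Eu n) (y : Eu m) {x : Eu n}
    (hx : x ∈ P.X) : inner ℝ u x - P.vTilde γ (M.ρf1 + M.ρg1 + c / 4) x y
      ≤ P.conj γ (M.ρf1 + M.ρg1 + c / 4) u y :=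
  le_csSup (h.bddAbove_conj hc u y) ⟨x, hx, rfl⟩

/-- Equality in Fenchel-Young: at the gradient of a convex function the supremum is attained at the
base point. -/
theorem conj_envDual (h : P.IsRegular M γ) {c : ℝ} (hc : 0 < c) (y : Eu m) {x : Eu n}
    (hx : x ∈ P.X) :
    P.conj γ (M.ρf1 + M.ρg1 + c / 4) (P.envDual γ (M.ρf1 + M.ρg1 + c / 4) x y) y
      = inner ℝ (P.envDual γ (M.ρf1 + M.ρg1 + c / 4) x y) x
        - P.vTilde γ (M.ρf1 + M.ρg1 + c / 4) x y := by
  refine IsGreatest.csSup_eq ⟨⟨x, hx, rfl⟩, ?_⟩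
  rintro _ ⟨x', hx', rfl⟩
  have h1 := h.vTilde_lower hx hx' y c
  rw [inner_sub_right] at h1
  have h2 : 0 ≤ c / 8 * ‖x' - x‖ ^ 2 := by positivity
  linarith

/-- Fenchel-Young with test point `x`, for any dual variable. This links the merit value after one
step to the starting value of the next. -/
theorem penalized_le_merit (h : P.IsRegular M γ) {c : ℝ} (hc : 0 < c) (p : ℝ) {x : Eu n}
    (hx : x ∈ P.X) (y : Eu m) (u : Eu n) :
    P.penalized γ p x y
      ≤ P.meritReal γ (M.ρf1 + M.ρg1 + c / 4) p (WithLp.toLp 2 (pair x y, u)) := by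
  have h1 := h.le_conj hc u y hx
  simp only [vTilde] at h1
  rw [penalized, meritReal_toLp]
  linarith

/-- When `u` is the gradient at `x₀`, the merit function is the penalized one with `v_γ(·, y)`
replaced by its linearization at `x₀`, plus a proximal term. -/
theorem merit_envDual (h : P.IsRegular M γ) {c : ℝ} (hc : 0 < c) (p : ℝ) {x₀ : Eu n}
    (hx₀ : x₀ ∈ P.X) (x : Eu n) (y : Eu m) :
    P.meritReal γ (M.ρf1 + M.ρg1 + c / 4) p
        (WithLp.toLp 2 (pair x y, P.envDual γ (M.ρf1 + M.ρg1 + c / 4) x₀ y))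
      = 1 / p * (P.F x y - P.Finf) + P.phi x y - P.vEnv γ x₀ y
        - inner ℝ (P.phiX x₀ (P.envSol γ x₀ y)) (x - x₀)
        + (M.ρf1 + M.ρg1 + c / 4) / 2 * ‖x - x₀‖ ^ 2 := by
  rw [meritReal_toLp, h.conj_envDual hc y hx₀, vTilde]
  have e1 := norm_sub_sq_eq_add x x₀ 0
  simp only [sub_zero] at e1
  rw [e1, envDual, inner_add_left, inner_add_left, real_inner_smul_left, real_inner_smul_left,
    inner_sub_right, inner_sub_right, real_inner_self_eq_norm_sq]
  ring

theorem merit_envDual_self (h : P.IsRegular M γ) {c : ℝ} (hc : 0 < c) (p : ℝ) {x : Eu n}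
    (hx : x ∈ P.X) (y : Eu m) :
    P.meritReal γ (M.ρf1 + M.ρg1 + c / 4) p
        (WithLp.toLp 2 (pair x y, P.envDual γ (M.ρf1 + M.ρg1 + c / 4) x y))
      = P.penalized γ p x y := by
  rw [h.merit_envDual hc p hx, penalized]
  simp

/-- Subgradients of the merit function at points with a dual variable of the form `envDual`. -/
theorem mem_frechetSubdiff_merit (h : P.IsRegular M γ) (hF : P.UpperAssumption M) {c : ℝ}
    (hc : 0 < c) {p : ℝ} (hp : 0 < p) {x₀ x : Eu n} {y : Eu m} (hx₀ : x₀ ∈ P.X) (hx : x ∈ P.X)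
    (hy : y ∈ P.Y) {w : Eu n} (hw : ∀ x' ∈ P.X, inner ℝ w (x' - x) ≤ 0) {ξ : Eu m}
    (hξ : ∀ y' ∈ P.Y, P.g x y + inner ℝ ξ (y' - y) ≤ P.g x y') :
    (WithLp.toLp 2 (pair
      ((1 / p) • gradX P.F x y + P.phiX x y + (M.ρf1 + M.ρg1 + c / 4) • x
        - P.envDual γ (M.ρf1 + M.ρg1 + c / 4) x₀ y + w)
      ((1 / p) • gradY P.F x y + gradY P.f x y + ξ - (1 / γ) • (y - P.envSol γ x₀ y)),
      x₀ - x) : Triple n m) ∈ frechetSubdiff (P.merit γ (M.ρf1 + M.ρg1 + c / 4) p)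
        (WithLp.toLp 2 (pair x y, P.envDual γ (M.ρf1 + M.ρg1 + c / 4) x₀ y)) := by
  have hγ := h.γ_pos
  have hL1 := h.smooth.Lfx_nonneg
  have hL2 := h.smooth.Lg1_nonneg
  have hL3 := h.smooth.Lg2_nonneg
  have hF1 := hF.LFx_nonneg
  have hF2 := hF.LFy_nonneg
  have hρ1 := add_nonneg h.smooth.ρf1_nonneg h.smooth.ρg1_nonneg
  have hρ0 : 0 ≤ M.ρf1 + M.ρg1 + c / 4 := by positivity
  have hconj := h.conj_envDual hc y hx₀
  have hle := fun (u' : Eu n) (y' : Eu m) => h.le_conj hc u' y' hx₀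
  set ρ := M.ρf1 + M.ρg1 + c / 4 with hρ
  set u := P.envDual γ ρ x₀ y with hu
  set s := P.envSol γ x₀ y with hs
  set CF := M.LFx / 2 + M.LFx + M.LFy / 2 with hCF
  set Cφ := (M.Lfx + M.Lg1) / 2 + (M.Lfx + M.Lg2) + 0 with hCφ
  have hCF0 : 0 ≤ CF := by positivity
  have hCφ0 : 0 ≤ Cφ := by positivity
  rw [merit_eq_extend]
  refine mem_frechetSubdiff_of_quadratic (C := 1 / p * CF + Cφ + 1 / (2 * γ) + 1)
    (show pair x y ∈ P.box from ⟨hx, hy⟩) fun q hq => ?_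
  obtain ⟨z', u', rfl⟩ : ∃ z' u', q = WithLp.toLp 2 (z', u') := ⟨q.fst, q.snd, rfl⟩
  obtain ⟨x', y', rfl⟩ : ∃ x' y', z' = pair x' y' := ⟨z'.fst, z'.snd, rfl⟩
  have hx' : x' ∈ P.X := hq.1
  have hy' : y' ∈ P.Y := hq.2
  have hn : ‖(WithLp.toLp 2 (pair x' y', u') : Triple n m) - WithLp.toLp 2 (pair x y, u)‖ ^ 2
      = ‖x' - x‖ ^ 2 + ‖y' - y‖ ^ 2 + ‖u' - u‖ ^ 2 := by
    have e1 : ‖(WithLp.toLp 2 (pair x' y', u') : Triple n m) - WithLp.toLp 2 (pair x y, u)‖ ^ 2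
        = ‖pair (x' - x) (y' - y)‖ ^ 2 + ‖u' - u‖ ^ 2 := WithLp.prod_norm_sq_eq_of_L2 _
    rw [e1, norm_pair_sq]
  have hi : ∀ (a : Eu n) (b : Eu m) (d : Eu n),
      inner ℝ (WithLp.toLp 2 (pair a b, d) : Triple n m)
        (WithLp.toLp 2 (pair x' y', u') - WithLp.toLp 2 (pair x y, u))
      = inner ℝ a (x' - x) + inner ℝ b (y' - y) + inner ℝ d (u' - u) := fun a b d => rfl
  rw [hn, hi]
  rw [meritReal_toLp, meritReal_toLp]
  have h1 := quadratic_lower_of_partial (h := P.F) (b := gradY P.F x y) (a := gradX P.F x y)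
    (C₁ := M.LFx / 2) (C₂ := M.LFx) (C₃ := M.LFy / 2)
    (by positivity) hF1 (by positivity) (hF.lower_left h.sets hx hx' hy')
    (by simpa using hF.lip_left hx hx hy' hy) (hF.lower_right h.sets hx hy hy')
  have h2 := quadratic_lower_of_partial (h := P.phi) (b := gradY P.f x y + ξ) (a := P.phiX x y)
    (C₁ := (M.Lfx + M.Lg1) / 2) (C₂ := M.Lfx + M.Lg2) (C₃ := 0)
    (by positivity) (by positivity) le_rfl (h.phi_lower_left hx hx' hy')
    (h.phiX_lip_right hx hy' hy) (by
      have e1 := h.f_lower_right hx hy hy'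
      have e2 := hξ y' hy'
      rw [inner_add_left]
      simp only [phi]
      linarith)
  rw [← hCF] at h1
  rw [← hCφ] at h2
  have h3 := mul_le_mul_of_nonneg_left h1 (show 0 ≤ 1 / p by positivity)
  -- The test point `x₀` bounds `H` below everywhere and attains it at `(u, y)`. With the upper
  -- expansion of `v_γ(x₀, ·)` this yields the subgradient `(x₀, -(y - s)/γ)` of `H` up to a
  -- quadratic error.
  have h4 := hle u' y'
  have h5 := h.vEnv_upper hx₀ hx₀ y y'
  rw [← hs, sub_self, inner_zero_right, norm_zero] at h5
  have h6 := hw x' hx'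
  have e1 := norm_sub_sq_eq_add x' x 0
  simp only [sub_zero] at e1
  have h7 : inner ℝ u' x' - inner ℝ u' x₀ = inner ℝ u x - inner ℝ u x₀
      - inner ℝ (x₀ - x) (u' - u) + inner ℝ u (x' - x) + inner ℝ (u' - u) (x' - x) := by
    simp only [inner_sub_left, inner_sub_right, real_inner_comm x₀, real_inner_comm x]
    ring
  have h8 : inner ℝ (u' - u) (x' - x) ≤ ‖x' - x‖ ^ 2 + ‖u' - u‖ ^ 2 := by
    have := real_inner_le_norm (u' - u) (x' - x)
    nlinarith [sq_nonneg (‖u' - u‖ - ‖x' - x‖), sq_nonneg (‖u' - u‖), sq_nonneg (‖x' - x‖)]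
  rw [hconj, e1]
  simp only [vTilde] at h4 ⊢
  simp only [inner_add_left, inner_sub_left, real_inner_smul_left] at h2 h5 h7 h8 ⊢
  have p1 : 0 ≤ (1 / p * CF + Cφ + 1 / (2 * γ)) * ‖u' - u‖ ^ 2 := by positivity
  have p2 : 0 ≤ 1 / (2 * γ) * ‖x' - x‖ ^ 2 := by positivity
  have p3 : 0 ≤ ρ / 2 * ‖x' - x‖ ^ 2 := by positivity
  have p4 : 0 ≤ ‖y' - y‖ ^ 2 := by positivity
  linarith

/-- The proximal step in `y` decreases the penalized value function. -/
theorem penalized_prox_step (h : P.IsRegular M γ) (hF : P.UpperAssumption M) {p β : ℝ}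
    (hp : 0 < p) {x : Eu n} {y yp θ : Eu m} (hx : x ∈ P.X) (hy : y ∈ P.Y) (hyp : yp ∈ P.Y)
    (hsub : P.g x yp + inner ℝ ((1 / β) • (y - yp)
      - ((1 / p) • gradY P.F x y + gradY P.f x y - (1 / γ) • (y - θ))) (y - yp) ≤ P.g x y) :
    P.penalized γ p x yp + (1 / β - (M.LFy / p + M.Lfy) / 2) * ‖yp - y‖ ^ 2
      ≤ P.penalized γ p x y + 1 / γ * ‖θ - P.envSol γ x y‖ * ‖yp - y‖ := by
  have hγ := h.γ_pos
  have h1 := mul_le_mul_of_nonneg_left (hF.upper_right h.sets hx hy hyp)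
    (show 0 ≤ 1 / p by positivity)
  have h2 := h.f_upper_right hx hy hyp
  -- Convexity of the envelope in `y` bounds `-v_γ` linearly without loss, so no `1/γ` enters the
  -- step size condition.
  have h3 := h.vEnv_lower_right hx y yp
  set s := P.envSol γ x y with hs
  have h4 := neg_le_of_abs_le (abs_real_inner_le_norm (θ - s) (yp - y))
  have h5 := mul_le_mul_of_nonneg_left h4 (show 0 ≤ 1 / γ by positivity)
  have h6 : y - yp = -(yp - y) := by abel
  rw [h6] at hsub
  simp only [penalized, phi]
  simp only [inner_add_left, inner_sub_left, real_inner_smul_left, inner_neg_right,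
    inner_neg_left] at hsub h3 h5 ⊢
  have h7 : ‖yp - y‖ ^ 2 = inner ℝ yp (yp - y) - inner ℝ y (yp - y) := by
    rw [← inner_sub_left, real_inner_self_eq_norm_sq]
  rw [h7] at h1 h2 ⊢
  rw [show M.LFy / p = 1 / p * M.LFy by ring]
  linarith

/-- The projection step in `x` decreases the merit function below the penalized value function. -/
theorem merit_proj_step (h : P.IsRegular M γ) (hF : P.UpperAssumption M) {c : ℝ} (hc : 0 < c)
    {p α : ℝ} (hp : 0 < p) (hα : 0 < α) {x xp : Eu n} {y θ : Eu m} (hx : x ∈ P.X) (hxp : xp ∈ P.X)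
    (hy : y ∈ P.Y) (hθ : θ ∈ P.Y)
    (hproj : inner ℝ (x - α • ((1 / p) • gradX P.F x y + P.phiX x y - P.phiX x θ) - xp) (x - xp)
      ≤ 0) :
    P.meritReal γ (M.ρf1 + M.ρg1 + c / 4) p
        (WithLp.toLp 2 (pair xp y, P.envDual γ (M.ρf1 + M.ρg1 + c / 4) x y))
      + (1 / α - (M.LFx / p + M.Lfx + M.Lg1 + M.ρf1 + M.ρg1 + c / 4) / 2) * ‖xp - x‖ ^ 2
      ≤ P.penalized γ p x y
        + (M.Lfx + M.Lg2) * ‖θ - P.envSol γ x y‖ * ‖xp - x‖ := by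
  -- With the dual variable taken at the old `x`, the envelope enters linearized there. The
  -- projection direction matches this linear part up to the error of `θ`.
  rw [h.merit_envDual hc p hx]
  have h1 := mul_le_mul_of_nonneg_left (hF.upper_left h.sets hx hxp hy)
    (show 0 ≤ 1 / p by positivity)
  have h2 := h.phi_upper_left hx hxp hy
  set s := P.envSol γ x y with hs
  have hsY : s ∈ P.Y := (h.envSol_spec hx y).1
  have h3 := mul_le_mul_of_nonneg_right (h.phiX_lip_right hx hθ hsY) (norm_nonneg (xp - x))
  have h4 := real_inner_le_norm (P.phiX x θ - P.phiX x s) (xp - x)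
  have h5 : 1 / α * ‖xp - x‖ ^ 2
      + inner ℝ ((1 / p) • gradX P.F x y + P.phiX x y - P.phiX x θ) (xp - x) ≤ 0 := by
    set D := (1 / p) • gradX P.F x y + P.phiX x y - P.phiX x θ with hD
    have e1 : x - α • D - xp = -((xp - x) + α • D) := by abel
    have e2 : x - xp = -(xp - x) := by abel
    rw [e1, e2, inner_neg_neg, inner_add_left, real_inner_smul_left,
      real_inner_self_eq_norm_sq] at hproj
    have e3 := mul_le_mul_of_nonneg_left hproj (show 0 ≤ 1 / α by positivity)
    have e4 : 1 / α * (‖xp - x‖ ^ 2 + α * inner ℝ D (xp - x))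
        = 1 / α * ‖xp - x‖ ^ 2 + inner ℝ D (xp - x) := by
      field_simp
    linarith
  simp only [penalized]
  simp only [inner_add_left, inner_sub_left, real_inner_smul_left] at h4 h5 ⊢
  rw [show M.LFx / p = 1 / p * M.LFx by ring]
  linarith

/-- The residual of an inexact solution bounds its distance to the exact one. -/
theorem exists_error_bound (h : P.IsRegular M γ) {A : Params} (hAγ : A.γ = γ) (hη : 0 < A.η) :
    ∃ C : ℝ, 0 ≤ C ∧ ∀ x ∈ P.X, ∀ θ ∈ P.Y, ∀ y : Eu m,
      ‖θ - P.envSol γ x y‖ ≤ C * Iterates.resid P A θ x y := by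
  have hγ := h.γ_pos
  have hL := h.smooth.Lfy_nonneg
  set K := 1 / A.η + M.Lfy + 1 / γ with hK
  have hK0 : 0 ≤ K := by positivity
  refine ⟨1 + γ * K, by positivity, fun x hx θ hθ y => ?_⟩
  set s := P.envSol γ x y with hs
  have hsY : s ∈ P.Y := (h.envSol_spec hx y).1
  set D := gradY P.f x θ + (1 / γ) • (θ - y) with hD
  set q := prox P.Y (fun t => A.η * P.g x t) (θ - A.η • D) with hq
  have hres : Iterates.resid P A θ x y = ‖θ - q‖ := by
    rw [Iterates.resid, hAγ]
  have hcg : ContinuousOn (fun t => A.η * P.g x t) P.Y :=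
    continuousOn_const.mul (continuousOn_slice h.smooth.cont_g hx)
  have hvg : ConvexOn ℝ P.Y (fun t => A.η * P.g x t) := (h.lower.convex_g x hx).smul hη.le
  obtain ⟨hqY, hqv⟩ := prox_spec h.sets.closed_Y h.nonempty_Y hvg hcg (θ - A.η • D)
  rw [← hq] at hqY hqv
  rw [hres]
  have h1 := hqv s hsY
  have h1' : P.g x q + inner ℝ ((1 / A.η) • (θ - q) - D) (s - q) ≤ P.g x s := by
    have e1 : θ - A.η • D - q = A.η • ((1 / A.η) • (θ - q) - D) := by
      rw [smul_sub, smul_smul, mul_one_div_cancel hη.ne', one_smul]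
      abel
    rw [e1, real_inner_smul_left, ← mul_add] at h1
    exact le_of_mul_le_mul_left h1 hη
  have h2 := h.phi_subgradient_envSol hx y hqY
  rw [← hs] at h2
  have h3 := h.f_lower_right hx hqY hsY
  simp only [phi] at h2
  have h4 : ‖gradY P.f x θ - gradY P.f x q‖ ≤ M.Lfy * ‖θ - q‖ := by
    simpa using h.lip_fY hx hx hθ hqY
  -- Optimality of `q` tested at `s`, optimality of `s` tested at `q`, and convexity of `f` are
  -- added; strong monotonicity with modulus `1/γ` remains.
  have h5 : 1 / γ * ‖q - s‖ ^ 2 ≤ K * ‖θ - q‖ * ‖q - s‖ := by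
    have e1 : s - q = -(q - s) := by abel
    have e2 : y - s = (y - θ) + (θ - q) + (q - s) := by abel
    have e3 : θ - y = -(y - θ) := by abel
    rw [hD, e3, e1] at h1'
    rw [e1] at h3
    rw [e2] at h2
    have e4 := real_inner_le_norm (θ - q) (q - s)
    have e5 := neg_le_of_abs_le (abs_real_inner_le_norm (θ - q) (q - s))
    have e6 := neg_le_of_abs_le
      (abs_real_inner_le_norm (gradY P.f x θ - gradY P.f x q) (q - s))
    have e7 := mul_le_mul_of_nonneg_right h4 (norm_nonneg (q - s))
    have e8 := mul_le_mul_of_nonneg_left e4 (show 0 ≤ 1 / A.η by positivity)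
    have e9 := mul_le_mul_of_nonneg_left e5 (show 0 ≤ 1 / γ by positivity)
    have e10 : inner ℝ ((y - θ) + (θ - q) + (q - s)) (q - s)
        = inner ℝ (y - θ) (q - s) + inner ℝ (θ - q) (q - s) + ‖q - s‖ ^ 2 := by
      rw [inner_add_left, inner_add_left, real_inner_self_eq_norm_sq]
    rw [real_inner_smul_left, e10] at h2
    rw [inner_sub_left] at e6
    have e11 : inner ℝ ((1 / A.η) • (θ - q) - (gradY P.f x θ + (1 / γ) • -(y - θ))) (-(q - s))
        = -(1 / A.η * inner ℝ (θ - q) (q - s)) + inner ℝ (gradY P.f x θ) (q - s)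
          - 1 / γ * inner ℝ (y - θ) (q - s) := by
      rw [inner_neg_right, inner_sub_left, inner_add_left, real_inner_smul_left,
        real_inner_smul_left, inner_neg_left]
      ring
    rw [e11] at h1'
    rw [inner_neg_right] at h3
    rw [hK]
    linarith
  have h6 : ‖q - s‖ ≤ γ * K * ‖θ - q‖ := by
    rcases (norm_nonneg (q - s)).eq_or_lt with h0 | h0
    · rw [← h0]; positivity
    · have e1 := mul_le_mul_of_nonneg_left h5 hγ.le
      have e2 : γ * (1 / γ * ‖q - s‖ ^ 2) = ‖q - s‖ * ‖q - s‖ := by field_simp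
      rw [e2] at e1
      exact le_of_mul_le_mul_right (by linarith) h0
  have h7 : θ - s = (θ - q) + (q - s) := by abel
  rw [h7]
  linarith [norm_add_le (θ - q) (q - s)]

end IsRegular

end BilevelProblem

/-! ### Continuity, and convergence under the KL property. -/

namespace BilevelProblem

variable {n m : ℕ}

namespace IsRegular

variable {P : BilevelProblem n m} {M : Moduli} {γ : ℝ}

section Continuity

variable {ι : Type} {l : Filter ι} {xs : ι → Eu n} {ys : ι → Eu m} {x : Eu n} {y : Eu m}

theorem tendsto_envSol (h : P.IsRegular M γ) (hxs : ∀ᶠ i in l, xs i ∈ P.X) (hx : x ∈ P.X)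
    (hxl : Tendsto xs l (𝓝 x)) (hyl : Tendsto ys l (𝓝 y)) :
    Tendsto (fun i => P.envSol γ (xs i) (ys i)) l (𝓝 (P.envSol γ x y)) := by
  obtain ⟨C, hC, hb⟩ := h.exists_envelope_bounds
  rw [tendsto_iff_norm_sub_tendsto_zero]
  have h1 : Tendsto (fun i => C * (‖xs i - x‖ + ‖ys i - y‖)) l (𝓝 0) := by
    have := ((tendsto_iff_norm_sub_tendsto_zero.1 hxl).add
      (tendsto_iff_norm_sub_tendsto_zero.1 hyl)).const_mul C
    simpa using this
  refine squeeze_zero' (Eventually.of_forall fun i => norm_nonneg _) ?_ h1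
  filter_upwards [hxs] with i hi
  exact (hb x hx (xs i) hi y (ys i)).1

theorem tendsto_vEnv (h : P.IsRegular M γ) (hxs : ∀ᶠ i in l, xs i ∈ P.X) (hx : x ∈ P.X)
    (hxl : Tendsto xs l (𝓝 x)) (hyl : Tendsto ys l (𝓝 y)) :
    Tendsto (fun i => P.vEnv γ (xs i) (ys i)) l (𝓝 (P.vEnv γ x y)) := by
  obtain ⟨C, hC, hb⟩ := h.exists_envelope_bounds
  have d1 : Tendsto (fun i => xs i - x) l (𝓝 0) := tendsto_sub_nhds_zero_iff.2 hxl
  have d2 : Tendsto (fun i => ys i - y) l (𝓝 0) := tendsto_sub_nhds_zero_iff.2 hyl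
  set L : ι → ℝ := fun i => inner ℝ (P.phiX x (P.envSol γ x y)) (xs i - x)
    + inner ℝ ((1 / γ) • (y - P.envSol γ x y)) (ys i - y)
  have h1 : Tendsto L l (𝓝 0) := by
    have := ((tendsto_const_nhds (x := P.phiX x (P.envSol γ x y))).inner d1 (𝕜 := ℝ)).add
      ((tendsto_const_nhds (x := (1 / γ) • (y - P.envSol γ x y))).inner d2 (𝕜 := ℝ))
    rwa [inner_zero_right, inner_zero_right, add_zero] at this
  have h2 : Tendsto (fun i => C * (‖xs i - x‖ ^ 2 + ‖ys i - y‖ ^ 2)) l (𝓝 0) := by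
    have := ((d1.norm.pow 2).add (d2.norm.pow 2)).const_mul C
    simpa using this
  have h3 : Tendsto (fun i => P.vEnv γ (xs i) (ys i) - P.vEnv γ x y - L i) l (𝓝 0) := by
    refine squeeze_zero_norm' ?_ h2
    filter_upwards [hxs] with i hi
    rw [Real.norm_eq_abs]
    exact (hb x hx (xs i) hi y (ys i)).2
  have h4 := (h3.add h1).add_const (P.vEnv γ x y)
  simpa using h4

theorem tendsto_of_continuousOn_box {k : Eu n → Eu m → ℝ} (hk : ContinuousOn (onPair k) P.box)
    (hxs : ∀ᶠ i in l, xs i ∈ P.X) (hys : ∀ᶠ i in l, ys i ∈ P.Y) (hx : x ∈ P.X) (hy : y ∈ P.Y)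
    (hxl : Tendsto xs l (𝓝 x)) (hyl : Tendsto ys l (𝓝 y)) :
    Tendsto (fun i => k (xs i) (ys i)) l (𝓝 (k x y)) := by
  have h1 : ContinuousWithinAt (onPair k) P.box (pair x y) := hk _ ⟨hx, hy⟩
  have h2 : Tendsto (fun i => pair (xs i) (ys i)) l (𝓝[P.box] (pair x y)) :=
    tendsto_nhdsWithin_iff.2 ⟨(continuous_pair.tendsto (x, y)).comp (hxl.prodMk_nhds hyl),
      (hxs.and hys).mono fun i hi => hi⟩
  exact h1.tendsto.comp h2

theorem tendsto_of_lipschitz_box {V : Type} [NormedAddCommGroup V] {k : Eu n → Eu m → V}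
    {C D : ℝ} (hk : ∀ x ∈ P.X, ∀ x' ∈ P.X, ∀ y ∈ P.Y, ∀ y' ∈ P.Y,
      ‖k x y - k x' y'‖ ≤ C * ‖x - x'‖ + D * ‖y - y'‖)
    (hxs : ∀ᶠ i in l, xs i ∈ P.X) (hys : ∀ᶠ i in l, ys i ∈ P.Y) (hx : x ∈ P.X) (hy : y ∈ P.Y)
    (hxl : Tendsto xs l (𝓝 x)) (hyl : Tendsto ys l (𝓝 y)) :
    Tendsto (fun i => k (xs i) (ys i)) l (𝓝 (k x y)) := by
  rw [tendsto_iff_norm_sub_tendsto_zero]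
  have h1 : Tendsto (fun i => C * ‖xs i - x‖ + D * ‖ys i - y‖) l (𝓝 0) := by
    have := ((tendsto_iff_norm_sub_tendsto_zero.1 hxl).const_mul C).add
      ((tendsto_iff_norm_sub_tendsto_zero.1 hyl).const_mul D)
    simpa using this
  refine squeeze_zero' (Eventually.of_forall fun i => norm_nonneg _) ?_ h1
  filter_upwards [hxs, hys] with i hi hi'
  exact hk _ hi _ hx _ hi' _ hy

theorem tendsto_phiX (h : P.IsRegular M γ) (hxs : ∀ᶠ i in l, xs i ∈ P.X)
    (hys : ∀ᶠ i in l, ys i ∈ P.Y) (hx : x ∈ P.X) (hy : y ∈ P.Y)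
    (hxl : Tendsto xs l (𝓝 x)) (hyl : Tendsto ys l (𝓝 y)) :
    Tendsto (fun i => P.phiX (xs i) (ys i)) l (𝓝 (P.phiX x y)) :=
  tendsto_of_lipschitz_box (fun _ hx _ hx' _ hy _ hy' => h.phiX_lip hx hx' hy hy') hxs hys hx hy
    hxl hyl

theorem tendsto_envDual (h : P.IsRegular M γ) (ρ : ℝ) (hxs : ∀ᶠ i in l, xs i ∈ P.X)
    (hx : x ∈ P.X) (hxl : Tendsto xs l (𝓝 x)) (hyl : Tendsto ys l (𝓝 y)) :
    Tendsto (fun i => P.envDual γ ρ (xs i) (ys i)) l (𝓝 (P.envDual γ ρ x y)) :=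
  (h.tendsto_phiX hxs (hxs.mono fun _ hi => (h.envSol_spec hi _).1) hx (h.envSol_spec hx y).1 hxl
    (h.tendsto_envSol hxs hx hxl hyl)).add (hxl.const_smul ρ)

theorem tendsto_penalized (h : P.IsRegular M γ) (hF : P.UpperAssumption M) (p : ℝ)
    (hxs : ∀ᶠ i in l, xs i ∈ P.X) (hys : ∀ᶠ i in l, ys i ∈ P.Y) (hx : x ∈ P.X) (hy : y ∈ P.Y)
    (hxl : Tendsto xs l (𝓝 x)) (hyl : Tendsto ys l (𝓝 y)) :
    Tendsto (fun i => P.penalized γ p (xs i) (ys i)) l (𝓝 (P.penalized γ p x y)) :=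
  ((((tendsto_of_continuousOn_box hF.contDiff.continuous.continuousOn hxs hys hx hy hxl
    hyl).sub_const _).const_mul _).add
    (tendsto_of_continuousOn_box h.continuousOn_phi hxs hys hx hy hxl hyl)).sub
    (h.tendsto_vEnv hxs hx hxl hyl)

end Continuity

theorem isClosed_box (h : P.IsRegular M γ) : IsClosed P.box :=
  (h.sets.closed_X.preimage continuous_pair_fst).inter
    (h.sets.closed_Y.preimage continuous_pair_snd)

theorem penalized_nonneg (h : P.IsRegular M γ) (hF : P.UpperAssumption M) {p : ℝ} (hp : 0 < p)
    {x : Eu n} {y : Eu m} (hx : x ∈ P.X) (hy : y ∈ P.Y) : 0 ≤ P.penalized γ p x y := by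
  have h1 := hF.Finf_le hx hy
  have h2 := h.vEnv_le_phi hx hy
  have h3 : 0 ≤ 1 / p * (P.F x y - P.Finf) := mul_nonneg (by positivity) (by linarith)
  rw [penalized]
  linarith

/-- A bounded sequence with sufficient decrease of the merit function and relative error bounds
for its subgradients converges, if the merit function is a KL function. -/
theorem exists_tendsto_of_KL (h : P.IsRegular M γ) (hF : P.UpperAssumption M) {c : ℝ} (hc : 0 < c)
    {p : ℝ} (hp : 0 < p) (hKL : IsKLFunction (P.merit γ (M.ρf1 + M.ρg1 + c / 4) p))
    {z : ℕ → Pair n m} (hz : ∀ k, z k ∈ P.box) (hbdd : Bornology.IsBounded (Set.range z))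
    {e w : ℕ → ℝ} {a b B : ℝ} (ha : 0 < a) (hb : 0 ≤ b)
    (he0 : ∀ k, 0 ≤ e k) (he : Summable e) (hw0 : ∀ k, 0 < w k) (hwmono : Monotone w)
    (hwinv : Summable fun k => (w k)⁻¹) (hwe : Summable fun k => w k * e k ^ 2)
    (hdesc : ∀ k, P.meritReal γ (M.ρf1 + M.ρg1 + c / 4) p (WithLp.toLp 2 (z (k + 1),
        P.envDual γ (M.ρf1 + M.ρg1 + c / 4) (z k).fst (z (k + 1)).snd))
      + a * ‖z (k + 1) - z k‖ ^ 2 ≤ P.penalized γ p (z k).fst (z k).snd + b * e k ^ 2)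
    (hsub : ∀ k, ∃ v ∈ frechetSubdiff (P.merit γ (M.ρf1 + M.ρg1 + c / 4) p)
        (WithLp.toLp 2 (z (k + 1),
          P.envDual γ (M.ρf1 + M.ρg1 + c / 4) (z k).fst (z (k + 1)).snd)),
      ‖v‖ ≤ B * (‖z (k + 1) - z k‖ + e k)) :
    ∃ zb ∈ P.box, Tendsto z atTop (𝓝 zb) := by
  set ρ := M.ρf1 + M.ρg1 + c / 4 with hρ
  -- The dual variable mixes the old `x` with the new `y`, because the projection step linearizes
  -- the envelope there.
  set W : ℕ → Triple n m := fun k =>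
    WithLp.toLp 2 (z (k + 1), P.envDual γ ρ (z k).fst (z (k + 1)).snd) with hW
  set E : ℕ → ℝ := fun k => P.meritReal γ ρ p (W k) with hE
  have hpen : ∀ k, P.penalized γ p (z (k + 1)).fst (z (k + 1)).snd ≤ E k := fun k =>
    h.penalized_le_merit hc p (hz (k + 1)).1 _ _
  have hpen0 : ∀ k, 0 ≤ P.penalized γ p (z k).fst (z k).snd := fun k =>
    h.penalized_nonneg hF hp (hz k).1 (hz k).2
  have hdescE : ∀ k, E (k + 1) + a * ‖z (k + 1 + 1) - z (k + 1)‖ ^ 2 ≤ E k + b * e (k + 1) ^ 2 :=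
    fun k => (hdesc (k + 1)).trans (by linarith [hpen k])
  have he1 : Summable fun k => e (k + 1) := (summable_nat_add_iff 1).2 he
  have hwe1 : Summable fun k => w (k + 1) * e (k + 1) ^ 2 := (summable_nat_add_iff 1).2 hwe
  have he2 : Summable fun k => e (k + 1) ^ 2 := by
    refine (hwe1.mul_left (w 0)⁻¹).of_nonneg_of_le (fun k => sq_nonneg _) fun k => ?_
    have h1 := mul_le_mul_of_nonneg_right (hwmono (Nat.zero_le (k + 1))) (sq_nonneg (e (k + 1)))
    rw [← div_eq_inv_mul, le_div_iff₀ (hw0 0)]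
    linarith
  obtain ⟨Es, hEs, hd2⟩ := exists_tendsto_of_descent (e := fun k => e (k + 1)) ha hb
    (fun k => (hpen0 (k + 1)).trans (hpen k)) he2 hdescE
  have hd : Tendsto (fun k => ‖z (k + 1 + 1) - z (k + 1)‖) atTop (𝓝 0) := by
    have := (Real.continuous_sqrt.tendsto 0).comp hd2
    rw [Real.sqrt_zero] at this
    exact this.congr fun k => Real.sqrt_sq (norm_nonneg _)
  obtain ⟨zb, -, φ, hφ, hφlim⟩ := tendsto_subseq_of_bounded hbdd
    (fun k => mem_range_self (f := z) (k + 1))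
  have hφ1 : Tendsto (fun j => z (φ j + 1)) atTop (𝓝 zb) := hφlim
  have hφ2 : Tendsto (fun j => z (φ j + 1 + 1)) atTop (𝓝 zb) := by
    have := hφ1.add (tendsto_zero_iff_norm_tendsto_zero.2 (hd.comp hφ.tendsto_atTop))
    rw [add_zero] at this
    refine this.congr fun j => ?_
    simp
  have hzb : zb ∈ P.box := h.isClosed_box.mem_of_tendsto hφ1 (Eventually.of_forall fun j => hz _)
  have hfst := fun {l : Filter ℕ} {q : ℕ → ℕ} (hq : Tendsto (fun j => z (q j)) l (𝓝 zb)) =>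
    (continuous_pair_fst.tendsto zb).comp hq
  have hsnd := fun {l : Filter ℕ} {q : ℕ → ℕ} (hq : Tendsto (fun j => z (q j)) l (𝓝 zb)) =>
    (continuous_pair_snd.tendsto zb).comp hq
  set wb : Triple n m := WithLp.toLp 2 (zb, P.envDual γ ρ zb.fst zb.snd) with hwb
  have hcont : Continuous fun q : Pair n m × Eu n => (WithLp.toLp 2 q : Triple n m) :=
    WithLp.prod_continuous_toLp 2 _ _
  have hWlim : Tendsto (fun j => W (φ j + 1)) atTop (𝓝 wb) := by
    refine (hcont.tendsto (zb, P.envDual γ ρ zb.fst zb.snd)).comp (hφ2.prodMk_nhds ?_)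
    exact h.tendsto_envDual ρ (Eventually.of_forall fun j => (hz _).1) hzb.1 (hfst hφ1) (hsnd hφ2)
  -- The penalized values are squeezed by consecutive merit values up to errors. Hence the merit
  -- value at the cluster point is found from continuity of the penalized function, not of the
  -- conjugate.
  have hpenlim : Tendsto (fun k => P.penalized γ p (z (k + 1)).fst (z (k + 1)).snd) atTop
      (𝓝 Es) := by
    have h1 : Tendsto (fun k => E (k + 1) - b * e (k + 1) ^ 2) atTop (𝓝 Es) := by
      have := ((tendsto_add_atTop_iff_nat 1).2 hEs).sub (he2.tendsto_atTop_zero.const_mul b)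
      simpa using this
    refine tendsto_of_tendsto_of_tendsto_of_le_of_le h1 hEs (fun k => ?_) hpen
    have h2 := hdesc (k + 1)
    have h3 : 0 ≤ a * ‖z (k + 1 + 1) - z (k + 1)‖ ^ 2 := by positivity
    change E (k + 1) - _ ≤ _
    change E (k + 1) + _ ≤ _ at h2
    linarith
  have hEb : P.meritReal γ ρ p wb = Es := by
    have h1 : P.meritReal γ ρ p wb = P.penalized γ p zb.fst zb.snd :=
      h.merit_envDual_self hc p hzb.1 zb.snd
    rw [h1]
    exact tendsto_nhds_unique (h.tendsto_penalized hF p (Eventually.of_forall fun j => (hz _).1)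
      (Eventually.of_forall fun j => (hz _).2) hzb.1 hzb.2 (hfst hφ1) (hsnd hφ1))
      (hpenlim.comp hφ.tendsto_atTop)
  have hmeritW : ∀ k, P.merit γ ρ p (W k) = (E k : EReal) := fun k => by
    rw [merit_eq_extend, extend]
    exact if_pos (hz (k + 1))
  have hmeritb : P.merit γ ρ p wb = (Es : EReal) := by
    rw [← hEb, merit_eq_extend, extend]
    exact if_pos hzb
  choose v hv hvB using hsub
  -- The subgradients along the subsequence tend to `0`, so `0` is a limiting subgradient and the KL
  -- hypothesis applies at `wb`.
  have hne : (limitingSubdiff (P.merit γ ρ p) wb).Nonempty := by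
    refine ⟨0, by simp [hmeritb], by simp [hmeritb], fun j => W (φ j + 1),
      fun j => v (φ j + 1), hWlim, ?_, fun j => hv _, ?_⟩
    · simp only [hmeritW, hmeritb]
      exact (continuous_coe_real_ereal.tendsto Es).comp
        (((tendsto_add_atTop_iff_nat 1).2 hEs).comp hφ.tendsto_atTop)
    · refine squeeze_zero_norm (a := fun j => B * (‖z (φ j + 1 + 1) - z (φ j + 1)‖ + e (φ j + 1)))
        (fun j => hvB _) ?_
      have := ((hd.add he1.tendsto_atTop_zero).const_mul B).comp hφ.tendsto_atTop
      rwa [add_zero, mul_zero] at this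
  obtain ⟨ζ, ψ, hζ, hψ, U, hU, hUkl⟩ := hKL.kl wb hne
  -- The shift by one: passing from `E k` to `E (k + 1)` concerns the step from `z (k + 1)` to `z (k
  -- + 2)`.
  obtain ⟨q, hq0, hqs, hq⟩ := exists_summable_contraction (E := E)
    (d := fun k => ‖z (k + 1 + 1) - z (k + 1)‖) (e := fun k => e (k + 1)) (c := fun k => w (k + 1))
    (B := B) ha hb
    (fun k => norm_nonneg _) (fun k => he0 _) (fun k => hw0 _)
    (fun i j hij => hwmono (by omega)) ((summable_nat_add_iff 1).2 hwinv) he1 hwe1 hdescE hEs hζ hψ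
  -- Continuity of `envDual` on the box turns the KL neighborhood of triples into a ball for two
  -- consecutive iterates.
  obtain ⟨r, hr, hrU⟩ : ∃ r > 0, ∀ z₁ ∈ P.box, ∀ z₂ ∈ P.box, ‖z₁ - zb‖ < r → ‖z₂ - zb‖ < r →
      (WithLp.toLp 2 (z₂, P.envDual γ ρ z₁.fst z₂.snd) : Triple n m) ∈ U := by
    have h1 : Tendsto (fun q : Pair n m × Pair n m =>
        (WithLp.toLp 2 (q.2, P.envDual γ ρ q.1.fst q.2.snd) : Triple n m))
        (𝓝[P.box] zb ×ˢ 𝓝[P.box] zb) (𝓝 wb) := by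
      have l1 : Tendsto (fun q : Pair n m × Pair n m => q.1) (𝓝[P.box] zb ×ˢ 𝓝[P.box] zb)
        (𝓝 zb) := tendsto_fst.mono_right nhdsWithin_le_nhds
      have l2 : Tendsto (fun q : Pair n m × Pair n m => q.2) (𝓝[P.box] zb ×ˢ 𝓝[P.box] zb)
        (𝓝 zb) := tendsto_snd.mono_right nhdsWithin_le_nhds
      refine (hcont.tendsto (zb, P.envDual γ ρ zb.fst zb.snd)).comp (l2.prodMk_nhds ?_)
      refine h.tendsto_envDual ρ ?_ hzb.1 ((continuous_pair_fst.tendsto zb).comp l1)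
        ((continuous_pair_snd.tendsto zb).comp l2)
      have l3 : Tendsto (fun q : Pair n m × Pair n m => q.1) (𝓝[P.box] zb ×ˢ 𝓝[P.box] zb)
        (𝓝[P.box] zb) := tendsto_fst
      exact (l3.eventually self_mem_nhdsWithin).mono fun q hq => hq.1
    obtain ⟨r, hr, hrs⟩ :=
      (Metric.nhdsWithin_basis_ball (x := zb) (s := P.box)).prod_self.mem_iff.1 (h1 hU)
    refine ⟨r, hr, fun z₁ h₁ z₂ h₂ hd₁ hd₂ => ?_⟩
    exact hrs (show (z₁, z₂) ∈ _ from ⟨⟨by rwa [Metric.mem_ball, dist_eq_norm], h₁⟩,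
      ⟨by rwa [Metric.mem_ball, dist_eq_norm], h₂⟩⟩)
  refine ⟨zb, hzb, (tendsto_add_atTop_iff_nat 1).1 ?_⟩
  refine tendsto_of_local_contraction (z := fun k => z (k + 1)) hr hq0 hqs
    (hφ1.mapClusterPt.of_comp hφ.tendsto_atTop) hd ?_
  filter_upwards [hq] with k hk hk1 hk2
  refine hk fun hlt hlt2 => ?_
  have hmem := hrU _ (hz (k + 1)) _ (hz (k + 1 + 1)) hk1 hk2
  have hkl := hUkl _ hmem
  change P.merit γ ρ p wb < P.merit γ ρ p (W (k + 1)) →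
    P.merit γ ρ p (W (k + 1)) < P.merit γ ρ p wb + ζ → 1 ≤ ENNReal.ofReal
      (deriv ψ ((P.merit γ ρ p (W (k + 1))).toReal - (P.merit γ ρ p wb).toReal)) *
      Metric.infEDist 0 (limitingSubdiff (P.merit γ ρ p) (W (k + 1))) at hkl
  rw [hmeritW, hmeritb] at hkl
  have h1 := hkl (EReal.coe_lt_coe_iff.2 hlt) hlt2
  rw [EReal.toReal_coe, EReal.toReal_coe] at h1
  have h2 : Metric.infEDist 0 (limitingSubdiff (P.merit γ ρ p) (W (k + 1)))
      ≤ ENNReal.ofReal ‖v (k + 1)‖ := by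
    have h3 := Metric.infEDist_le_edist_of_mem (x := (0 : Triple n m))
      (frechetSubdiff_subset_limitingSubdiff _ _ (hv (k + 1)))
    refine h3.trans (le_of_eq ?_)
    rw [edist_dist, dist_zero_left]
  set D := deriv ψ (E (k + 1) - Es) with hD
  have h4 : 1 ≤ ENNReal.ofReal (D * ‖v (k + 1)‖) := by
    rw [ENNReal.ofReal_mul' (norm_nonneg _)]
    exact h1.trans (by gcongr)
  have h5 : 1 ≤ D * ‖v (k + 1)‖ := ENNReal.one_le_ofReal.1 h4
  have hD0 : 0 < D := by
    by_contra! hcon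
    have := mul_nonpos_of_nonpos_of_nonneg hcon (norm_nonneg (v (k + 1)))
    linarith
  exact h5.trans (mul_le_mul_of_nonneg_left (hvB (k + 1)) hD0.le)

end IsRegular

end BilevelProblem

/-! ### Descent and relative error of one inexact step. -/

namespace BilevelProblem

variable {n m : ℕ}

/-- One step from `(x, y)` to `(xp, yp)`, with first order optimality of the proximal step and of
the projection, and with the errors of the inexact solutions bounded by `δ`. -/
structure InexactStep (P : BilevelProblem n m) (γ p α β δ : ℝ) (x xp : Eu n)
    (y yp θ θ' : Eu m) : Prop where
  x_mem : x ∈ P.X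
  xp_mem : xp ∈ P.X
  y_mem : y ∈ P.Y
  yp_mem : yp ∈ P.Y
  θ'_mem : θ' ∈ P.Y
  prox_le : ∀ y' ∈ P.Y, P.g x yp + inner ℝ ((1 / β) • (y - yp)
    - ((1 / p) • gradY P.F x y + gradY P.f x y - (1 / γ) • (y - θ))) (y' - yp) ≤ P.g x y'
  proj_le : ∀ x' ∈ P.X, inner ℝ
    (x - α • ((1 / p) • gradX P.F x yp + P.phiX x yp - P.phiX x θ') - xp) (x' - xp) ≤ 0
  err : ‖θ - P.envSol γ x y‖ ≤ δ
  err' : ‖θ' - P.envSol γ x yp‖ ≤ δ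

namespace IsRegular

variable {P : BilevelProblem n m} {M : Moduli} {γ : ℝ}

/-- The proximal step leads to the penalized value at `(x, yp)`, the projection from there to the
merit value. Of the margins `cβ/2` and `3cα/8` left by the step size rules, Young's inequality
spends `cβ/4` and `cα/4` on the errors. -/
theorem merit_descent (h : P.IsRegular M γ) (hF : P.UpperAssumption M) {cα cβ : ℝ} (hcα : 0 < cα)
    (hcβ : 0 < cβ) {p α β δ : ℝ} (hp : 0 < p) (hα : 0 < α) (hβ : 0 < β)
    (hα' : α ≤ 2 / ((M.LFx / p + M.Lfx + M.Lg1 + M.ρf1 + M.ρg1) + cα))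
    (hβ' : β ≤ 2 / ((M.LFy / p + M.Lfy) + cβ)) {x xp : Eu n} {y yp θ θ' : Eu m}
    (hs : P.InexactStep γ p α β δ x xp y yp θ θ') :
    P.meritReal γ (M.ρf1 + M.ρg1 + cα / 4) p
        (WithLp.toLp 2 (pair xp yp, P.envDual γ (M.ρf1 + M.ρg1 + cα / 4) x yp))
      + min (cβ / 4) (cα / 8) * ‖pair xp yp - pair x y‖ ^ 2
      ≤ P.penalized γ p x y
        + ((1 / γ) ^ 2 / cβ + (M.Lfx + M.Lg2) ^ 2 / cα) * δ ^ 2 := by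
  have hγ := h.γ_pos
  have hL1 := h.smooth.Lfx_nonneg
  have hL2 := h.smooth.Lg1_nonneg
  have hL3 := h.smooth.Lg2_nonneg
  have hL4 := h.smooth.Lfy_nonneg
  have hF1 := hF.LFx_nonneg
  have hF2 := hF.LFy_nonneg
  have hρ1 := h.smooth.ρf1_nonneg
  have hρ2 := h.smooth.ρg1_nonneg
  have h1 := h.penalized_prox_step hF hp hs.x_mem hs.y_mem hs.yp_mem (hs.prox_le y hs.y_mem)
  have h2 := h.merit_proj_step hF hcα hp hα hs.x_mem hs.xp_mem hs.yp_mem hs.θ'_mem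
    (hs.proj_le x hs.x_mem)
  have hβ1 : (M.LFy / p + M.Lfy + cβ) / 2 ≤ 1 / β := by
    rw [le_div_iff₀ hβ]
    rw [le_div_iff₀ (by positivity)] at hβ'
    linarith
  have hα1 : (M.LFx / p + M.Lfx + M.Lg1 + M.ρf1 + M.ρg1 + cα) / 2 ≤ 1 / α := by
    rw [le_div_iff₀ hα]
    rw [le_div_iff₀ (by positivity)] at hα'
    linarith
  have hn : ‖pair xp yp - pair x y‖ ^ 2 = ‖xp - x‖ ^ 2 + ‖yp - y‖ ^ 2 := by
    rw [pair_sub, norm_pair_sq]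
  set u := ‖xp - x‖ with hu
  set v := ‖yp - y‖ with hv
  have hu0 : 0 ≤ u := norm_nonneg _
  have hv0 : 0 ≤ v := norm_nonneg _
  have h3 : cβ / 2 * v ^ 2 ≤ (1 / β - (M.LFy / p + M.Lfy) / 2) * v ^ 2 :=
    mul_le_mul_of_nonneg_right (by linarith) (sq_nonneg v)
  have h4 : 3 * cα / 8 * u ^ 2
      ≤ (1 / α - (M.LFx / p + M.Lfx + M.Lg1 + M.ρf1 + M.ρg1 + cα / 4) / 2) * u ^ 2 :=
    mul_le_mul_of_nonneg_right (by linarith) (sq_nonneg u)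
  have h5 : 1 / γ * ‖θ - P.envSol γ x y‖ * v ≤ 1 / γ * δ * v :=
    mul_le_mul_of_nonneg_right (mul_le_mul_of_nonneg_left hs.err (by positivity)) hv0
  have h6 : (M.Lfx + M.Lg2) * ‖θ' - P.envSol γ x yp‖ * u ≤ (M.Lfx + M.Lg2) * δ * u :=
    mul_le_mul_of_nonneg_right (mul_le_mul_of_nonneg_left hs.err' (by positivity)) hu0
  have young : ∀ κ t c : ℝ, 0 < c → κ * δ * t ≤ c / 4 * t ^ 2 + κ ^ 2 / c * δ ^ 2 := by
    intro κ t c hc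
    have e1 : 0 ≤ c / 4 * (t - 2 / c * κ * δ) ^ 2 := by positivity
    have e2 : c / 4 * (t - 2 / c * κ * δ) ^ 2
        = c / 4 * t ^ 2 - κ * δ * t + κ ^ 2 / c * δ ^ 2 := by
      field_simp
      ring
    linarith
  have h7 := young (1 / γ) v cβ hcβ
  have h8 := young (M.Lfx + M.Lg2) u cα hcα
  have h9 : min (cβ / 4) (cα / 8) * v ^ 2 ≤ cβ / 4 * v ^ 2 :=
    mul_le_mul_of_nonneg_right (min_le_left _ _) (sq_nonneg v)
  have h10 : min (cβ / 4) (cα / 8) * u ^ 2 ≤ cα / 8 * u ^ 2 :=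
    mul_le_mul_of_nonneg_right (min_le_right _ _) (sq_nonneg u)
  rw [hn]
  linarith

theorem norm_toLp_pair_le (a d : Eu n) (b : Eu m) :
    ‖(WithLp.toLp 2 (pair a b, d) : Triple n m)‖ ≤ ‖a‖ + ‖b‖ + ‖d‖ := by
  have h1 : ‖(WithLp.toLp 2 (pair a b, d) : Triple n m)‖ ^ 2 = ‖pair a b‖ ^ 2 + ‖d‖ ^ 2 :=
    WithLp.prod_norm_sq_eq_of_L2 _
  have h2 : ‖(WithLp.toLp 2 (pair a b, d) : Triple n m)‖ ≤ ‖pair a b‖ + ‖d‖ := by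
    refine le_of_sq_le_sq ?_ (by positivity)
    rw [h1]
    nlinarith [norm_nonneg (pair a b), norm_nonneg d]
  linarith [norm_pair_le a b]

theorem norm_add_four_le {V : Type} [NormedAddCommGroup V] (a b c d : V) :
    ‖a + b + c + d‖ ≤ ‖a‖ + ‖b‖ + ‖c‖ + ‖d‖ := by
  linarith [norm_add_le (a + b + c) d, norm_add_le (a + b) c, norm_add_le a b]

/-- The optimality conditions supply a normal vector and a subgradient of `g`. Inserted in the
subgradient of the merit function, they leave only differences between the two points and errors of
the inexact solutions. -/
theorem exists_merit_subgradient (h : P.IsRegular M γ) (hF : P.UpperAssumption M) {L : ℝ}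
    (hL : P.SubdiffLipschitz L) {cα : ℝ} (hcα : 0 < cα) {p αlow βlow : ℝ} (hp : 0 < p)
    (hαlow : 0 < αlow) (hβlow : 0 < βlow) : ∃ B : ℝ, 0 ≤ B ∧
    ∀ {α β δ : ℝ} {x xp : Eu n} {y yp θ θ' : Eu m}, αlow ≤ α → βlow ≤ β →
      P.InexactStep γ p α β δ x xp y yp θ θ' →
      ∃ v ∈ frechetSubdiff (P.merit γ (M.ρf1 + M.ρg1 + cα / 4) p)
        (WithLp.toLp 2 (pair xp yp, P.envDual γ (M.ρf1 + M.ρg1 + cα / 4) x yp)),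
        ‖v‖ ≤ B * (‖pair xp yp - pair x y‖ + δ) := by
  have hγ := h.γ_pos
  obtain ⟨Ce, hCe, hb⟩ := h.exists_envelope_bounds
  have hL1 := h.smooth.Lfx_nonneg
  have hL2 := h.smooth.Lg1_nonneg
  have hL3 := h.smooth.Lg2_nonneg
  have hL4 := h.smooth.Lfy_nonneg
  have hF1 := hF.LFx_nonneg
  have hF2 := hF.LFy_nonneg
  have hρ1 := h.smooth.ρf1_nonneg
  have hρ2 := h.smooth.ρg1_nonneg
  have hρ0 : 0 ≤ M.ρf1 + M.ρg1 + cα / 4 := by positivity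
  set ρ := M.ρf1 + M.ρg1 + cα / 4 with hρ
  set B₁ := 1 / p * M.LFx + (M.Lfx + M.Lg1) + ρ + 1 / αlow with hB₁
  set B₂ := 2 * (1 / p * M.LFy + M.Lfy) + |L| + (1 / βlow + 1 / γ) + 1 / γ * Ce with hB₂
  set B₃ := M.Lfx + M.Lg2 + 1 / γ with hB₃
  have hB₁0 : 0 ≤ B₁ := by positivity
  have hB₂0 : 0 ≤ B₂ := by positivity
  have hB₃0 : 0 ≤ B₃ := by positivity
  refine ⟨B₁ + B₂ + 1 + 2 * B₃, by positivity, ?_⟩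
  intro α β δ x xp y yp θ θ' hα hβ hs
  have hα0 : 0 < α := hαlow.trans_le hα
  have hβ0 : 0 < β := hβlow.trans_le hβ
  have hx := hs.x_mem
  have hxp := hs.xp_mem
  have hy := hs.y_mem
  have hyp := hs.yp_mem
  set s' := P.envSol γ x yp with hs'
  have hs'Y : s' ∈ P.Y := (h.envSol_spec hx yp).1
  set s := P.envSol γ x y with hss
  set u := ‖xp - x‖ with hu
  set v := ‖yp - y‖ with hv
  set D := ‖pair xp yp - pair x y‖ with hD
  have hn : D ^ 2 = u ^ 2 + v ^ 2 := by
    rw [hD, pair_sub, norm_pair_sq]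
  have hD0 : 0 ≤ D := norm_nonneg _
  have hu0 : 0 ≤ u := norm_nonneg _
  have hv0 : 0 ≤ v := norm_nonneg _
  have huD : u ≤ D := le_of_sq_le_sq (by rw [hn]; nlinarith) hD0
  have hvD : v ≤ D := le_of_sq_le_sq (by rw [hn]; nlinarith) hD0
  have hδ0 : 0 ≤ δ := (norm_nonneg _).trans hs.err
  set dx := (1 / p) • gradX P.F x yp + P.phiX x yp - P.phiX x θ' with hdx
  set w := (1 / α) • (x - xp) - dx with hw
  have hwn : ∀ x' ∈ P.X, inner ℝ w (x' - xp) ≤ 0 := by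
    intro x' hx'
    have e1 : inner ℝ (x - α • dx - xp) (x' - xp) ≤ 0 := hs.proj_le x' hx'
    have e2 : α • w = x - xp - α • dx := by
      rw [hw, smul_sub α _ dx, smul_smul, mul_one_div_cancel hα0.ne', one_smul]
    rw [show x - α • dx - xp = x - xp - α • dx by abel, ← e2, real_inner_smul_left] at e1
    exact nonpos_of_mul_nonpos_right e1 hα0
  set dy := (1 / β) • (y - yp) - ((1 / p) • gradY P.F x y + gradY P.f x y - (1 / γ) • (y - θ))
    with hdy
  have hdymem : dy ∈ P.subdiffGy x yp :=
    frechetSubdiff_subset_limitingSubdiff _ _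
      (mem_frechetSubdiff_of_quadratic (C := 0) hyp fun y' hy' => by
        rw [zero_mul, sub_zero]
        exact hs.prox_le y' hy')
  -- The proximal step gives a subgradient of `g(x, ·)`, while the merit function at the new point
  -- needs one of `g(xp, ·)`. Assumption 4 provides the transfer.
  obtain ⟨ξ, hξ, hξn⟩ := hL yp hyp xp hxp x hx dy hdymem
  refine ⟨_, h.mem_frechetSubdiff_merit hF hcα hp hx hxp hyp hwn
    ((h.lower.convex_g xp hxp).subgradient_of_mem_limitingSubdiff hξ), ?_⟩
  refine (norm_toLp_pair_le _ _ _).trans ?_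
  have hxcomp : ‖(1 / p) • gradX P.F xp yp + P.phiX xp yp + ρ • xp - P.envDual γ ρ x yp + w‖
      ≤ B₁ * D + B₃ * δ := by
    have e1 : (1 / p) • gradX P.F xp yp + P.phiX xp yp + ρ • xp - P.envDual γ ρ x yp + w
        = (1 / p) • (gradX P.F xp yp - gradX P.F x yp) + (P.phiX xp yp - P.phiX x yp)
          + (ρ • (xp - x) + (1 / α) • (x - xp)) + (P.phiX x θ' - P.phiX x s') := by
      rw [hw, hdx, envDual, ← hs']
      module
    rw [e1]
    refine (norm_add_four_le _ _ _ _).trans ?_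
    have e2 : ‖(1 / p) • (gradX P.F xp yp - gradX P.F x yp)‖ ≤ 1 / p * (M.LFx * D) := by
      rw [norm_smul, Real.norm_of_nonneg (by positivity)]
      refine mul_le_mul_of_nonneg_left ?_ (by positivity)
      have := hF.lip_left hxp hx hyp hyp
      rw [sub_self, norm_zero, add_zero] at this
      exact this.trans (mul_le_mul_of_nonneg_left huD hF1)
    have e3 : ‖P.phiX xp yp - P.phiX x yp‖ ≤ (M.Lfx + M.Lg1) * D :=
      (h.phiX_lip_left hyp xp hxp x hx).trans (mul_le_mul_of_nonneg_left huD (by positivity))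
    have e4 : ‖ρ • (xp - x) + (1 / α) • (x - xp)‖ ≤ (ρ + 1 / αlow) * D := by
      refine (norm_add_le _ _).trans ?_
      rw [norm_smul, norm_smul, Real.norm_of_nonneg hρ0, Real.norm_of_nonneg (by positivity),
        norm_sub_rev x xp, ← hu, ← add_mul]
      have e5 : 1 / α ≤ 1 / αlow := one_div_le_one_div_of_le hαlow hα
      exact mul_le_mul (by linarith) huD hu0 (by positivity)
    have e6 : ‖P.phiX x θ' - P.phiX x s'‖ ≤ (M.Lfx + M.Lg2) * δ :=
      (h.phiX_lip_right hx hs.θ'_mem hs'Y).trans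
        (mul_le_mul_of_nonneg_left hs.err' (by positivity))
    have e7 : 0 ≤ 1 / γ * δ := by positivity
    rw [hB₁, hB₃]
    linarith
  have hycomp : ‖(1 / p) • gradY P.F xp yp + gradY P.f xp yp + ξ - (1 / γ) • (yp - s')‖
      ≤ B₂ * D + B₃ * δ := by
    have e1 : (1 / p) • gradY P.F xp yp + gradY P.f xp yp + ξ - (1 / γ) • (yp - s')
        = ((1 / p) • (gradY P.F xp yp - gradY P.F x y) + (gradY P.f xp yp - gradY P.f x y))
          + (ξ - dy) + (1 / β + 1 / γ) • (y - yp)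
          + (1 / γ) • ((s' - s) + (s - θ)) := by
      rw [hdy]
      module
    rw [e1]
    refine (norm_add_four_le _ _ _ _).trans ?_
    have e2 : ‖(1 / p) • (gradY P.F xp yp - gradY P.F x y) + (gradY P.f xp yp - gradY P.f x y)‖
        ≤ 2 * (1 / p * M.LFy + M.Lfy) * D := by
      refine (norm_add_le _ _).trans ?_
      rw [norm_smul, Real.norm_of_nonneg (by positivity)]
      have f1 := mul_le_mul_of_nonneg_left (hF.lip_right hxp hx hyp hy)
        (show 0 ≤ 1 / p by positivity)
      have f2 := h.lip_fY hxp hx hyp hy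
      have f3 := mul_le_mul_of_nonneg_left (show ‖xp - x‖ + ‖yp - y‖ ≤ 2 * D by linarith)
        (show 0 ≤ 1 / p * M.LFy + M.Lfy by positivity)
      linarith
    have e3 : ‖ξ - dy‖ ≤ |L| * D := by
      rw [norm_sub_rev]
      exact hξn.trans (mul_le_mul (le_abs_self L) huD hu0 (abs_nonneg L))
    have e4 : ‖(1 / β + 1 / γ) • (y - yp)‖ ≤ (1 / βlow + 1 / γ) * D := by
      rw [norm_smul, Real.norm_of_nonneg (by positivity), norm_sub_rev y yp, ← hv]
      have e5 : 1 / β ≤ 1 / βlow := one_div_le_one_div_of_le hβlow hβ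
      exact mul_le_mul (by linarith) hvD hv0 (by positivity)
    have e6 : ‖(1 / γ) • ((s' - s) + (s - θ))‖ ≤ 1 / γ * (Ce * D + δ) := by
      rw [norm_smul, Real.norm_of_nonneg (by positivity)]
      refine mul_le_mul_of_nonneg_left ((norm_add_le _ _).trans ?_) (by positivity)
      have f1 := (hb x hx x hx y yp).1
      rw [sub_self, norm_zero, zero_add, ← hs', ← hss] at f1
      have f2 := mul_le_mul_of_nonneg_left hvD hCe
      have f3 := hs.err
      rw [norm_sub_rev] at f3
      linarith
    have e7 : 0 ≤ (M.Lfx + M.Lg2) * δ := by positivity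
    rw [hB₂, hB₃]
    linarith
  have hucomp : ‖x - xp‖ ≤ D := by rw [norm_sub_rev]; exact huD
  have e8 : 0 ≤ (B₁ + B₂ + 1) * δ := by positivity
  have e9 : 0 ≤ B₃ * D := by positivity
  linarith

end IsRegular

end BilevelProblem

/-! ### Stationarity of the limit. -/

namespace BilevelProblem

variable {n m : ℕ}

namespace IsRegular

variable {P : BilevelProblem n m} {M : Moduli} {γ : ℝ}

theorem tendsto_of_err (h : P.IsRegular M γ) {xs : ℕ → Eu n} {ys θ : ℕ → Eu m} {δ : ℕ → ℝ}
    {x : Eu n} {y : Eu m} (hxs : ∀ k, xs k ∈ P.X) (hx : x ∈ P.X) (hxl : Tendsto xs atTop (𝓝 x))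
    (hyl : Tendsto ys atTop (𝓝 y)) (hθ : ∀ k, ‖θ k - P.envSol γ (xs k) (ys k)‖ ≤ δ k)
    (hδ : Tendsto δ atTop (𝓝 0)) : Tendsto θ atTop (𝓝 (P.envSol γ x y)) := by
  have h1 : Tendsto (fun k => θ k - P.envSol γ (xs k) (ys k)) atTop (𝓝 0) :=
    squeeze_zero_norm hθ hδ
  have h2 := h1.add (h.tendsto_envSol (Eventually.of_forall hxs) hx hxl hyl)
  simpa using h2

/-- Partial subgradients of `g` in `y` together with the partial gradient in `x`. -/
theorem mem_subdiffG (h : P.IsRegular M γ) {x : Eu n} {y : Eu m} (hx : x ∈ P.X) (hy : y ∈ P.Y)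
    {ξ : Eu m} (hξ : ∀ y' ∈ P.Y, P.g x y + inner ℝ ξ (y' - y) ≤ P.g x y') :
    pair (gradX P.g x y) ξ ∈ P.subdiffG (pair x y) := by
  have hL2 := h.smooth.Lg1_nonneg
  refine frechetSubdiff_subset_limitingSubdiff _ _ (mem_frechetSubdiff_of_quadratic
    (C := M.Lg1 / 2 + M.Lg2 + 0) (show pair x y ∈ P.box from ⟨hx, hy⟩) fun z hz => ?_)
  have h1 := quadratic_lower_of_partial (h := P.g) (x := x) (x' := z.fst) (y := y)
    (y' := z.snd) (a := gradX P.g x y) (b := ξ) (C₁ := M.Lg1 / 2) (C₂ := M.Lg2) (C₃ := 0)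
    (by positivity) h.smooth.Lg2_nonneg le_rfl
    (add_sub_sq_le_of_lipschitz_gradient (h := fun x => P.g x z.snd) h.sets.convex_X
      (fun x hx => (h.smooth.diff_gx x hx z.snd hz.2).hasGradientAt)
      (fun x hx x' hx' => h.smooth.lip_g1 z.snd hz.2 x hx x' hx') hx hz.1)
    (h.smooth.lip_g2 x hx z.snd hz.2 y hy)
    (by rw [zero_mul, sub_zero]; exact hξ z.snd hz.2)
  rw [← pair_eta z]
  simp only [onPair, pair_fst, pair_snd, pair_sub, inner_pair, norm_pair_sq]
  exact h1

/-- The limit of a convergent sequence of inexact steps with vanishing errors is stationary for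
the penalized problem. -/
theorem isKKT_of_tendsto (h : P.IsRegular M γ) (hF : P.UpperAssumption M) {p αlow βlow : ℝ}
    (hp : 0 < p) (hαlow : 0 < αlow) (hβlow : 0 < βlow) {α β δ : ℕ → ℝ} {xs : ℕ → Eu n}
    {ys θ θ' : ℕ → Eu m} (hα : ∀ k, αlow ≤ α k) (hβ : ∀ k, βlow ≤ β k)
    (hs : ∀ k, P.InexactStep γ p (α k) (β k) (δ k) (xs k) (xs (k + 1)) (ys k) (ys (k + 1))
      (θ k) (θ' k)) (hδ : Tendsto δ atTop (𝓝 0)) {x : Eu n} {y : Eu m}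
    (hxl : Tendsto xs atTop (𝓝 x)) (hyl : Tendsto ys atTop (𝓝 y)) :
    P.IsKKT γ (P.phi x y - P.vEnv γ x y) (pair x y) := by
  have hX := fun k => (hs k).x_mem
  have hY := fun k => (hs k).y_mem
  have hx : x ∈ P.X := h.sets.closed_X.mem_of_tendsto hxl (Eventually.of_forall hX)
  have hy : y ∈ P.Y := h.sets.closed_Y.mem_of_tendsto hyl (Eventually.of_forall hY)
  have hxl1 := (tendsto_add_atTop_iff_nat 1).2 hxl
  have hyl1 := (tendsto_add_atTop_iff_nat 1).2 hyl
  set s := P.envSol γ x y with hsdef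
  have hsY : s ∈ P.Y := (h.envSol_spec hx y).1
  have hθl : Tendsto θ atTop (𝓝 s) :=
    h.tendsto_of_err hX hx hxl hyl (fun k => (hs k).err) hδ
  have hθ'l : Tendsto θ' atTop (𝓝 s) :=
    h.tendsto_of_err hX hx hxl hyl1 (fun k => (hs k).err') hδ
  have eX : ∀ᶠ k in atTop, xs k ∈ P.X := Eventually.of_forall hX
  have eY : ∀ᶠ k in atTop, ys k ∈ P.Y := Eventually.of_forall hY
  have eY1 : ∀ᶠ k in atTop, ys (k + 1) ∈ P.Y := Eventually.of_forall fun k => hY (k + 1)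
  have eθ' : ∀ᶠ k in atTop, θ' k ∈ P.Y := Eventually.of_forall fun k => (hs k).θ'_mem
  -- Step sizes stay away from zero, so the scaled increments in the optimality conditions vanish.
  have step_lim : ∀ {V : Type} [NormedAddCommGroup V] [NormedSpace ℝ V] {q : ℕ → V} {q₀ : V}
      {a : ℕ → ℝ} {alow : ℝ}, 0 < alow → (∀ k, alow ≤ a k) → Tendsto q atTop (𝓝 q₀) →
      Tendsto (fun k => (1 / a k) • (q k - q (k + 1))) atTop (𝓝 0) := by
    intro V _ _ q q₀ a alow h0 ha hq
    have h1 : Tendsto (fun k => 1 / alow * ‖q k - q (k + 1)‖) atTop (𝓝 0) := by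
      have := (hq.sub ((tendsto_add_atTop_iff_nat 1).2 hq)).norm.const_mul (1 / alow)
      simpa using this
    refine squeeze_zero_norm (fun k => ?_) h1
    have h2 : 0 < a k := h0.trans_le (ha k)
    rw [norm_smul, Real.norm_of_nonneg (by positivity)]
    exact mul_le_mul_of_nonneg_right (one_div_le_one_div_of_le h0 (ha k)) (norm_nonneg _)
  have gFX : Tendsto (fun k => gradX P.F (xs k) (ys (k + 1))) atTop (𝓝 (gradX P.F x y)) :=
    tendsto_of_lipschitz_box (k := gradX P.F) (C := M.LFx) (D := M.LFx)
      (fun x hx x' hx' y hy y' hy' => by rw [← mul_add]; exact hF.lip_left hx hx' hy hy')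
      eX eY1 hx hy hxl hyl1
  have gFY : Tendsto (fun k => gradY P.F (xs k) (ys k)) atTop (𝓝 (gradY P.F x y)) :=
    tendsto_of_lipschitz_box (k := gradY P.F) (C := M.LFy) (D := M.LFy)
      (fun x hx x' hx' y hy y' hy' => by rw [← mul_add]; exact hF.lip_right hx hx' hy hy')
      eX eY hx hy hxl hyl
  have gfY : Tendsto (fun k => gradY P.f (xs k) (ys k)) atTop (𝓝 (gradY P.f x y)) :=
    tendsto_of_lipschitz_box (k := gradY P.f) (C := M.Lfy) (D := M.Lfy)
      (fun x hx x' hx' y hy y' hy' => by rw [← mul_add]; exact h.lip_fY hx hx' hy hy')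
      eX eY hx hy hxl hyl
  set dx := (1 / p) • gradX P.F x y + P.phiX x y - P.phiX x s with hdx
  have hdxl : Tendsto (fun k => (1 / p) • gradX P.F (xs k) (ys (k + 1))
      + P.phiX (xs k) (ys (k + 1)) - P.phiX (xs k) (θ' k)) atTop (𝓝 dx) :=
    ((gFX.const_smul _).add (h.tendsto_phiX eX eY1 hx hy hxl hyl1)).sub
      (h.tendsto_phiX eX eθ' hx hsY hxl hθ'l)
  have hw : ∀ x' ∈ P.X, inner ℝ (-dx) (x' - x) ≤ 0 := by
    intro x' hx'
    have h1 : ∀ k, inner ℝ ((1 / α k) • (xs k - xs (k + 1))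
        - ((1 / p) • gradX P.F (xs k) (ys (k + 1)) + P.phiX (xs k) (ys (k + 1))
          - P.phiX (xs k) (θ' k))) (x' - xs (k + 1)) ≤ 0 := by
      intro k
      have hαk : 0 < α k := hαlow.trans_le (hα k)
      have e1 := (hs k).proj_le x' hx'
      set d := (1 / p) • gradX P.F (xs k) (ys (k + 1)) + P.phiX (xs k) (ys (k + 1))
          - P.phiX (xs k) (θ' k)
      have e2 : α k • ((1 / α k) • (xs k - xs (k + 1)) - d) = xs k - xs (k + 1) - α k • d := by
        rw [smul_sub (α k) _ d, smul_smul, mul_one_div_cancel hαk.ne', one_smul]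
      rw [show xs k - α k • d - xs (k + 1) = xs k - xs (k + 1) - α k • d by abel, ← e2,
        real_inner_smul_left] at e1
      exact nonpos_of_mul_nonpos_right e1 hαk
    have h2 := ((step_lim hαlow hα hxl).sub hdxl).inner (𝕜 := ℝ)
      ((tendsto_const_nhds (x := x')).sub hxl1)
    rw [zero_sub] at h2
    exact le_of_tendsto h2 (Eventually.of_forall h1)
  set dy := (1 / p) • gradY P.F x y + gradY P.f x y - (1 / γ) • (y - s) with hdy
  have hζ : ∀ y' ∈ P.Y, P.g x y + inner ℝ (-dy) (y' - y) ≤ P.g x y' := by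
    intro y' hy'
    have h1 := fun k => (hs k).prox_le y' hy'
    have h2 : Tendsto (fun k => (1 / p) • gradY P.F (xs k) (ys k) + gradY P.f (xs k) (ys k)
        - (1 / γ) • (ys k - θ k)) atTop (𝓝 dy) :=
      ((gFY.const_smul _).add gfY).sub ((hyl.sub hθl).const_smul _)
    have h3 := ((step_lim hβlow hβ hyl).sub h2).inner (𝕜 := ℝ)
      ((tendsto_const_nhds (x := y')).sub hyl1)
    rw [zero_sub] at h3
    have h4 := tendsto_of_continuousOn_box h.smooth.cont_g eX eY1 hx hy hxl hyl1
    have h5 := tendsto_of_continuousOn_box (ys := fun _ => y') h.smooth.cont_g eX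
      (Eventually.of_forall fun _ => hy') hx hy' hxl tendsto_const_nhds
    exact le_of_tendsto_of_tendsto' (h4.add h3) h5 h1
  -- The multiplier is the penalty parameter, and complementarity is automatic for a tolerance equal
  -- to the gap. The normal vector has zero second component, since normals of `Y` are already
  -- contained in `∂g`.
  refine ⟨⟨hx, hy⟩, le_rfl, p, hp.le, by simp, _, h.mem_subdiffG hx hy hζ, _,
    h.hasGradientWithinAt_vEnv hx y, pair (p • -dx) 0, ?_, ?_⟩
  · intro z hz
    rw [← pair_eta z, pair_sub, inner_pair, inner_zero_left, add_zero, real_inner_smul_left]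
    exact mul_nonpos_of_nonneg_of_nonpos hp.le (hw z.fst hz.1)
  · rw [gradient_onPair (hF.differentiableAt _), gradient_onPair (h.smooth.diff_f _ ⟨hx, hy⟩),
      ← hsdef]
    have e1 : gradX P.F x y + p • (gradX P.f x y + gradX P.g x y - P.phiX x s) + p • -dx = 0 := by
      have e3 : gradX P.f x y + gradX P.g x y - P.phiX x s = dx - (1 / p) • gradX P.F x y := by
        rw [hdx, ← phiX]; abel
      rw [e3, smul_sub, smul_smul, mul_one_div_cancel hp.ne', one_smul, smul_neg]
      abel
    have e2 : gradY P.F x y + p • (gradY P.f x y + -dy - (1 / γ) • (y - s)) + 0 = 0 := by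
      have e3 : gradY P.f x y + -dy - (1 / γ) • (y - s) = -((1 / p) • gradY P.F x y) := by
        rw [hdy]; abel
      rw [e3, smul_neg, smul_smul, mul_one_div_cancel hp.ne', one_smul, add_zero, add_neg_cancel]
    change pair (gradX P.F x y + p • (gradX P.f x y + gradX P.g x y - P.phiX x s) + p • -dx)
      (gradY P.F x y + p • (gradY P.f x y + -dy - (1 / γ) • (y - s)) + 0) = 0
    rw [e1, e2]
    rfl

end IsRegular

end BilevelProblem

/-! ### Properties of the iterates. -/

namespace Iterates

variable {n m : ℕ} {P : BilevelProblem n m} {M : Moduli} {A : Params} {I : Iterates n m}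

theorem IsAGILS.p_pos (hI : I.IsAGILS P A) (hA : A.Admissible M) (k : ℕ) : 0 < I.p k := by
  induction k with
  | zero => rw [hI.p_init]; exact hA.p0_pos
  | succ k ih =>
    have hϱ := hA.ϱp_pos
    by_cases hT : I.PenaltyTest P A k
    · rcases le_or_gt ‖I.y (k + 1) - I.θ (k + 1)‖ (A.cy * A.γ / I.p k) with hle | hlt
      · rw [(hI.case_two k hT hle).1]; linarith
      · obtain ⟨yc, -, θc, -, -, -, h | h⟩ := hI.case_three k hT hlt
        · rw [h.2.1]; exact ih
        · rw [h.2.1]; linarith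
    · rw [(hI.case_one k hT).1]; exact ih

theorem IsAGILS.isRegular (hI : I.IsAGILS P A) (hA : A.Admissible M) (hsets : P.ConvexSets)
    (hconv : P.LowerConvexAssumption) (hsmooth : P.LowerSmoothAssumption M) :
    P.IsRegular M A.γ :=
  ⟨hsets, hconv, hsmooth, ⟨_, hI.y_init⟩, hA.γ_pos, hA.γ_lt⟩

section Basic

variable {αlow βlow cα cβ : ℝ}

theorem IsAGILS.x_mem (hI : I.IsAGILS P A) (hsets : P.ConvexSets) (k : ℕ) : I.x k ∈ P.X := by
  cases k with
  | zero => exact hI.x_init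
  | succ k =>
    rw [hI.x_update]
    exact (proj_spec hsets.closed_X hsets.convex_X ⟨_, hI.x_init⟩ _).1

theorem IsAGILS.y_spec (hI : I.IsAGILS P A) (h : P.IsRegular M A.γ)
    (hstep : I.StepSizes A M αlow βlow cα cβ) (k : ℕ) :
    I.y (k + 1) ∈ P.Y ∧ ∀ y' ∈ P.Y, P.g (I.x k) (I.y (k + 1))
      + inner ℝ ((1 / A.β k) • (I.yt k - I.y (k + 1)) - I.dY P A k) (y' - I.y (k + 1))
      ≤ P.g (I.x k) y' := by
  have hx := hI.x_mem h.sets k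
  have hβ : 0 < A.β k := hstep.βlow_pos.trans_le (hstep.β_mem k).1
  have hcg : ContinuousOn (fun t => A.β k * P.g (I.x k) t) P.Y :=
    continuousOn_const.mul (BilevelProblem.IsRegular.continuousOn_slice h.smooth.cont_g hx)
  have hvg : ConvexOn ℝ P.Y (fun t => A.β k * P.g (I.x k) t) :=
    (h.lower.convex_g _ hx).smul hβ.le
  obtain ⟨h1, h2⟩ := prox_spec h.sets.closed_Y h.nonempty_Y hvg hcg
    (I.yt k - A.β k • I.dY P A k)
  rw [← hI.y_update] at h1 h2
  refine ⟨h1, fun y' hy' => ?_⟩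
  have h3 := h2 y' hy'
  set D := I.dY P A k
  have e1 : A.β k • ((1 / A.β k) • (I.yt k - I.y (k + 1)) - D)
      = I.yt k - A.β k • D - I.y (k + 1) := by
    rw [smul_sub (A.β k) _ D, smul_smul, mul_one_div_cancel hβ.ne', one_smul]
    abel
  rw [← e1, real_inner_smul_left, ← mul_add] at h3
  exact le_of_mul_le_mul_left h3 hβ

theorem IsAGILS.y_mem (hI : I.IsAGILS P A) (h : P.IsRegular M A.γ)
    (hstep : I.StepSizes A M αlow βlow cα cβ) (k : ℕ) : I.y k ∈ P.Y := by
  cases k with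
  | zero => exact hI.y_init
  | succ k => exact (hI.y_spec h hstep k).1

end Basic

theorem resid_nonneg (θ : Eu m) (x : Eu n) (y : Eu m) : 0 ≤ resid P A θ x y := norm_nonneg _

/-- The error bound for the inexact solutions with index `k + 1`. -/
noncomputable def tol (P : BilevelProblem n m) (A : Params) (I : Iterates n m) (k : ℕ) : ℝ :=
  A.s (k + 1) + A.τ (k + 1) * resid P A (I.θ k) (I.x k) (I.y k)

theorem τ_nonneg (hA : A.Admissible M) (k : ℕ) : 0 ≤ A.τ k :=
  div_nonneg hA.τ0_pos.le (Real.rpow_nonneg (by positivity) _)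

theorem tendsto_τ (hA : A.Admissible M) : Tendsto A.τ atTop (𝓝 0) := by
  have h1 : Tendsto (fun k : ℕ => ((k : ℝ) + 1) ^ A.pτ) atTop atTop :=
    (tendsto_rpow_atTop hA.pτ_pos).comp
      (tendsto_atTop_add_const_right _ _ tendsto_natCast_atTop_atTop)
  exact h1.const_div_atTop A.τ0

theorem le_tol_of_or (hA : A.Admissible M) {k : ℕ} {r : ℝ} (hr : r ≤ A.s (k + 1) ∨
    r ≤ A.τ (k + 1) * resid P A (I.θ k) (I.x k) (I.y k)) : r ≤ I.tol P A k := by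
  have h1 := hA.s_nonneg (k + 1)
  have h2 : 0 ≤ A.τ (k + 1) * resid P A (I.θ k) (I.x k) (I.y k) :=
    mul_nonneg (τ_nonneg hA _) (resid_nonneg _ _ _)
  rw [tol]
  rcases hr with hr | hr <;> linarith

theorem tol_nonneg (hA : A.Admissible M) (k : ℕ) : 0 ≤ I.tol P A k :=
  add_nonneg (hA.s_nonneg _) (mul_nonneg (τ_nonneg hA _) (resid_nonneg _ _ _))

/-- An accepted candidate may equal `y` while `θt` differs from `θ`, but its residual obeys the same
tolerance. -/
theorem IsAGILS.resid_θt_le (hI : I.IsAGILS P A) (hA : A.Admissible M) {k : ℕ}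
    (hy : I.yt (k + 1) = I.y (k + 1)) :
    resid P A (I.θt (k + 1)) (I.x (k + 1)) (I.y (k + 1)) ≤ I.tol P A k ∧
      I.θt (k + 1) ∈ P.Y := by
  have hkeep : I.Keep k → resid P A (I.θt (k + 1)) (I.x (k + 1)) (I.y (k + 1)) ≤ I.tol P A k ∧
      I.θt (k + 1) ∈ P.Y := fun hK => by
    rw [hK.2]
    exact ⟨le_tol_of_or hA (hI.θ_inexact k), hI.θ_mem k⟩
  by_cases hT : I.PenaltyTest P A k
  · rcases le_or_gt ‖I.y (k + 1) - I.θ (k + 1)‖ (A.cy * A.γ / I.p k) with hle | hlt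
    · exact hkeep (hI.case_two k hT hle).2
    · obtain ⟨yc, -, θc, hθc, -, hres, hc | hc⟩ := hI.case_three k hT hlt
      · obtain ⟨-, -, hyc, hθ⟩ := hc
        rw [hθ, ← hy, hyc]
        exact ⟨le_tol_of_or hA hres, hθc⟩
      · exact hkeep hc.2.2
  · exact hkeep (hI.case_one k hT).2

/-- The relative tolerances of `θt (k + 1)` and `θh (k + 1)` both refer to the residual at index
`k`, so one error sequence serves both. -/
theorem IsAGILS.inexactStep (hI : I.IsAGILS P A) (hA : A.Admissible M) (h : P.IsRegular M A.γ)
    {αlow βlow cα cβ : ℝ} (hstep : I.StepSizes A M αlow βlow cα cβ) {C : ℝ} (hC : 0 ≤ C)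
    (hCb : ∀ x ∈ P.X, ∀ θ ∈ P.Y, ∀ y : Eu m, ‖θ - P.envSol A.γ x y‖ ≤ C * resid P A θ x y)
    {p : ℝ} {k : ℕ} (hp : I.p (k + 1) = p) (hy : I.yt (k + 1) = I.y (k + 1)) :
    P.InexactStep A.γ p (A.α (k + 1)) (A.β (k + 1)) (C * I.tol P A k) (I.x (k + 1))
      (I.x (k + 1 + 1)) (I.y (k + 1)) (I.y (k + 1 + 1)) (I.θt (k + 1)) (I.θh (k + 1)) := by
  have hθt := hI.resid_θt_le hA hy
  refine ⟨hI.x_mem h.sets _, hI.x_mem h.sets _, hI.y_mem h hstep _, hI.y_mem h hstep _,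
    hI.θh_mem _, ?_, ?_, ?_, ?_⟩
  · have h1 := (hI.y_spec h hstep (k + 1)).2
    rwa [dY, hp, hy] at h1
  · have h1 := (proj_spec h.sets.closed_X h.sets.convex_X ⟨_, hI.x_init⟩
      (I.x (k + 1) - A.α (k + 1) • I.dX P (k + 1))).2
    rw [← hI.x_update, dX, hp] at h1
    simp only [BilevelProblem.phiX]
    rwa [← sub_sub _ (gradX P.f _ _)]
  · exact (hCb _ (hI.x_mem h.sets _) _ hθt.2 _).trans (mul_le_mul_of_nonneg_left hθt.1 hC)
  · exact (hCb _ (hI.x_mem h.sets _) _ (hI.θh_mem _) _).trans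
      (mul_le_mul_of_nonneg_left (le_tol_of_or hA (hI.θh_inexact (k + 1))) hC)

/-- The residual of the lower-level prox-gradient equation vanishes only at minimizers. -/
theorem _root_.BilevelProblem.IsRegular.phi_le_vEnv_of_tendsto {γ : ℝ} (h : P.IsRegular M γ)
    {ι : Type} {l : Filter ι} [l.NeBot] {xs : ι → Eu n} {ys : ι → Eu m} {x : Eu n} {y : Eu m}
    (hX : ∀ i, xs i ∈ P.X) (hY : ∀ i, ys i ∈ P.Y)
    (hxl : Tendsto xs l (𝓝 x)) (hyl : Tendsto ys l (𝓝 y))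
    (hres : Tendsto (fun i => ys i - prox P.Y (P.g (xs i)) (ys i - gradY P.f (xs i) (ys i))) l
      (𝓝 0)) : P.phi x y ≤ P.vEnv γ x y := by
  have hx : x ∈ P.X := h.sets.closed_X.mem_of_tendsto hxl (Eventually.of_forall hX)
  have hy : y ∈ P.Y := h.sets.closed_Y.mem_of_tendsto hyl (Eventually.of_forall hY)
  have hγ := h.γ_pos
  set q : ι → Eu m := fun i => prox P.Y (P.g (xs i)) (ys i - gradY P.f (xs i) (ys i)) with hq
  have hqs := fun i => prox_spec h.sets.closed_Y h.nonempty_Y (h.lower.convex_g _ (hX i))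
    (BilevelProblem.IsRegular.continuousOn_slice h.smooth.cont_g (hX i))
    (ys i - gradY P.f (xs i) (ys i))
  have hql : Tendsto q l (𝓝 y) := by
    have := hyl.sub hres
    simpa using this
  have eX : ∀ᶠ i in l, xs i ∈ P.X := Eventually.of_forall hX
  have gfY : Tendsto (fun i => gradY P.f (xs i) (ys i)) l (𝓝 (gradY P.f x y)) :=
    BilevelProblem.IsRegular.tendsto_of_lipschitz_box (k := gradY P.f) (C := M.Lfy) (D := M.Lfy)
      (fun x hx x' hx' y hy y' hy' => by rw [← mul_add]; exact h.lip_fY hx hx' hy hy')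
      eX (Eventually.of_forall hY) hx hy hxl hyl
  set s := P.envSol γ x y with hs
  have hsY : s ∈ P.Y := (h.envSol_spec hx y).1
  have h1 : P.g x y + inner ℝ (-gradY P.f x y) (s - y) ≤ P.g x s := by
    have h2 := ((hres.sub gfY).inner (𝕜 := ℝ) ((tendsto_const_nhds (x := s)).sub hql))
    rw [zero_sub] at h2
    have h4 := BilevelProblem.IsRegular.tendsto_of_continuousOn_box h.smooth.cont_g eX
      (Eventually.of_forall fun i => (hqs i).1) hx hy hxl hql
    have h5 := BilevelProblem.IsRegular.tendsto_of_continuousOn_box (ys := fun _ => s)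
      h.smooth.cont_g eX (Eventually.of_forall fun _ => hsY) hx hsY hxl tendsto_const_nhds
    refine le_of_tendsto_of_tendsto' (h4.add h2) h5 fun i => ?_
    have := (hqs i).2 s hsY
    rwa [sub_right_comm] at this
  have h2 := h.f_lower_right hx hy hsY
  rw [inner_neg_left] at h1
  have h3 := h.vEnv_eq hx y
  rw [← hs] at h3
  have h4 : 0 ≤ 1 / (2 * γ) * ‖s - y‖ ^ 2 := by positivity
  rw [h3]
  simp only [BilevelProblem.phi]
  linarith

/-- If the penalty parameter and the uncorrected iterates are kept, the limit is feasible. -/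
theorem IsAGILS.gap_le (hI : I.IsAGILS P A) (hA : A.Admissible M) (h : P.IsRegular M A.γ)
    {αlow βlow cα cβ : ℝ} (hstep : I.StepSizes A M αlow βlow cα cβ) {C : ℝ} (hC : 0 ≤ C)
    (hCb : ∀ x ∈ P.X, ∀ θ ∈ P.Y, ∀ y : Eu m, ‖θ - P.envSol A.γ x y‖ ≤ C * resid P A θ x y)
    {p : ℝ} (hev : ∀ᶠ k in atTop, I.p k = p ∧ I.yt k = I.y k)
    (htol : Tendsto (I.tol P A) atTop (𝓝 0)) {x : Eu n} {y : Eu m}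
    (hxl : Tendsto I.x atTop (𝓝 x)) (hyl : Tendsto I.y atTop (𝓝 y)) :
    P.phi x y - P.vEnv A.γ x y ≤ A.ε := by
  -- A gap above `ε` keeps the violation positive while steps vanish, so the penalty test eventually
  -- always passes. With `p` constant only accepted corrections remain, and `yt = y` makes `y` its
  -- own candidate, whose lower-level residual tends to zero.
  by_contra! hcon
  have hX := hI.x_mem h.sets
  have hY := hI.y_mem h hstep
  have hx : x ∈ P.X := h.sets.closed_X.mem_of_tendsto hxl (Eventually.of_forall hX)
  have hy : y ∈ P.Y := h.sets.closed_Y.mem_of_tendsto hyl (Eventually.of_forall hY)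
  have hxl1 := (tendsto_add_atTop_iff_nat 1).2 hxl
  have hyl1 := (tendsto_add_atTop_iff_nat 1).2 hyl
  have hp : 0 < p := by
    obtain ⟨k, hk⟩ := hev.exists
    rw [← hk.1]
    exact hI.p_pos hA k
  set s := P.envSol A.γ x y with hs
  have hsY : s ∈ P.Y := (h.envSol_spec hx y).1
  have hθl : Tendsto (fun k => I.θ (k + 1)) atTop (𝓝 s) := by
    refine h.tendsto_of_err (fun k => hX (k + 1)) hx hxl1 hyl1 (δ := fun k => C * I.tol P A k)
      (fun k => ?_) (by simpa using htol.const_mul C)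
    exact (hCb _ (hX _) _ (hI.θ_mem k) _).trans
      (mul_le_mul_of_nonneg_left (le_tol_of_or hA (hI.θ_inexact k)) hC)
  have eX : ∀ᶠ k in atTop, I.x (k + 1) ∈ P.X := Eventually.of_forall fun k => hX (k + 1)
  have eY : ∀ᶠ k in atTop, I.y (k + 1) ∈ P.Y := Eventually.of_forall fun k => hY (k + 1)
  have hviol : Tendsto (I.viol P A) atTop (𝓝 (P.phi x y - P.vEnv A.γ x y - A.ε)) := by
    have h1 := BilevelProblem.IsRegular.tendsto_of_continuousOn_box h.continuousOn_phi eX eY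
      hx hy hxl1 hyl1
    have h2 := BilevelProblem.IsRegular.tendsto_of_continuousOn_box h.continuousOn_phi eX
      (Eventually.of_forall hI.θ_mem) hx hsY hxl1 hθl
    have h3 := ((hθl.sub hyl1).norm.pow 2).const_mul (1 / (2 * A.γ))
    have h4 := (((h1.sub h2).sub h3).sub_const A.ε).max (tendsto_const_nhds (x := (0 : ℝ)))
    have h5 : max (P.phi x y - P.phi x s - 1 / (2 * A.γ) * ‖s - y‖ ^ 2 - A.ε) 0
        = P.phi x y - P.vEnv A.γ x y - A.ε := by
      rw [h.vEnv_eq hx, ← hs, max_eq_left]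
      · ring
      · rw [h.vEnv_eq hx, ← hs] at hcon
        linarith
    rw [h5] at h4
    exact h4
  have hlen : Tendsto (I.stepLen) atTop (𝓝 0) := by
    have h1 : Tendsto (fun k => pair (I.x (k + 1)) (I.y (k + 1)) - pair (I.x k) (I.y k)) atTop
        (𝓝 (pair x y - pair x y)) :=
      ((continuous_pair.tendsto (x, y)).comp (hxl1.prodMk_nhds hyl1)).sub
        ((continuous_pair.tendsto (x, y)).comp (hxl.prodMk_nhds hyl))
    rw [sub_self] at h1
    have h2 := h1.norm
    rw [norm_zero] at h2
    refine h2.congr' ?_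
    filter_upwards [hev] with k hk
    rw [stepLen, hk.2]
  have hmin : Tendsto (fun k => A.cp * min (1 / p) (I.viol P A k)) atTop
      (𝓝 (A.cp * min (1 / p) (P.phi x y - P.vEnv A.γ x y - A.ε))) :=
    ((tendsto_const_nhds (x := 1 / p)).min hviol).const_mul _
  have hpos : 0 < A.cp * min (1 / p) (P.phi x y - P.vEnv A.γ x y - A.ε) :=
    mul_pos hA.cp_pos (lt_min (by positivity) (by linarith))
  have htest : ∀ᶠ k in atTop, I.PenaltyTest P A k := by
    have h1 := hlen.eventually_lt hmin hpos
    filter_upwards [h1, hev] with k hk hk'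
    rw [PenaltyTest, hk'.1]
    exact hk
  have hres : ∀ᶠ k in atTop,
      ‖I.y (k + 1) - prox P.Y (P.g (I.x (k + 1)))
        (I.y (k + 1) - gradY P.f (I.x (k + 1)) (I.y (k + 1)))‖ ≤ A.cyt / p * I.stepLen k := by
    filter_upwards [htest, hev, (tendsto_add_atTop_nat 1).eventually hev] with k hT hk hk1
    have hϱ := hA.ϱp_pos
    rcases le_or_gt ‖I.y (k + 1) - I.θ (k + 1)‖ (A.cy * A.γ / I.p k) with hle | hlt
    · have := (hI.case_two k hT hle).1
      rw [hk.1, hk1.1] at this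
      linarith
    · obtain ⟨yc, -, θc, -, hyc, -, hc | hc⟩ := hI.case_three k hT hlt
      · rw [← hk1.2, hc.2.2.1]
        rwa [hk.1] at hyc
      · have := hc.2.1
        rw [hk.1, hk1.1] at this
        linarith
  have h1 := h.phi_le_vEnv_of_tendsto (fun k => hX (k + 1)) (fun k => hY (k + 1)) hxl1 hyl1
    (squeeze_zero_norm' hres (by simpa using hlen.const_mul (A.cyt / p)))
  linarith [hA.ε_pos]

end Iterates

/-! ### The convergence theorem. -/

set_option maxHeartbeats 2000000 in
open BilevelProblem Iterates in
theorem mainTheorem1 {n m : ℕ} (P : BilevelProblem n m) (M : Moduli) (Lgy : ℝ)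
    (hsets : P.ConvexSets)
    (hF : P.UpperAssumption M)
    (hconv : P.LowerConvexAssumption)
    (hsmooth : P.LowerSmoothAssumption M)
    (hLgy : P.SubdiffLipschitz Lgy)
    (A : Params) (hA : A.Admissible M)
    (I : Iterates n m) (hI : I.IsAGILS P A)
    (αlow βlow cα cβ : ℝ) (hstep : I.StepSizes A M αlow βlow cα cβ)
    (hs : Summable A.s)
    (ps : ℝ) (hps : ps < 2) (hs' : Summable fun k : ℕ => (k : ℝ) * A.s k ^ ps)
    (hbdd : Bornology.IsBounded (Set.range fun k => pair (I.x k) (I.y k)))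
    (pbar : ℝ)
    (hev : ∀ᶠ k in Filter.atTop, I.p k = pbar ∧ I.yt k = I.y k)
    (hKL : IsKLFunction (P.merit A.γ (M.ρf1 + M.ρg1 + cα / 4) pbar)) :
    ∃ zbar : Pair n m,
      Filter.Tendsto (fun k => pair (I.x k) (I.y k)) Filter.atTop (nhds zbar) ∧
      ∃ ε' : ℝ, 0 ≤ ε' ∧ ε' ≤ A.ε ∧ P.IsKKT A.γ ε' zbar := by
  have h := hI.isRegular hA hsets hconv hsmooth
  obtain ⟨C, hC, hCb⟩ := h.exists_error_bound rfl hA.η_pos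
  have hp : 0 < pbar := by
    obtain ⟨k, hk⟩ := hev.exists
    rw [← hk.1]
    exact hI.p_pos hA k
  obtain ⟨q, hq1, hq2, hqs⟩ := exists_weight_of_summable hA.s_nonneg hs hps hs'
  have hq0 : 0 ≤ q := by linarith
  have hwmono : Monotone fun k : ℕ => ((k : ℝ) + 1) ^ q := fun i j hij =>
    Real.rpow_le_rpow (by positivity) (by exact_mod_cast Nat.succ_le_succ hij) hq0
  -- Here `q ≤ 2` is used: the base at most doubles, so the weight at most quadruples.
  have hw4 : ∀ k : ℕ, (((k + 1 : ℕ) : ℝ) + 1) ^ q ≤ 4 * ((k : ℝ) + 1) ^ q := fun k => by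
    have h1 : (((k + 1 : ℕ) : ℝ) + 1) ^ q ≤ (2 * ((k : ℝ) + 1)) ^ q := by
      refine Real.rpow_le_rpow (by positivity) ?_ hq0
      push_cast
      have : (0 : ℝ) ≤ k := k.cast_nonneg
      linarith
    have h2 : (2 : ℝ) ^ q ≤ 2 ^ (2 : ℝ) := Real.rpow_le_rpow_of_exponent_le (by norm_num) hq2
    rw [Real.mul_rpow (by norm_num) (by positivity)] at h1
    exact h1.trans (mul_le_mul_of_nonneg_right (h2.trans (by norm_num)) (by positivity))
  obtain ⟨htol, hwtol⟩ := summable_relative_errors (c := fun k : ℕ => ((k : ℝ) + 1) ^ q)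
    (s := A.s) (τ := A.τ) (r := fun k => resid P A (I.θ k) (I.x k) (I.y k))
    (fun k => by positivity) hw4 hA.s_nonneg hs hqs (τ_nonneg hA) (tendsto_τ hA)
    (fun k => resid_nonneg _ _ _) (fun k => le_tol_of_or hA (hI.θ_inexact k))
  change Summable (I.tol P A) at htol
  change Summable fun k => (((k + 1 : ℕ) : ℝ) + 1) ^ q * I.tol P A k ^ 2 at hwtol
  have hwinv : Summable fun k : ℕ => (((k : ℝ) + 1) ^ q)⁻¹ := by
    have h1 := (summable_nat_add_iff 1).2 (Real.summable_nat_rpow_inv.2 hq1)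
    simpa using h1
  -- From `K` on the penalty is fixed and no iterate is corrected. Starting at `K + 1` lets each
  -- step use the tolerance formed from the preceding residual.
  obtain ⟨K, hK⟩ := eventually_atTop.1 hev
  have hst : ∀ k, P.InexactStep A.γ pbar (A.α (k + K + 1)) (A.β (k + K + 1))
      (C * I.tol P A (k + K)) (I.x (k + K + 1)) (I.x (k + K + 1 + 1)) (I.y (k + K + 1))
      (I.y (k + K + 1 + 1)) (I.θt (k + K + 1)) (I.θh (k + K + 1)) := fun k =>
    hI.inexactStep hA h hstep hC hCb (hK (k + K + 1) (by omega)).1 (hK (k + K + 1) (by omega)).2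
  obtain ⟨B, hB, hBs⟩ := h.exists_merit_subgradient hF hLgy hstep.cα_pos hp hstep.αlow_pos
    hstep.βlow_pos
  have hL1 := hsmooth.Lfx_nonneg
  have hL3 := hsmooth.Lg2_nonneg
  have hcα := hstep.cα_pos
  have hcβ := hstep.cβ_pos
  have hshift : ∀ k, k + 1 + K + 1 = k + K + 1 + 1 := fun k => by omega
  obtain ⟨zb, hzb, hzlim⟩ := h.exists_tendsto_of_KL hF hcα hp hKL
    (z := fun k => pair (I.x (k + K + 1)) (I.y (k + K + 1)))
    (fun k => ⟨hI.x_mem hsets _, hI.y_mem h hstep _⟩)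
    (hbdd.subset (by rintro _ ⟨k, rfl⟩; exact ⟨k + K + 1, rfl⟩))
    (e := fun k => C * I.tol P A (k + K)) (w := fun k => (((k + K + 1 : ℕ) : ℝ) + 1) ^ q)
    (a := min (cβ / 4) (cα / 8))
    (b := (1 / A.γ) ^ 2 / cβ + (M.Lfx + M.Lg2) ^ 2 / cα) (B := B)
    (lt_min (by positivity) (by positivity)) (by positivity)
    (fun k => mul_nonneg hC (tol_nonneg hA _)) (((summable_nat_add_iff K).2 htol).mul_left C)
    (fun k => by positivity) (fun i j hij => hwmono (by omega))
    ((summable_nat_add_iff (K + 1)).2 hwinv)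
    ((((summable_nat_add_iff K).2 hwtol).mul_left (C ^ 2)).congr fun k => by ring)
    (fun k => by
      have h1 := h.merit_descent hF hcα hcβ hp
        (hstep.αlow_pos.trans_le (hstep.α_mem _).1) (hstep.βlow_pos.trans_le (hstep.β_mem _).1)
        (by have := (hstep.α_mem (k + K + 1)).2; rwa [(hK (k + K + 1) (by omega)).1] at this)
        (by have := (hstep.β_mem (k + K + 1)).2; rwa [(hK (k + K + 1) (by omega)).1] at this)
        (hst k)
      simp only [hshift]
      exact h1)
    (fun k => by
      simp only [hshift]
      exact hBs (hstep.α_mem _).1 (hstep.β_mem _).1 (hst k))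
  have hlim : Tendsto (fun k => pair (I.x k) (I.y k)) atTop (𝓝 zb) :=
    (tendsto_add_atTop_iff_nat (K + 1)).1 hzlim
  have hxl : Tendsto I.x atTop (𝓝 zb.fst) := (continuous_pair_fst.tendsto zb).comp hlim
  have hyl : Tendsto I.y atTop (𝓝 zb.snd) := (continuous_pair_snd.tendsto zb).comp hlim
  refine ⟨zb, hlim, P.phi zb.fst zb.snd - P.vEnv A.γ zb.fst zb.snd,
    sub_nonneg.2 (h.vEnv_le_phi hzb.1 hzb.2),
    hI.gap_le hA h hstep hC hCb hev htol.tendsto_atTop_zero hxl hyl, ?_⟩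
  rw [← pair_eta zb]
  refine h.isKKT_of_tendsto hF hp hstep.αlow_pos hstep.βlow_pos
    (α := fun k => A.α (k + K + 1)) (β := fun k => A.β (k + K + 1))
    (δ := fun k => C * I.tol P A (k + K)) (xs := fun k => I.x (k + K + 1))
    (ys := fun k => I.y (k + K + 1)) (θ := fun k => I.θt (k + K + 1))
    (θ' := fun k => I.θh (k + K + 1))
    (fun k => (hstep.α_mem _).1) (fun k => (hstep.β_mem _).1)
    (fun k => by simp only [hshift]; exact hst k) ?_
    ((tendsto_add_atTop_iff_nat (K + 1)).2 hxl) ((tendsto_add_atTop_iff_nat (K + 1)).2 hyl)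
  have := ((summable_nat_add_iff K).2 htol).tendsto_atTop_zero.const_mul C
  rwa [mul_zero] at this
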